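/- Let $\Omega$ be a smooth compact connected Riemannian manifold of dimension $d\ge 2$ with smooth connected (nonempty) boundary $\partial\Omega$ and outward unit normal $N$. Let $|\Omega|$ and $|\partial\Omega|$ be the $d$- and $(d-1)$-dimensional Hausdorff measures of $\Omega$ and $\partial\Omega$, and let $\lambda_\Omega$, $\lambda_{\partial\Omega}$ be the corresponding normalised (probability) measures on $\Omega$ and $\partial\Omega$. For a probability measure $\mu$ write $\mathrm{Var}_\mu(f)=\int f^2\,d\mu-\left(\int f\,d\mu\right)^2$. Let $C_\Omega$ be the Neumann Poincaré constant of $\Omega$, i.e. the smallest constant $C$ such that $\mathrm{Var}_{\lambda_\Omega}(f)\le C\int_\Omega|\nabla f|^2\,d\lambda_\Omega$ for all $f\in C^1(\Omega)$, where $C^1(\Omega)$ denotes functions that are $C^1$ up to the boundary. Let $\rho\in C^1(\Omega)$ be such that $\frac{\partial\rho}{\partial N}=-1$ on $\partial\Omega$ and $\nabla\rho$ is Lipschitz continuous on $\Omega$. Then for every $f\in C^1(\Omega)$ $$\mathrm{Var}_{\lambda_{\partial\Omega}}(f)\le K_{\partial\Omega,\Omega}\int_\Omega|\nabla f|^2\,d\lambda_\Omega,\qquad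 K_{\partial\Omega,\Omega}=\frac{|\Omega|}{|\partial\Omega|}\left(2\,|\nabla\rho|_\infty\,C_\Omega^{1/2}+|(\Delta\rho)^-|_\infty\,C_\Omega\right),$$ where $\Delta\rho$ is the (almost everywhere defined, weak) Laplacian of $\rho$, $(\cdot)^-$ denotes the negative part, and $|\cdot|_\infty$ is the $L^\infty$-norm on $\Omega$ with respect to $\lambda_\Omega$. -/

import Mathlib

open MeasureTheory Set Manifold Bundle Topology
open scoped ContDiff ENNReal NNReal

noncomputable section

namespace BoundaryVariance

/-- The normalised `k`-dimensional Hausdorff measure on a subset `S` of a metric space. Here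
`μHE[k]` is the Hausdorff measure scaled so as to agree with Lebesgue measure on `ℝ^k`; on a
`k`-dimensional Riemannian (sub)manifold it is the Riemannian volume measure. -/
def normalizedHausdorff {M : Type*} [EMetricSpace M] [MeasurableSpace M] [BorelSpace M]
    (k : ℕ) (S : Set M) : Measure M :=
  ((μHE[k] : Measure M) S)⁻¹ • (μHE[k] : Measure M).restrict S

/-- `Var_μ(f) = ∫ f² dμ - (∫ f dμ)²`. -/
def var {M : Type*} [MeasurableSpace M] (μ : Measure M) (f : M → ℝ) : ℝ :=
  ∫ x, f x ^ 2 ∂μ - (∫ x, f x ∂μ) ^ 2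

section Riemannian

variable (d : ℕ) [NeZero d] {M : Type*} [EMetricSpace M] [ChartedSpace (EuclideanHalfSpace d) M]
  [RiemannianBundle (fun x : M ↦ TangentSpace (𝓡∂ d) x)]

instance finiteDimensional_tangentSpace (x : M) :
    FiniteDimensional ℝ (TangentSpace (𝓡∂ d) x) :=
  inferInstanceAs (FiniteDimensional ℝ (EuclideanSpace ℝ (Fin d)))

instance completeSpace_tangentSpace (x : M) : CompleteSpace (TangentSpace (𝓡∂ d) x) :=
  FiniteDimensional.complete ℝ _

/-- The Riemannian gradient `∇f(x) ∈ T_xM`: the vector representing the differential `df_x`. -/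
def grad (f : M → ℝ) (x : M) : TangentSpace (𝓡∂ d) x :=
  (InnerProductSpace.toDual ℝ (TangentSpace (𝓡∂ d) x)).symm
    (mfderiv (𝓡∂ d) 𝓘(ℝ, ℝ) f x : TangentSpace (𝓡∂ d) x →L[ℝ] ℝ)

/-- The outward pointing unit normal at a boundary point `x`. In the half-space chart around `x` the
manifold is `{y | 0 ≤ y 0}`, so that the outward normal is minus the normalised gradient of the
zeroth coordinate function. (Only meaningful at boundary points.) -/
def outwardNormal (x : M) : TangentSpace (𝓡∂ d) x :=
  -(‖grad d (fun y : M ↦ extChartAt (𝓡∂ d) x y 0) x‖⁻¹ •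
    grad d (fun y : M ↦ extChartAt (𝓡∂ d) x y 0) x)

/-- The outer normal derivative `∂f/∂N` at a boundary point. -/
def normalDeriv (f : M → ℝ) (x : M) : ℝ :=
  inner ℝ (grad d f x) (outwardNormal d x)

/-- Lipschitz continuity of a vector field (on a compact manifold): around every point, its
component vector in the tangent coordinates at that point is Lipschitz. -/
def IsLipschitzField [IsManifold (𝓡∂ d) 1 M] (V : ∀ x : M, TangentSpace (𝓡∂ d) x) : Prop :=
  ∀ x : M, ∃ K : ℝ≥0, ∃ U ∈ 𝓝 x, LipschitzOnWith K
    (fun y : M ↦ (trivializationAt (EuclideanSpace ℝ (Fin d))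
      (fun z : M ↦ TangentSpace (𝓡∂ d) z) x ⟨y, V y⟩).2) U

/-- The Dirichlet energy `∫ |∇f|² dμ`. -/
def energy [MeasurableSpace M] (μ : Measure M) (f : M → ℝ) : ℝ≥0∞ :=
  ∫⁻ x, ‖grad d f x‖ₑ ^ 2 ∂μ

/-- The Neumann Poincaré constant: the smallest `C ∈ [0, ∞]` with `Var_μ(f) ≤ C ∫ |∇f|² dμ` for
all `f ∈ C¹(M)` (`C¹` up to the boundary, without boundary conditions). -/
def poincareConst [MeasurableSpace M] (μ : Measure M) : ℝ≥0∞ :=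
  sInf {C : ℝ≥0∞ | ∀ f : M → ℝ, ContMDiff (𝓡∂ d) 𝓘(ℝ, ℝ) 1 f →
    ENNReal.ofReal (var μ f) ≤ C * energy d μ f}

variable [MeasurableSpace M] [BorelSpace M]

/-- `L` is the weak Laplacian of `u`:  `∫ L φ = -∫ ⟨∇u, ∇φ⟩` (with respect to the Riemannian
volume) for all `C¹` functions `φ` with compact support in the interior of the compact manifold
`M`. -/
def IsWeakLaplacian (u L : M → ℝ) : Prop :=
  Integrable L (μHE[d] : Measure M) ∧
  ∀ φ : M → ℝ, ContMDiff (𝓡∂ d) 𝓘(ℝ, ℝ) 1 φ → tsupport φ ⊆ (𝓡∂ d).interior M →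
    ∫ x, L x * φ x ∂(μHE[d] : Measure M) =
      -∫ x, (inner ℝ (grad d u x) (grad d φ x) : ℝ) ∂(μHE[d] : Measure M)

open Classical in
/-- The Laplacian `Δu`, as an almost everywhere defined function. It exists as soon as `∇u` is
Lipschitz, and is then almost everywhere the classical `div ∇u`. -/
def laplacian (u : M → ℝ) : M → ℝ :=
  if h : ∃ L : M → ℝ, IsWeakLaplacian d u L then h.choose else 0

variable (M) in
/-- The normalised volume measure `λ_Ω`. -/
def volΩ : Measure M := normalizedHausdorff d univ

variable (M) in
/-- The normalised Hausdorff measure `λ_∂Ω` on the boundary. -/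
def volBd : Measure M := normalizedHausdorff (d - 1) ((𝓡∂ d).boundary M)

/-- `K = (|Ω| / |∂Ω|) (2 |∇ρ|_∞ C_Ω^{1/2} + |(Δρ)⁻|_∞ C_Ω)`. -/
def traceConst (ρ : M → ℝ) : ℝ≥0∞ :=
  (μHE[d] : Measure M) univ / (μHE[d - 1] : Measure M) ((𝓡∂ d).boundary M) *
    (2 * eLpNorm (fun x ↦ ‖grad d ρ x‖) ∞ (volΩ d M) *
        poincareConst d (volΩ d M) ^ (1 / 2 : ℝ) +
      eLpNorm (fun x ↦ max (-laplacian d ρ x) 0) ∞ (volΩ d M) * poincareConst d (volΩ d M))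

end Riemannian

end BoundaryVariance

end

set_option linter.unusedSectionVars false

/-! Let `a` be the mean of `f` over Ω and `u = (f - a)^2`. Since the outer normal derivative of `ρ`
is -1, the divergence theorem for `u ∇ρ` reads `∫_∂Ω u = -∫_Ω (u Δρ + ⟨∇ρ, ∇u⟩)`. The first term on
the right is at most `|(Δρ)⁻|_∞ ∫ u`. As `∇u = 2 (f - a) ∇f`, Cauchy-Schwarz bounds the second by `2
|∇ρ|_∞ (∫ u)^(1/2) (∫ |∇f|^2)^(1/2)`. The Poincaré inequality bounds `∫ u`, and the left side,
divided by the boundary area, dominates the boundary variance whatever `a` is. This is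
`lintegral_boundary_sub_sq_le` followed by `ofReal_var_boundary_le`.

The weight of the proof is Green's formula with Hausdorff measures, a merely Lipschitz `∇ρ` and a
weak Laplacian. It rests on three facts.

Measures: near a point `p` the Riemannian distance differs from the norm of the coordinate
difference, taken in the metric frozen at `p`, by a factor close to 1 (`exists_edist_le`,
`exists_le_edist`). Hausdorff measure scales under Lipschitz maps, so it is the usual volume density
times Lebesgue measure in a chart (`euclideanHausdorffMeasure_restrict_source`). On the boundary
only the inequality "Hausdorff measure ≤ coordinate area" is needed (`lintegral_boundary_le`),
because Green's formula is applied to `u ≥ 0` and an upper bound for the boundary integral suffices.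

Local formula: in a chart the field `χ √g ∇ρ` is Lipschitz, and `exists_divergence_halfBall`
integrates it by parts over a half ball. The boundary flux is the boundary area density, by the
identity `√g |∇x⁰| = √(det of the tangential Gram matrix)` (`frameDensity_mul_norm_grad`) and the
normal derivative condition. A partition of unity globalises this (`exists_green`).

Identification: the divergence so constructed is a weak Laplacian, hence agrees almost everywhere in
the interior with the chosen one; a boundary of finite area is a null set for the volume
(`lintegral_boundary_le_laplacian`). -/

namespace BoundaryVariance

/-! ### Integration by parts on a Euclidean half-space for compactly supported Lipschitz functions.
-/

section HalfSpace

variable {n : ℕ}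

/-- The inclusion of the boundary hyperplane into Euclidean space. -/
noncomputable def bdIncl (n : ℕ) (z : EuclideanSpace ℝ (Fin n)) : EuclideanSpace ℝ (Fin (n + 1)) :=
  WithLp.toLp 2 (Fin.cons 0 z.ofLp)

/-- Splitting off the zeroth coordinate. -/
noncomputable def consPoint (n : ℕ) (p : ℝ × EuclideanSpace ℝ (Fin n)) :
    EuclideanSpace ℝ (Fin (n + 1)) :=
  WithLp.toLp 2 (Fin.cons p.1 p.2.ofLp)

@[simp] lemma consPoint_apply_zero (p : ℝ × EuclideanSpace ℝ (Fin n)) : consPoint n p 0 = p.1 := rfl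

@[simp] lemma consPoint_apply_succ (p : ℝ × EuclideanSpace ℝ (Fin n)) (i : Fin n) :
    consPoint n p i.succ = p.2 i := rfl

@[simp] lemma bdIncl_apply_zero (z : EuclideanSpace ℝ (Fin n)) : bdIncl n z 0 = 0 := rfl

@[simp] lemma bdIncl_apply_succ (z : EuclideanSpace ℝ (Fin n)) (i : Fin n) :
    bdIncl n z i.succ = z i := rfl

lemma consPoint_add_smul (s t : ℝ) (z : EuclideanSpace ℝ (Fin n)) :
    consPoint n (s, z) + t • EuclideanSpace.single 0 1 = consPoint n (s + t, z) := by
  ext i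
  refine Fin.cases ?_ (fun j => ?_) i <;> simp

lemma continuous_consPoint : Continuous (consPoint n) := by
  refine (PiLp.continuous_toLp 2 _).comp (continuous_pi fun i => ?_)
  refine Fin.cases ?_ (fun j => ?_) i
  · exact continuous_fst
  · simpa using! (by fun_prop : Continuous fun p : ℝ × EuclideanSpace ℝ (Fin n) => p.2 j)

/-- The linear inclusion of the boundary hyperplane. -/
noncomputable def bdInclₗ (n : ℕ) : EuclideanSpace ℝ (Fin n) →ₗᵢ[ℝ] EuclideanSpace ℝ (Fin (n + 1)) where
  toFun := bdIncl n
  map_add' x y := by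
    ext i
    refine Fin.cases ?_ (fun j => ?_) i <;> simp
  map_smul' c x := by
    ext i
    refine Fin.cases ?_ (fun j => ?_) i <;> simp
  norm_map' x := by
    simp [EuclideanSpace.norm_eq, Fin.sum_univ_succ]

@[simp] lemma bdInclₗ_apply (z : EuclideanSpace ℝ (Fin n)) : bdInclₗ n z = bdIncl n z := rfl

lemma isometry_bdIncl : Isometry (bdIncl n) := (bdInclₗ n).isometry

lemma bdIncl_single (i : Fin n) :
    bdIncl n (EuclideanSpace.single i 1) = EuclideanSpace.single i.succ 1 := by
  ext j
  refine Fin.cases ?_ (fun j => ?_) j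
  · simp [Fin.succ_ne_zero]
  · simp

lemma measurePreserving_consPoint : MeasurePreserving (consPoint n) volume volume := by
  have h1 := (EuclideanSpace.volume_preserving_symm_measurableEquiv_toLp (Fin n))
  have h2 : MeasurePreserving (Prod.map (id : ℝ → ℝ)
      (MeasurableEquiv.toLp 2 (Fin n → ℝ)).symm) volume volume :=
    (MeasurePreserving.id volume).prod h1
  have h3 := (volume_preserving_piFinSuccAbove (fun _ : Fin (n + 1) => ℝ) 0).symm
  have h4 := (PiLp.volume_preserving_toLp (Fin (n + 1)))
  have heq : consPoint n = (WithLp.toLp 2 ∘ (MeasurableEquiv.piFinSuccAbove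
      (fun _ : Fin (n + 1) => ℝ) 0).symm) ∘
        Prod.map (id : ℝ → ℝ) (MeasurableEquiv.toLp 2 (Fin n → ℝ)).symm := by
    ext p i
    refine Fin.cases ?_ (fun j => ?_) i <;> simp [consPoint, MeasurableEquiv.piFinSuccAbove]
  rw [heq]
  exact (h4.comp h3).comp h2

lemma injective_consPoint : Function.Injective (consPoint n) := by
  intro p q h
  have h0 := congrArg (fun y => y 0) h
  refine Prod.ext (by simpa using h0) ?_
  ext i
  simpa using congrArg (fun y => y i.succ) h

lemma measurableEmbedding_consPoint : MeasurableEmbedding (consPoint n) :=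
  continuous_consPoint.measurableEmbedding injective_consPoint

lemma isOpen_openHalfSpace : IsOpen {y : EuclideanSpace ℝ (Fin (n + 1)) | 0 < y 0} :=
  isOpen_lt continuous_const (by fun_prop)

lemma volume_hyperplane_eq_zero : volume {y : EuclideanSpace ℝ (Fin (n + 1)) | y 0 = 0} = 0 := by
  have hm : MeasurableSet {y : EuclideanSpace ℝ (Fin (n + 1)) | y 0 = 0} :=
    (isClosed_eq (by fun_prop) continuous_const).measurableSet
  rw [← measurePreserving_consPoint.measure_preimage hm.nullMeasurableSet]
  have : consPoint n ⁻¹' {y | y 0 = 0} = {(0 : ℝ)} ×ˢ univ := by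
    ext p; simp
  rw [this, Measure.volume_eq_prod, Measure.prod_prod]
  simp

section Integrals

variable {u : EuclideanSpace ℝ (Fin (n + 1)) → ℝ} {K : ℝ≥0}

lemma lineDeriv_eq_zero_of_notMem_tsupport {v y : EuclideanSpace ℝ (Fin (n + 1))}
    (hy : y ∉ tsupport u) : lineDeriv ℝ u y v = 0 := by
  have h := notMem_tsupport_iff_eventuallyEq.1 hy
  have : (fun t : ℝ => u (y + t • v)) =ᶠ[𝓝 0] fun _ => 0 := by
    have hc : ContinuousAt (fun t : ℝ => y + t • v) 0 := by fun_prop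
    have := hc.eventually (p := fun x => u x = 0) (by simp only [zero_smul, add_zero]; exact h)
    exact this
  rw [lineDeriv, this.deriv_eq]
  simp

lemma integrable_lineDeriv (hu : LipschitzWith K u) (hs : HasCompactSupport u)
    (v : EuclideanSpace ℝ (Fin (n + 1))) : Integrable (fun y => lineDeriv ℝ u y v) := by
  have h1 : IntegrableOn (fun y => lineDeriv ℝ u y v) (tsupport u) :=
    Measure.integrableOn_of_bounded hs.isCompact.measure_lt_top.ne
      (aestronglyMeasurable_lineDeriv hu.continuous _)
      (.of_forall fun y => norm_lineDeriv_le_of_lipschitz ℝ hu)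
  exact (integrableOn_iff_integrable_of_support_subset fun y hy => by
    by_contra h
    exact hy (lineDeriv_eq_zero_of_notMem_tsupport h)).1 h1

/-- A Lipschitz function is absolutely continuous, so the fundamental theorem of calculus applies on
an interval reaching beyond the support. -/
lemma integral_Ioi_deriv_of_lipschitz {g : ℝ → ℝ} (hg : LipschitzWith K g)
    (hs : HasCompactSupport g) : ∫ s in Ioi (0 : ℝ), deriv g s = -g 0 := by
  obtain ⟨R, hR⟩ := hs.isCompact.isBounded.subset_ball 0
  set R' := max R 1
  have hR' : ∀ s, R' ≤ s → s ∉ tsupport g := fun s hs' h => by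
    have := hR h
    rw [mem_ball_zero_iff, Real.norm_eq_abs] at this
    have h1 := le_abs_self s
    have h2 := le_max_left R 1
    linarith
  have hz : ∀ s, R' ≤ s → deriv g s = 0 := fun s hs' => by
    rw [(notMem_tsupport_iff_eventuallyEq.1 (hR' s hs')).deriv_eq]
    simp
  have h0 : (0 : ℝ) ≤ R' := by positivity
  rw [setIntegral_eq_of_subset_of_forall_sdiff_eq_zero measurableSet_Ioi
    (Ioc_subset_Ioi_self : Ioc 0 R' ⊆ Ioi 0) (fun s hs' => hz s (not_lt.1 fun h => hs'.2 ⟨hs'.1, h.le⟩)), ← intervalIntegral.integral_of_le h0,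
    (hg.lipschitzOnWith (s := uIcc 0 R')).absolutelyContinuousOnInterval.integral_deriv_eq_sub,
    image_eq_zero_of_notMem_tsupport (hR' R' le_rfl)]
  simp

/-- Fubini along the lines normal to the hyperplane reduces this to the one-dimensional formula.
This direction is the only source of a boundary term. -/
lemma integral_lineDeriv_zero (hu : LipschitzWith K u) (hs : HasCompactSupport u) :
    ∫ y in {y : EuclideanSpace ℝ (Fin (n + 1)) | 0 < y 0},
      lineDeriv ℝ u y (EuclideanSpace.single 0 1) = -∫ z, u (bdIncl n z) := by
  rw [← measurePreserving_consPoint.setIntegral_preimage_emb measurableEmbedding_consPoint]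
  have hset : consPoint n ⁻¹' {y | 0 < y 0} = Ioi (0 : ℝ) ×ˢ univ := by
    ext p; simp
  have hd : ∀ s z, lineDeriv ℝ u (consPoint n (s, z)) (EuclideanSpace.single 0 1) =
      deriv (fun s => u (consPoint n (s, z))) s := by
    intro s z
    simp only [lineDeriv, consPoint_add_smul]
    have := deriv_comp_const_add (f := fun s => u (consPoint n (s, z))) s 0
    simpa using this
  rw [hset, Measure.volume_eq_prod, ← Measure.prod_restrict, Measure.restrict_univ,
    integral_prod_symm, ← integral_neg]
  · congr 1
    ext z
    simp_rw [hd]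
    have hl : LipschitzWith 1 fun s : ℝ => consPoint n (s, z) := by
      refine LipschitzWith.of_dist_le_mul fun s t => ?_
      rw [EuclideanSpace.dist_eq]
      simp [Fin.sum_univ_succ, Real.sqrt_sq_eq_abs, Real.dist_eq]
    refine (integral_Ioi_deriv_of_lipschitz (K := K * 1) (hu.comp hl) ?_).trans ?_
    · refine hs.comp_isClosedEmbedding (g := fun s : ℝ => consPoint n (s, z)) ?_
      have hi : Isometry fun s : ℝ => consPoint n (s, z) := by
        refine Isometry.of_dist_eq fun s t => ?_
        rw [EuclideanSpace.dist_eq]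
        simp [Fin.sum_univ_succ, Real.sqrt_sq_eq_abs, Real.dist_eq]
      exact hi.isClosedEmbedding
    · rfl
  · have h1 : Integrable ((fun y => lineDeriv ℝ u y (EuclideanSpace.single 0 1)) ∘ consPoint n) :=
      (measurePreserving_consPoint.integrable_comp_emb measurableEmbedding_consPoint).2
        (integrable_lineDeriv hu hs _)
    have h2 := h1.mono_measure (Measure.restrict_le_self (s := Ioi (0 : ℝ) ×ˢ univ))
    rwa [Measure.volume_eq_prod, ← Measure.prod_restrict, Measure.restrict_univ] at h2

/-- The half-space is invariant under tangential translations, so the integral of the translate of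
`u` by `t • e` does not depend on `t`; differentiating under the integral at `t = 0` gives the
claim. -/
lemma integral_lineDeriv_succ (hu : LipschitzWith K u) (hs : HasCompactSupport u) (i : Fin n) :
    ∫ y in {y : EuclideanSpace ℝ (Fin (n + 1)) | 0 < y 0},
      lineDeriv ℝ u y (EuclideanSpace.single i.succ 1) = 0 := by
  set e : EuclideanSpace ℝ (Fin (n + 1)) := EuclideanSpace.single i.succ 1
  set H : Set (EuclideanSpace ℝ (Fin (n + 1))) := {y | 0 < y 0}
  have hconst : ∀ t : ℝ, ∫ y in H, u (y + t • e) = ∫ y in H, u y := by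
    intro t
    have h := (measurePreserving_add_right volume (t • e)).setIntegral_preimage_emb
      (measurableEmbedding_addRight _) u H
    have hH : (fun y => y + t • e) ⁻¹' H = H := by
      ext y
      simp [H, e, (Fin.succ_ne_zero i).symm]
    rw [hH] at h
    exact h
  have hi : Integrable u := hu.continuous.integrable_of_hasCompactSupport hs
  obtain ⟨R, hR⟩ := hs.isCompact.isBounded.subset_closedBall 0
  -- Translations by `t • e` with `|t| < 1` move the support by at most `‖e‖`, so this ball contains
  -- all supports and carries the dominating function.
  set B := Metric.closedBall (0 : EuclideanSpace ℝ (Fin (n + 1))) (R + ‖e‖)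
  have hzero : ∀ y ∉ B, ∀ t ∈ Metric.ball (0 : ℝ) 1, u (y + t • e) = 0 := by
    intro y hy t ht
    refine image_eq_zero_of_notMem_tsupport fun h => hy ?_
    have h1 := hR h
    rw [mem_closedBall_zero_iff] at h1 ⊢
    rw [mem_ball_zero_iff] at ht
    calc ‖y‖ = ‖(y + t • e) - t • e‖ := by simp
      _ ≤ ‖y + t • e‖ + ‖t • e‖ := norm_sub_le _ _
      _ ≤ R + ‖e‖ := by
        rw [norm_smul]
        nlinarith [norm_nonneg e]
  have key := hasDerivAt_integral_of_dominated_loc_of_lip (μ := volume.restrict H) (𝕜 := ℝ)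
    (F := fun t y => u (y + t • e)) (F' := fun y => lineDeriv ℝ u y e)
    (bound := B.indicator fun _ => (K : ℝ) * ‖e‖) (x₀ := 0) (s := Metric.ball 0 1)
    (Metric.ball_mem_nhds _ one_pos)
    (.of_forall fun t => (hu.continuous.comp (by fun_prop)).aestronglyMeasurable)
    (by simpa using hi.restrict)
    (aestronglyMeasurable_lineDeriv hu.continuous _)
    (.of_forall fun y => ?_) ?_ ?_
  · have h2 := key.2
    simp_rw [hconst] at h2
    exact h2.unique (hasDerivAt_const _ _)
  · by_cases hy : y ∈ B
    · have : LipschitzWith (K * ‖e‖₊) fun t : ℝ => u (y + t • e) := by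
        refine hu.comp (LipschitzWith.of_dist_le_mul fun s t => ?_)
        rw [dist_add_left, dist_eq_norm, ← sub_smul, norm_smul, mul_comm, dist_eq_norm]
        rfl
      simp only [hy, indicator_of_mem]
      convert this.lipschitzOnWith using 1
      ext
      simp
    · refine LipschitzOnWith.of_dist_le_mul fun s hs' t ht => ?_
      rw [hzero y hy s hs', hzero y hy t ht]
      simp [hy]
  · refine (integrable_indicator_iff Metric.isClosed_closedBall.measurableSet).2 ?_
    refine integrableOn_const ?_
    exact ((Measure.restrict_apply_le _ _).trans_lt
      (isCompact_closedBall _ _).measure_lt_top).ne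
  · filter_upwards [ae_restrict_of_ae (hu.ae_lineDifferentiableAt (μ := volume) e)] with y hy
    exact hy.hasDerivAt

end Integrals
end HalfSpace
end BoundaryVariance

namespace BoundaryVariance

/-! ### Green's formula on a half ball. -/

section HalfSpaceGreen

/-- The factor `g` may be unbounded; only its values on the ball outside which `b` vanishes matter,
and there it is bounded. -/
lemma exists_lipschitzWith_mul {E : Type*} [NormedAddCommGroup E] {g b : E → ℝ} {K K' : ℝ≥0}
    {B r : ℝ} {c : E} (hg : LipschitzWith K g) (hb : LipschitzWith K' b) (hB : ∀ y, |b y| ≤ B)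
    (h0 : ∀ y ∉ Metric.ball c r, b y = 0) :
    (∃ C : ℝ≥0, LipschitzWith C fun y => g y * b y) ∧ ∃ A, ∀ y, |g y * b y| ≤ A := by
  have hB0 : 0 ≤ B := (abs_nonneg _).trans (hB c)
  have hgM : ∀ y ∈ Metric.ball c r, |g y| ≤ |g c| + K * |r| := by
    intro y hy
    have h1 := hg.dist_le_mul y c
    rw [Real.dist_eq] at h1
    have h2 : dist y c ≤ |r| := (le_of_lt hy).trans (le_abs_self r)
    have h3 : |g y| ≤ |g y - g c| + |g c| := by
      simpa using abs_add_le (g y - g c) (g c)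
    have h4 : (K : ℝ) * dist y c ≤ K * |r| := by gcongr
    linarith
  set A := |g c| + K * |r|
  have hA : 0 ≤ A := by positivity
  have key : ∀ x y, x ∈ Metric.ball c r →
      |g x * b x - g y * b y| ≤ (A * K' + K * B) * dist x y := by
    intro x y hx
    have h1 := hg.dist_le_mul x y
    have h2 := hb.dist_le_mul x y
    rw [Real.dist_eq] at h1 h2
    calc |g x * b x - g y * b y| = |g x * (b x - b y) + (g x - g y) * b y| := by ring_nf
      _ ≤ |g x| * |b x - b y| + |g x - g y| * |b y| := by
        rw [← abs_mul, ← abs_mul]; exact abs_add_le _ _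
      _ ≤ A * (K' * dist x y) + (K * dist x y) * B := by
        gcongr
        · exact hgM x hx
        · exact hB y
      _ = _ := by ring
  refine ⟨⟨⟨A * K' + K * B, by positivity⟩, LipschitzWith.of_dist_le_mul fun x y => ?_⟩,
    A * B, fun y => ?_⟩
  · rw [Real.dist_eq]
    by_cases hx : x ∈ Metric.ball c r
    · exact key x y hx
    by_cases hy : y ∈ Metric.ball c r
    · rw [abs_sub_comm, dist_comm]
      exact key y x hy
    · rw [h0 x hx, h0 y hy]
      simp only [mul_zero, sub_self, abs_zero]
      exact mul_nonneg (NNReal.coe_nonneg _) dist_nonneg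
  · by_cases hy : y ∈ Metric.ball c r
    · rw [abs_mul]
      gcongr
      · exact hgM y hy
      · exact hB y
    · rw [h0 y hy]
      simp only [mul_zero, abs_zero]
      positivity

/-- A Lipschitz function on a piece of a ball which vanishes off the concentric ball of half the
radius extends to a bounded Lipschitz function with support in the ball. -/
lemma exists_lipschitz_extension {E : Type*} [NormedAddCommGroup E] {c : E} {r : ℝ} (hr : 0 < r)
    {S : Set E} {f : E → ℝ} {K : ℝ≥0} (hf : LipschitzOnWith K f (Metric.ball c r ∩ S))
    (h0 : ∀ y ∈ Metric.ball c r ∩ S, y ∉ Metric.ball c (r / 2) → f y = 0) :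
    ∃ F : E → ℝ, (∃ C, LipschitzWith C F) ∧ (∃ A, ∀ y, |F y| ≤ A) ∧
      (∀ y ∉ Metric.ball c (3 * r / 4), F y = 0) ∧ EqOn F f (Metric.ball c r ∩ S) := by
  obtain ⟨g, hg, hgf⟩ := hf.extend_real
  -- A cutoff linear in the distance: 1 up to radius `r / 2`, 0 from radius `3 r / 4` on. The gap up
  -- to `r` keeps the closed support inside the open ball.
  have hb : LipschitzWith (Real.toNNReal (4 / r))
      fun y : E => max 0 (min 1 (3 - 4 / r * dist y c)) := by
    refine LipschitzWith.const_max (LipschitzWith.const_min ?_ 1) 0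
    refine LipschitzWith.of_dist_le_mul fun x y => ?_
    rw [Real.coe_toNNReal _ (by positivity), Real.dist_eq]
    have h1 := abs_dist_sub_le x y c
    calc |3 - 4 / r * dist x c - (3 - 4 / r * dist y c)|
        = |4 / r * -(dist x c - dist y c)| := by ring_nf
      _ = 4 / r * |dist x c - dist y c| := by
        rw [abs_mul, abs_neg, abs_of_nonneg (by positivity)]
      _ ≤ _ := by gcongr
  have hbz : ∀ y ∉ Metric.ball c (3 * r / 4), max 0 (min 1 (3 - 4 / r * dist y c)) = 0 := by
    intro y hy
    rw [Metric.mem_ball, not_lt] at hy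
    have : 3 ≤ 4 / r * dist y c := by
      calc (3 : ℝ) = 4 / r * (3 * r / 4) := by field_simp
        _ ≤ _ := by gcongr
    refine max_eq_left ((min_le_right _ _).trans (by linarith))
  have hb1 : ∀ y ∈ Metric.ball c (r / 2), max 0 (min 1 (3 - 4 / r * dist y c)) = 1 := by
    intro y hy
    have : 4 / r * dist y c ≤ 2 := by
      calc 4 / r * dist y c ≤ 4 / r * (r / 2) := by gcongr; exact (Metric.mem_ball.1 hy).le
        _ = 2 := by field_simp; norm_num
    rw [min_eq_left (by linarith)]
    norm_num
  have hB : ∀ y : E, |max 0 (min 1 (3 - 4 / r * dist y c))| ≤ 1 := by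
    intro y
    rw [abs_of_nonneg (le_max_left _ _)]
    exact max_le zero_le_one (min_le_left _ _)
  obtain ⟨hC, hA⟩ := exists_lipschitzWith_mul hg hb hB hbz
  refine ⟨_, hC, hA, fun y hy => by rw [hbz y hy, mul_zero], fun y hy => ?_⟩
  by_cases h : y ∈ Metric.ball c (r / 2)
  · simp only [hb1 y h, mul_one, hgf hy]
  · simp only [← hgf hy, h0 y hy h, zero_mul]

variable {n : ℕ}

lemma hasCompactSupport_of_ball {E : Type*} [NormedAddCommGroup E] [NormedSpace ℝ E]
    [FiniteDimensional ℝ E] {F : E → ℝ} {c : E} {r : ℝ}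
    (h : ∀ y ∉ Metric.ball c r, F y = 0) : HasCompactSupport F := by
  have := FiniteDimensional.proper ℝ E
  exact HasCompactSupport.intro (isCompact_closedBall c r)
    fun y hy => h y fun h' => hy (Metric.ball_subset_closedBall h')

/-- Green's formula on a half ball for Lipschitz vector fields vanishing near the spherical part of
the boundary. -/
theorem exists_divergence_halfBall {c : EuclideanSpace ℝ (Fin (n + 1))} {r : ℝ} (hr : 0 < r)
    {X : Fin (n + 1) → EuclideanSpace ℝ (Fin (n + 1)) → ℝ}
    (hX : ∀ i, ∃ K, LipschitzOnWith K (X i) (Metric.ball c r ∩ {y | 0 ≤ y 0}))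
    (h0 : ∀ i, ∀ y ∈ Metric.ball c r ∩ {y | 0 ≤ y 0}, y ∉ Metric.ball c (r / 2) → X i y = 0) :
    ∃ D : EuclideanSpace ℝ (Fin (n + 1)) → ℝ, Measurable D ∧ (∃ A, ∀ y, |D y| ≤ A) ∧
      (∀ y ∉ Metric.ball c r, D y = 0) ∧
      ∀ h : EuclideanSpace ℝ (Fin (n + 1)) → ℝ,
        (∃ K, LipschitzOnWith K h (Metric.ball c r ∩ {y | 0 ≤ y 0})) →
        (∀ y ∈ Metric.ball c r ∩ {y | 0 < y 0}, DifferentiableAt ℝ h y) →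
        ∫ y in Metric.ball c r ∩ {y | 0 < y 0},
          (D y * h y + ∑ i, X i y * fderiv ℝ h y (EuclideanSpace.single i 1)) =
        -∫ z in bdIncl n ⁻¹' Metric.ball c r, X 0 (bdIncl n z) * h (bdIncl n z) := by
  choose K hX using hX
  choose F hFL hFB hF0 hFX using fun i => exists_lipschitz_extension hr (hX i) (h0 i)
  choose C hFL using hFL
  choose A hFB using hFB
  have hFr : ∀ i, ∀ y ∉ Metric.ball c r, F i y = 0 := fun i y hy =>
    hF0 i y fun h => hy (Metric.ball_subset_ball (by linarith) h)
  have hts : ∀ i, tsupport (F i) ⊆ Metric.ball c r := by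
    intro i
    refine (closure_minimal (fun y hy => ?_) Metric.isClosed_closedBall).trans
      (Metric.closedBall_subset_ball (show 3 * r / 4 < r by linarith))
    by_contra h
    exact hy (hF0 i y fun h' => h (Metric.ball_subset_closedBall h'))
  -- The divergence is built from line derivatives of the extended field: these are defined
  -- everywhere, measurable and bounded by the Lipschitz constants, and are genuine derivatives
  -- almost everywhere.
  refine ⟨fun y => ∑ i, lineDeriv ℝ (F i) y (EuclideanSpace.single i 1),
    Finset.measurable_sum _ fun i _ => measurable_lineDeriv (hFL i).continuous,
    ⟨∑ i, C i * ‖(EuclideanSpace.single i 1 : EuclideanSpace ℝ (Fin (n + 1)))‖, fun y => ?_⟩,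
    fun y hy => Finset.sum_eq_zero fun i _ =>
      lineDeriv_eq_zero_of_notMem_tsupport fun h => hy (hts i h), ?_⟩
  · exact (Finset.abs_sum_le_sum_abs _ _).trans
      (Finset.sum_le_sum fun i _ => norm_lineDeriv_le_of_lipschitz ℝ (hFL i))
  rintro h ⟨Kh, hh⟩ hd
  -- A global extension of `h` makes each `g * F i` Lipschitz with compact support, so the
  -- half-space formulas apply; nothing outside the half ball contributes.
  obtain ⟨g, hg, hgh⟩ := hh.extend_real
  set H : Set (EuclideanSpace ℝ (Fin (n + 1))) := {y | 0 < y 0}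
  have hsub : Metric.ball c r ∩ H ⊆ Metric.ball c r ∩ {y | 0 ≤ y 0} :=
    inter_subset_inter_right _ fun y (hy : 0 < y 0) => hy.le
  have hopen : IsOpen (Metric.ball c r ∩ H) := Metric.isOpen_ball.inter isOpen_openHalfSpace
  choose C' hL using fun i => (exists_lipschitzWith_mul hg (hFL i) (hFB i) (hFr i)).1
  have hcs : ∀ i, HasCompactSupport fun y => g y * F i y := fun i =>
    hasCompactSupport_of_ball (c := c) (r := r) fun y hy => by rw [hFr i y hy, mul_zero]
  have hsum : ∫ y in H, ∑ i, lineDeriv ℝ (fun y => g y * F i y) y (EuclideanSpace.single i 1) =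
      -∫ z, g (bdIncl n z) * F 0 (bdIncl n z) := by
    rw [integral_finsetSum _ fun i _ => (integrable_lineDeriv (hL i) (hcs i) _).integrableOn,
      Fin.sum_univ_succ, integral_lineDeriv_zero (hL 0) (hcs 0),
      Finset.sum_eq_zero fun i _ => integral_lineDeriv_succ (hL i.succ) (hcs i.succ) i, add_zero]
  have hR : ∫ z in bdIncl n ⁻¹' Metric.ball c r, X 0 (bdIncl n z) * h (bdIncl n z) =
      ∫ z, g (bdIncl n z) * F 0 (bdIncl n z) := by
    have e0 : ∀ z ∉ bdIncl n ⁻¹' Metric.ball c r, g (bdIncl n z) * F 0 (bdIncl n z) = 0 :=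
      fun z hz => by rw [hFr 0 _ hz, mul_zero]
    rw [← setIntegral_eq_integral_of_forall_compl_eq_zero e0]
    refine setIntegral_congr_fun (isometry_bdIncl.continuous.measurable
      Metric.isOpen_ball.measurableSet) fun z hz => ?_
    have hz' : bdIncl n z ∈ Metric.ball c r ∩ {y | 0 ≤ y 0} := ⟨hz, (bdIncl_apply_zero z).ge⟩
    simp only [hFX 0 hz', hgh hz']
    ring
  rw [hR, ← hsum]
  rw [setIntegral_eq_of_subset_of_forall_sdiff_eq_zero isOpen_openHalfSpace.measurableSet
    (inter_subset_right : Metric.ball c r ∩ H ⊆ H)]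
  · refine setIntegral_congr_ae hopen.measurableSet ?_
    -- Almost everywhere line differentiability of Lipschitz functions allows the product rule
    -- pointwise.
    have h1 : ∀ i, ∀ᵐ y : EuclideanSpace ℝ (Fin (n + 1)),
        LineDifferentiableAt ℝ (F i) y (EuclideanSpace.single i 1) :=
      fun i => (hFL i).ae_lineDifferentiableAt _
    filter_upwards [eventually_countable_forall.2 h1] with y hy hyS
    rw [Finset.sum_mul, ← Finset.sum_add_distrib]
    refine Finset.sum_congr rfl fun i _ => ?_
    have e1 : HasFDerivAt g (fderiv ℝ h y) y := by
      refine (hd y hyS).hasFDerivAt.congr_of_eventuallyEq ?_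
      filter_upwards [hopen.mem_nhds hyS] with x hx using (hgh (hsub hx)).symm
    have e2 := e1.hasLineDerivAt (EuclideanSpace.single i 1)
    have e3 := (hy i).hasLineDerivAt
    have e4 : HasLineDerivAt ℝ (fun y => g y * F i y) _ y (EuclideanSpace.single i 1) :=
      HasDerivAt.mul e2 e3
    rw [e4.lineDeriv, zero_smul, add_zero, hFX i (hsub hyS), hgh (hsub hyS)]
    ring
  · rintro y ⟨hyH, hy⟩
    refine Finset.sum_eq_zero fun i _ => lineDeriv_eq_zero_of_notMem_tsupport fun hy' => hy
      ⟨hts i (closure_mono (Function.support_mul_subset_right _ _) hy'), hyH⟩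

end HalfSpaceGreen
end BoundaryVariance

namespace BoundaryVariance

/-! ### Coordinate frames of a chart and continuity of the metric in them. -/

section Frame

variable (d : ℕ) [NeZero d] {M : Type*} [EMetricSpace M]
  [ChartedSpace (EuclideanHalfSpace d) M] [IsManifold (𝓡∂ d) 1 M]

/-- The coordinate frame of the chart at `x₀` in the tangent space at `p`. -/
noncomputable def frameMap (x₀ p : M) : EuclideanSpace ℝ (Fin d) →L[ℝ] TangentSpace (𝓡∂ d) p :=
  (trivializationAt (EuclideanSpace ℝ (Fin d)) (fun z : M ↦ TangentSpace (𝓡∂ d) z) x₀).symmL ℝ p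

/-- The components of a tangent vector at `p` in the chart at `x₀`. -/
noncomputable def coordMap (x₀ p : M) : TangentSpace (𝓡∂ d) p →L[ℝ] EuclideanSpace ℝ (Fin d) :=
  (trivializationAt (EuclideanSpace ℝ (Fin d))
    (fun z : M ↦ TangentSpace (𝓡∂ d) z) x₀).continuousLinearMapAt ℝ p

variable {d} {x₀ p : M}

lemma mem_baseSet (hp : p ∈ (extChartAt (𝓡∂ d) x₀).source) :
    p ∈ (trivializationAt (EuclideanSpace ℝ (Fin d))
      (fun z : M ↦ TangentSpace (𝓡∂ d) z) x₀).baseSet := by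
  rw [extChartAt_source] at hp
  rwa [TangentBundle.trivializationAt_baseSet]

lemma coordMap_frameMap (hp : p ∈ (extChartAt (𝓡∂ d) x₀).source) (v : EuclideanSpace ℝ (Fin d)) :
    coordMap d x₀ p (frameMap d x₀ p v) = v :=
  Trivialization.continuousLinearMapAt_symmL _ (mem_baseSet hp) v

lemma frameMap_coordMap (hp : p ∈ (extChartAt (𝓡∂ d) x₀).source) (v : TangentSpace (𝓡∂ d) p) :
    frameMap d x₀ p (coordMap d x₀ p v) = v :=
  Trivialization.symmL_continuousLinearMapAt _ (mem_baseSet hp) v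

lemma coordMap_eq_mfderiv (hp : p ∈ (extChartAt (𝓡∂ d) x₀).source) :
    coordMap d x₀ p = (mfderiv (𝓡∂ d) 𝓘(ℝ, EuclideanSpace ℝ (Fin d)) (extChartAt (𝓡∂ d) x₀) p :
      TangentSpace (𝓡∂ d) p →L[ℝ] EuclideanSpace ℝ (Fin d)) := by
  rw [extChartAt_source] at hp
  exact TangentBundle.continuousLinearMapAt_trivializationAt hp

lemma frameMap_eq_mfderivWithin (hp : p ∈ (extChartAt (𝓡∂ d) x₀).source)
    (v : EuclideanSpace ℝ (Fin d)) :
    frameMap d x₀ p v = (mfderivWithin 𝓘(ℝ, EuclideanSpace ℝ (Fin d)) (𝓡∂ d)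
      (extChartAt (𝓡∂ d) x₀).symm (range (𝓡∂ d)) (extChartAt (𝓡∂ d) x₀ p) v :
        EuclideanSpace ℝ (Fin d)) := by
  rw [extChartAt_source] at hp
  exact congr($(TangentBundle.symmL_trivializationAt (I := 𝓡∂ d) hp) v)

lemma trivializationAt_snd_eq_coordMap (hp : p ∈ (extChartAt (𝓡∂ d) x₀).source)
    (v : TangentSpace (𝓡∂ d) p) :
    (trivializationAt (EuclideanSpace ℝ (Fin d))
      (fun z : M ↦ TangentSpace (𝓡∂ d) z) x₀ ⟨p, v⟩).2 = coordMap d x₀ p v :=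
  (Trivialization.continuousLinearMapAt_apply_of_mem ℝ _ (mem_baseSet hp) v).symm

variable [RiemannianBundle (fun x : M ↦ TangentSpace (𝓡∂ d) x)]

variable (d) in
/-- The Gram matrix of the coordinate frame. -/
noncomputable def metricMatrix (x₀ p : M) : Matrix (Fin d) (Fin d) ℝ :=
  Matrix.of fun i j => inner ℝ (frameMap d x₀ p (EuclideanSpace.single i 1))
    (frameMap d x₀ p (EuclideanSpace.single j 1))

lemma inner_frameMap (v w : EuclideanSpace ℝ (Fin d)) :
    inner ℝ (frameMap d x₀ p v) (frameMap d x₀ p w) =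
      ∑ i, ∑ j, v i * w j * metricMatrix d x₀ p i j := by
  have hv : ∀ v : EuclideanSpace ℝ (Fin d), frameMap d x₀ p v =
      ∑ i, v i • frameMap d x₀ p (EuclideanSpace.single i 1) := by
    intro v
    conv_lhs => rw [← (EuclideanSpace.basisFun (Fin d) ℝ).sum_repr v]
    simp [map_sum]
  rw [hv v, hv w, sum_inner]
  refine Finset.sum_congr rfl fun i _ => ?_
  rw [inner_sum]
  refine Finset.sum_congr rfl fun j _ => ?_
  rw [real_inner_smul_left, real_inner_smul_right, metricMatrix, Matrix.of_apply]
  ring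

end Frame

section Smooth

variable {d : ℕ} [NeZero d] {M : Type*} [EMetricSpace M]
  [ChartedSpace (EuclideanHalfSpace d) M] [IsManifold (𝓡∂ d) ∞ M]
  [RiemannianBundle (fun x : M ↦ TangentSpace (𝓡∂ d) x)]
  [IsContMDiffRiemannianBundle (𝓡∂ d) 1 (EuclideanSpace ℝ (Fin d))
    (fun x : M ↦ TangentSpace (𝓡∂ d) x)]

variable {x₀ p : M}

lemma contMDiffOn_metricMatrix (x₀ : M) (i j : Fin d) :
    ContMDiffOn (𝓡∂ d) 𝓘(ℝ, ℝ) 1 (fun p => metricMatrix d x₀ p i j)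
      (extChartAt (𝓡∂ d) x₀).source := by
  have h : ∀ i : Fin d, ContMDiffOn (𝓡∂ d) ((𝓡∂ d).prod 𝓘(ℝ, EuclideanSpace ℝ (Fin d))) 1
      (fun p : M => TotalSpace.mk' (EuclideanSpace ℝ (Fin d))
        (E := fun z : M ↦ TangentSpace (𝓡∂ d) z) p
        (frameMap d x₀ p (EuclideanSpace.single i 1))) (extChartAt (𝓡∂ d) x₀).source := by
    intro i
    have := Trivialization.contMDiffOn_localFrame_baseSet (I := 𝓡∂ d) 1
      (trivializationAt (EuclideanSpace ℝ (Fin d)) (fun z : M ↦ TangentSpace (𝓡∂ d) z) x₀)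
      (EuclideanSpace.basisFun (Fin d) ℝ).toBasis i
    refine (this.mono fun p hp => mem_baseSet hp).congr fun p hp => ?_
    rw [Trivialization.localFrame_apply_of_mem_baseSet _ _ (mem_baseSet hp)]
    simp [Trivialization.basisAt, frameMap]
    exact Trivialization.symmL_apply (R := ℝ) _ (mem_baseSet hp) _
  exact ContMDiffOn.inner_bundle (h i) (h j)

omit [IsContMDiffRiemannianBundle (𝓡∂ d) 1 (EuclideanSpace ℝ (Fin d))
    (fun x : M ↦ TangentSpace (𝓡∂ d) x)] in
lemma exists_norm_le_frameMap (hp : p ∈ (extChartAt (𝓡∂ d) x₀).source) :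
    ∃ C > 0, ∀ v : EuclideanSpace ℝ (Fin d), ‖v‖ ≤ C * ‖frameMap d x₀ p v‖ := by
  refine ⟨‖coordMap d x₀ p‖ + 1, by positivity, fun v => ?_⟩
  calc ‖v‖ = ‖coordMap d x₀ p (frameMap d x₀ p v)‖ := by rw [coordMap_frameMap hp]
    _ ≤ ‖coordMap d x₀ p‖ * ‖frameMap d x₀ p v‖ := ContinuousLinearMap.le_opNorm _ _
    _ ≤ _ := by gcongr; linarith

/-- The metric is continuous: norms of vectors with the same components at nearby points are
almost equal. -/
lemma eventually_norm_frameMap_le (hp : p ∈ (extChartAt (𝓡∂ d) x₀).source) {c : ℝ} (hc : 1 < c) :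
    ∀ᶠ q in 𝓝 p, ∀ v : EuclideanSpace ℝ (Fin d),
      ‖frameMap d x₀ q v‖ ≤ c * ‖frameMap d x₀ p v‖ ∧ ‖frameMap d x₀ p v‖ ≤ c * ‖frameMap d x₀ q v‖ := by
  obtain ⟨C, hC, hCv⟩ := exists_norm_le_frameMap hp
  have hd : (0 : ℝ) < d := Nat.cast_pos.2 (NeZero.pos d)
  -- With this `η`, a relative error `η` in the squared norm serves both directions: `1 + η ≤ c ^ 2`
  -- and `1 - η = (c ^ 2)⁻¹`.
  set η := 1 - (c ^ 2)⁻¹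
  have hc2 : 1 < c ^ 2 := by nlinarith
  have hη : 0 < η := sub_pos.2 (inv_lt_one_of_one_lt₀ hc2)
  -- There are `d ^ 2` Gram entries, each weighted by at most `‖v‖ ^ 2 ≤ C ^ 2 * ‖frameMap d x₀ p v‖
  -- ^ 2`.
  set δ := η / (d ^ 2 * C ^ 2)
  have hδ : 0 < δ := by positivity
  have hG : ∀ i j, ∀ᶠ q in 𝓝 p, |metricMatrix d x₀ q i j - metricMatrix d x₀ p i j| < δ := by
    intro i j
    have h1 : ContinuousAt (fun p => metricMatrix d x₀ p i j) p :=
      (contMDiffOn_metricMatrix x₀ i j).continuousOn.continuousAt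
        (extChartAt_source_mem_nhds' hp)
    exact Metric.tendsto_nhds.1 h1 δ hδ
  filter_upwards [Filter.eventually_all.2 fun i => Filter.eventually_all.2 fun j => hG i j]
    with q hq v
  have hdiff : |‖frameMap d x₀ q v‖ ^ 2 - ‖frameMap d x₀ p v‖ ^ 2| ≤ η * ‖frameMap d x₀ p v‖ ^ 2 := by
    rw [← real_inner_self_eq_norm_sq, ← real_inner_self_eq_norm_sq, inner_frameMap,
      inner_frameMap (p := p), ← Finset.sum_sub_distrib]
    simp_rw [← Finset.sum_sub_distrib, ← mul_sub]
    calc |∑ i, ∑ j, v i * v j * (metricMatrix d x₀ q i j - metricMatrix d x₀ p i j)|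
        ≤ ∑ i, ∑ j, |v i * v j * (metricMatrix d x₀ q i j - metricMatrix d x₀ p i j)| :=
          (Finset.abs_sum_le_sum_abs _ _).trans
            (Finset.sum_le_sum fun i _ => Finset.abs_sum_le_sum_abs _ _)
      _ ≤ ∑ i : Fin d, ∑ j : Fin d, ‖v‖ * ‖v‖ * δ := by
        refine Finset.sum_le_sum fun i _ => Finset.sum_le_sum fun j _ => ?_
        rw [abs_mul, abs_mul]
        have h1 := PiLp.norm_apply_le v i
        have h2 := PiLp.norm_apply_le v j
        rw [Real.norm_eq_abs] at h1 h2
        gcongr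
        exact (hq i j).le
      _ = d ^ 2 * δ * ‖v‖ ^ 2 := by
        simp only [Finset.sum_const, Finset.card_univ, Fintype.card_fin, nsmul_eq_mul]
        ring
      _ ≤ d ^ 2 * δ * (C * ‖frameMap d x₀ p v‖) ^ 2 := by
        gcongr
        exact hCv v
      _ = η * ‖frameMap d x₀ p v‖ ^ 2 := by
        simp only [δ]
        field_simp
      _ = _ := by
        rw [← real_inner_self_eq_norm_sq, inner_frameMap]
  rw [abs_le] at hdiff
  have hcc : c ^ 2 * (c ^ 2)⁻¹ = 1 := mul_inv_cancel₀ (by positivity)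
  constructor
  · refine abs_le_of_sq_le_sq' ?_ (by positivity) |>.2
    have : 1 + η ≤ c ^ 2 := by
      simp only [η]
      nlinarith [sq_nonneg (c ^ 2 - 1), inv_pos.2 (show 0 < c ^ 2 by positivity)]
    rw [mul_pow]
    nlinarith [sq_nonneg ‖frameMap d x₀ p v‖]
  · refine abs_le_of_sq_le_sq' ?_ (by positivity) |>.2
    have h1 : (c ^ 2)⁻¹ * ‖frameMap d x₀ p v‖ ^ 2 ≤ ‖frameMap d x₀ q v‖ ^ 2 := by
      have : (c ^ 2)⁻¹ = 1 - η := by simp [η]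
      rw [this]
      linarith [hdiff.1]
    rw [mul_pow]
    calc ‖frameMap d x₀ p v‖ ^ 2 = c ^ 2 * ((c ^ 2)⁻¹ * ‖frameMap d x₀ p v‖ ^ 2) := by
          rw [← mul_assoc, hcc, one_mul]
      _ ≤ _ := by gcongr

end Smooth
end BoundaryVariance

namespace BoundaryVariance

/-! ### Riemannian distance against the frozen coordinate norm. -/

section Distance

variable {d : ℕ} [NeZero d] {M : Type*} [EMetricSpace M]
  [ChartedSpace (EuclideanHalfSpace d) M] [IsManifold (𝓡∂ d) ∞ M]
  [RiemannianBundle (fun x : M ↦ TangentSpace (𝓡∂ d) x)]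
  [IsContMDiffRiemannianBundle (𝓡∂ d) 1 (EuclideanSpace ℝ (Fin d))
    (fun x : M ↦ TangentSpace (𝓡∂ d) x)] [IsRiemannianManifold (𝓡∂ d) M]

variable {x₀ p : M}

omit [RiemannianBundle (fun x : M ↦ TangentSpace (𝓡∂ d) x)]
  [IsContMDiffRiemannianBundle (𝓡∂ d) 1 (EuclideanSpace ℝ (Fin d))
    (fun x : M ↦ TangentSpace (𝓡∂ d) x)] [IsRiemannianManifold (𝓡∂ d) M] in
lemma mfderivWithin_symm_apply {y : EuclideanSpace ℝ (Fin d)}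
    (hy : y ∈ (extChartAt (𝓡∂ d) x₀).target) (v : EuclideanSpace ℝ (Fin d)) :
    mfderivWithin 𝓘(ℝ, EuclideanSpace ℝ (Fin d)) (𝓡∂ d)
      (extChartAt (𝓡∂ d) x₀).symm (range (𝓡∂ d)) y v =
    frameMap d x₀ ((extChartAt (𝓡∂ d) x₀).symm y) v := by
  have h := frameMap_eq_mfderivWithin ((extChartAt (𝓡∂ d) x₀).map_target hy) v
  rw [(extChartAt (𝓡∂ d) x₀).right_inv hy] at h
  exact h.symm

/-- Upper bound for the distance by the norm of the coordinate difference. -/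
lemma exists_edist_le (hp : p ∈ (extChartAt (𝓡∂ d) x₀).source) {c : ℝ} (hc : 1 < c) :
    ∃ U ∈ 𝓝 p, U ⊆ (extChartAt (𝓡∂ d) x₀).source ∧ ∀ q ∈ U, ∀ q' ∈ U, edist q q' ≤
      ENNReal.ofReal c *
        ‖frameMap d x₀ p (extChartAt (𝓡∂ d) x₀ q' - extChartAt (𝓡∂ d) x₀ q)‖ₑ := by
  set φ := extChartAt (𝓡∂ d) x₀
  have hsymm : ContinuousAt φ.symm (φ p) := continuousAt_extChartAt_symm' hp
  have hev := eventually_norm_frameMap_le hp hc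
  have hleft : φ.symm (φ p) = p := φ.left_inv hp
  obtain ⟨r, r_pos, hr⟩ : ∃ r > 0, Metric.ball (φ p) r ∩ range (𝓡∂ d) ⊆ φ.target ∩
      {y | ∀ v : EuclideanSpace ℝ (Fin d),
        ‖frameMap d x₀ (φ.symm y) v‖ ≤ c * ‖frameMap d x₀ p v‖} := by
    refine Metric.mem_nhdsWithin_iff.1 (Filter.inter_mem
      (extChartAt_target_mem_nhdsWithin' hp) (nhdsWithin_le_nhds ?_))
    rw [← hleft] at hev
    filter_upwards [hsymm.eventually hev] with y hy v
    have := (hy v).1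
    rwa [hleft] at this
  refine ⟨φ.source ∩ φ ⁻¹' Metric.ball (φ p) r, Filter.inter_mem (extChartAt_source_mem_nhds' hp)
    ((continuousAt_extChartAt' hp).preimage_mem_nhds (Metric.ball_mem_nhds _ r_pos)),
    inter_subset_left, fun q hq q' hq' => ?_⟩
  -- The coordinate segment stays in the half ball by convexity, so its image in the manifold is an
  -- admissible path, of speed at most `c` times the frozen norm of `φ q' - φ q`.
  let η := ContinuousAffineMap.lineMap (R := ℝ) (φ q) (φ q')
  set γ := φ.symm ∘ η
  have hmem : ∀ q ∈ φ.source ∩ φ ⁻¹' Metric.ball (φ p) r,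
      φ q ∈ Metric.ball (φ p) r ∩ range (𝓡∂ d) := fun q hq =>
    ⟨hq.2, extChartAt_target_subset_range x₀ (φ.map_source hq.1)⟩
  have hη : Icc 0 1 ⊆ ⇑η ⁻¹' (φ.target ∩ {y | ∀ v : EuclideanSpace ℝ (Fin d),
        ‖frameMap d x₀ (φ.symm y) v‖ ≤ c * ‖frameMap d x₀ p v‖}) := by
    simp only [← image_subset_iff, ContinuousAffineMap.coe_lineMap_eq,
     ← segment_eq_image_lineMap, η]
    exact Subset.trans (((convex_ball _ _).inter (𝓡∂ d).convex_range).segment_subset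
      (hmem q hq) (hmem q' hq')) hr
  simp only [preimage_inter, subset_inter_iff] at hη
  have η_smooth : ContMDiffOn 𝓘(ℝ, ℝ) 𝓘(ℝ, EuclideanSpace ℝ (Fin d)) 1 η (Icc 0 1) := by
    apply ContMDiff.contMDiffOn
    rw [contMDiff_iff_contDiff]
    exact ContinuousAffineMap.contDiff _
  have hle : edist q q' ≤ pathELength (𝓡∂ d) γ 0 1 := by
    rw [IsRiemannianManifold.out (I := 𝓡∂ d) q q']
    apply riemannianEDist_le_pathELength _ _ _ zero_le_one
    · exact (contMDiffOn_extChartAt_symm x₀).comp η_smooth hη.1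
    · simp [γ, η, ContinuousAffineMap.coe_lineMap_eq, φ.left_inv hq.1]
    · simp [γ, η, ContinuousAffineMap.coe_lineMap_eq, φ.left_inv hq'.1]
  refine hle.trans ?_
  rw [pathELength_eq_lintegral_mfderivWithin_Icc]
  calc ∫⁻ t in Icc (0 : ℝ) 1, ‖mfderivWithin 𝓘(ℝ, ℝ) (𝓡∂ d) γ (Icc 0 1) t 1‖ₑ
      ≤ ∫⁻ t in Icc (0 : ℝ) 1, ENNReal.ofReal c * ‖frameMap d x₀ p (φ q' - φ q)‖ₑ := by
        refine setLIntegral_mono' measurableSet_Icc fun t ht => ?_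
        have h1 : mfderivWithin 𝓘(ℝ, ℝ) (𝓡∂ d) γ (Icc 0 1) t =
            (mfderivWithin 𝓘(ℝ, EuclideanSpace ℝ (Fin d)) (𝓡∂ d) φ.symm (range (𝓡∂ d)) (η t)) ∘L
              (mfderivWithin 𝓘(ℝ, ℝ) 𝓘(ℝ, EuclideanSpace ℝ (Fin d)) η (Icc 0 1) t) := by
          apply mfderivWithin_comp
          · exact mdifferentiableWithinAt_extChartAt_symm (hη.1 ht)
          · exact η_smooth.mdifferentiableOn one_ne_zero t ht
          · exact hη.1.trans (preimage_mono (extChartAt_target_subset_range x₀))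
          · rw [uniqueMDiffWithinAt_iff_uniqueDiffWithinAt]
            exact uniqueDiffOn_Icc zero_lt_one t ht
        have h2 : mfderivWithin 𝓘(ℝ, ℝ) 𝓘(ℝ, EuclideanSpace ℝ (Fin d)) η (Icc 0 1) t (1 : ℝ) =
            (φ q' - φ q : EuclideanSpace ℝ (Fin d)) := by
          rw [mfderivWithin_eq_fderivWithin]
          have h3 : HasDerivAt (AffineMap.lineMap (φ q) (φ q') : ℝ →ᵃ[ℝ] EuclideanSpace ℝ (Fin d))
            (φ q' - φ q) t := AffineMap.hasDerivAt_lineMap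
          have h4 := h3.hasDerivWithinAt (s := Icc 0 1)
          have h5 := h4.hasFDerivWithinAt.fderivWithin (uniqueDiffOn_Icc zero_lt_one t ht)
          have h6 := congr($h5 1)
          simp only [ContinuousLinearMap.toSpanSingleton_apply, one_smul] at h6
          exact h6
        have h3 : mfderivWithin 𝓘(ℝ, ℝ) (𝓡∂ d) γ (Icc 0 1) t (1 : ℝ) =
            frameMap d x₀ (φ.symm (η t)) (φ q' - φ q) := by
          rw [← mfderivWithin_symm_apply (hη.1 ht), ← h2]
          exact congr($h1 1)
        have h4 := hη.2 ht (φ q' - φ q)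
        calc ‖mfderivWithin 𝓘(ℝ, ℝ) (𝓡∂ d) γ (Icc 0 1) t 1‖ₑ
            = ‖frameMap d x₀ (φ.symm (η t)) (φ q' - φ q)‖ₑ := by
              exact congrArg (fun w : TangentSpace (𝓡∂ d) (γ t) => ‖w‖ₑ) h3
          _ ≤ _ := by
            rw [← ofReal_norm, ← ofReal_norm, ← ENNReal.ofReal_mul (by linarith)]
            exact ENNReal.ofReal_le_ofReal h4
    _ = _ := by simp

omit [RiemannianBundle (fun x : M ↦ TangentSpace (𝓡∂ d) x)]
  [IsContMDiffRiemannianBundle (𝓡∂ d) 1 (EuclideanSpace ℝ (Fin d))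
    (fun x : M ↦ TangentSpace (𝓡∂ d) x)] [IsRiemannianManifold (𝓡∂ d) M] in
lemma mfderivWithin_extChartAt_comp {γ : ℝ → M}
    (hγ : ContMDiffOn 𝓘(ℝ, ℝ) (𝓡∂ d) 1 γ (Icc 0 1)) {t : ℝ} (ht : t ∈ Icc (0 : ℝ) 1)
    (hs : γ t ∈ (extChartAt (𝓡∂ d) x₀).source) :
    derivWithin (fun t => extChartAt (𝓡∂ d) x₀ (γ t)) (Icc 0 1) t =
      coordMap d x₀ (γ t) (mfderivWithin 𝓘(ℝ, ℝ) (𝓡∂ d) γ (Icc 0 1) t (1 : ℝ)) := by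
  have h1 : mfderivWithin 𝓘(ℝ, ℝ) 𝓘(ℝ, EuclideanSpace ℝ (Fin d))
      (extChartAt (𝓡∂ d) x₀ ∘ γ) (Icc 0 1) t =
      (mfderiv (𝓡∂ d) 𝓘(ℝ, EuclideanSpace ℝ (Fin d)) (extChartAt (𝓡∂ d) x₀) (γ t)) ∘L
        (mfderivWithin 𝓘(ℝ, ℝ) (𝓡∂ d) γ (Icc 0 1) t) := by
    apply mfderiv_comp_mfderivWithin
    · exact mdifferentiableAt_extChartAt (by rwa [extChartAt_source] at hs)
    · exact hγ.mdifferentiableOn one_ne_zero _ ht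
    · rw [uniqueMDiffWithinAt_iff_uniqueDiffWithinAt]
      exact uniqueDiffOn_Icc zero_lt_one _ ht
  rw [coordMap_eq_mfderiv hs, ← fderivWithin_derivWithin, ← mfderivWithin_eq_fderivWithin]
  exact congr($h1 1)

/-- Lower bound for the distance by the norm of the coordinate difference. -/
lemma exists_le_edist (hp : p ∈ (extChartAt (𝓡∂ d) x₀).source) {c : ℝ} (hc : 1 < c) :
    ∃ U ∈ 𝓝 p, U ⊆ (extChartAt (𝓡∂ d) x₀).source ∧ ∀ q ∈ U, ∀ q' ∈ U,
      ‖frameMap d x₀ p (extChartAt (𝓡∂ d) x₀ q' - extChartAt (𝓡∂ d) x₀ q)‖ₑ ≤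
        ENNReal.ofReal c * edist q q' := by
  set φ := extChartAt (𝓡∂ d) x₀
  obtain ⟨r, r_pos, hr⟩ : ∃ r > 0, Metric.eball p r ⊆ φ.source ∩
      {q | ∀ v : EuclideanSpace ℝ (Fin d), ‖frameMap d x₀ p v‖ ≤ c * ‖frameMap d x₀ q v‖} := by
    refine EMetric.mem_nhds_iff.1 (Filter.inter_mem (extChartAt_source_mem_nhds' hp) ?_)
    filter_upwards [eventually_norm_frameMap_le hp hc] with q hq v using (hq v).2
  -- Points within `r / 4` of `p` are less than `r / 2` apart, and a path of length below `r / 2`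
  -- from one of them cannot leave the `r`-ball, where the metrics are comparable.
  have r4 : 0 < r / 2 / 2 := ENNReal.half_pos (ENNReal.half_pos r_pos.ne').ne'
  refine ⟨Metric.eball p (r / 2 / 2), Metric.eball_mem_nhds _ r4, ?_, ?_⟩
  · refine (Metric.eball_subset_eball ?_).trans (hr.trans inter_subset_left)
    exact ENNReal.half_le_self.trans ENNReal.half_le_self
  intro q hq q' hq'
  have hqq' : edist q q' < r / 2 := by
    calc edist q q' ≤ edist q p + edist q' p := edist_triangle_right _ _ _
      _ < r / 2 / 2 + r / 2 / 2 := ENNReal.add_lt_add hq hq'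
      _ = r / 2 := ENNReal.add_halves _
  -- A path of length below `l` exists for every `l` above the distance; in coordinates its frozen
  -- length bounds the norm of the displacement. No minimising path is required.
  have main : ∀ l, edist q q' < l → l ≤ r / 2 →
      ‖frameMap d x₀ p (φ q' - φ q)‖ₑ ≤ ENNReal.ofReal c * l := by
    intro l hl hlr
    rw [IsRiemannianManifold.out (I := 𝓡∂ d) q q'] at hl
    obtain ⟨γ, γ0, γ1, hγ, hlen⟩ := exists_lt_of_riemannianEDist_lt hl
    have hmem : ∀ t ∈ Icc (0 : ℝ) 1, γ t ∈ Metric.eball p r := by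
      intro t ht
      have h1 : edist q (γ t) ≤ pathELength (𝓡∂ d) γ 0 t := by
        rw [IsRiemannianManifold.out (I := 𝓡∂ d) q (γ t)]
        exact riemannianEDist_le_pathELength (hγ.mono (Icc_subset_Icc_right ht.2)) γ0 rfl ht.1
      have h2 : pathELength (𝓡∂ d) γ 0 t ≤ pathELength (𝓡∂ d) γ 0 1 :=
        pathELength_mono le_rfl ht.2
      calc edist (γ t) p ≤ edist (γ t) q + edist q p := edist_triangle _ _ _
        _ < r / 2 + r / 2 := by
          refine ENNReal.add_lt_add ?_ ?_
          · rw [edist_comm]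
            exact (h1.trans h2).trans_lt (hlen.trans_le hlr)
          · exact lt_of_lt_of_le hq ENNReal.half_le_self
        _ = r := ENNReal.add_halves r
    have hsrc : ∀ t ∈ Icc (0 : ℝ) 1, γ t ∈ φ.source := fun t ht => (hr (hmem t ht)).1
    have hφγ : ContDiffOn ℝ 1 (fun t => φ (γ t)) (Icc 0 1) := by
      rw [← contMDiffOn_iff_contDiffOn]
      exact (contMDiffOn_extChartAt (I := 𝓡∂ d) (x := x₀)).comp hγ
        fun t ht => by simpa [φ, extChartAt_source] using hsrc t ht
    set A : EuclideanSpace ℝ (Fin d) →L[ℝ] TangentSpace (𝓡∂ d) p := frameMap d x₀ p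
    have hA : ContDiffOn ℝ 1 (fun t => A (φ (γ t))) (Icc 0 1) := A.contDiff.comp_contDiffOn hφγ
    have hderiv : ∀ t ∈ Icc (0 : ℝ) 1, derivWithin (fun t => A (φ (γ t))) (Icc 0 1) t =
        A (derivWithin (fun t => φ (γ t)) (Icc 0 1) t) := by
      intro t ht
      have := (hφγ.differentiableOn one_ne_zero t ht).hasDerivWithinAt
      exact (A.hasFDerivAt.comp_hasDerivWithinAt t this).derivWithin
        (uniqueDiffOn_Icc zero_lt_one t ht)
    have h0 := enorm_sub_le_lintegral_derivWithin_Icc_of_contDiffOn_Icc hA zero_le_one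
    rw [γ0, γ1, ← map_sub] at h0
    refine h0.trans ?_
    calc ∫⁻ t in Icc (0 : ℝ) 1, ‖derivWithin (fun t => A (φ (γ t))) (Icc 0 1) t‖ₑ
        ≤ ∫⁻ t in Icc (0 : ℝ) 1, ENNReal.ofReal c *
          ‖mfderivWithin 𝓘(ℝ, ℝ) (𝓡∂ d) γ (Icc 0 1) t 1‖ₑ := by
          refine setLIntegral_mono' measurableSet_Icc fun t ht => ?_
          rw [hderiv t ht, mfderivWithin_extChartAt_comp hγ ht (hsrc t ht)]
          have h4 := (hr (hmem t ht)).2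
            (coordMap d x₀ (γ t) (mfderivWithin 𝓘(ℝ, ℝ) (𝓡∂ d) γ (Icc 0 1) t (1 : ℝ)))
          rw [frameMap_coordMap (hsrc t ht)] at h4
          rw [← ofReal_norm, ← ofReal_norm, ← ENNReal.ofReal_mul (by linarith)]
          exact ENNReal.ofReal_le_ofReal h4
      _ = ENNReal.ofReal c * pathELength (𝓡∂ d) γ 0 1 := by
        rw [lintegral_const_mul' _ _ ENNReal.ofReal_ne_top,
          pathELength_eq_lintegral_mfderivWithin_Icc]
      _ ≤ _ := by gcongr
  refine ENNReal.le_of_forall_pos_le_add fun ε hε hfin => ?_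
  have hc0 : ENNReal.ofReal c ≠ 0 := by
    simp only [ne_eq, ENNReal.ofReal_eq_zero, not_le]
    linarith
  by_contra! hcon
  obtain ⟨l, hl1, hl2⟩ : ∃ l, edist q q' < l ∧ l < min (r / 2)
      (edist q q' + ε / ENNReal.ofReal c) := by
    refine exists_between (lt_min hqq' ?_)
    exact ENNReal.lt_add_right hqq'.ne_top
      (ENNReal.div_pos (by exact_mod_cast hε.ne') ENNReal.ofReal_ne_top).ne'
  refine absurd (main l hl1 (hl2.le.trans (min_le_left _ _))) (not_le.2 (lt_of_le_of_lt ?_ hcon))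
  calc ENNReal.ofReal c * l ≤ ENNReal.ofReal c * (edist q q' + ε / ENNReal.ofReal c) := by
        gcongr
        exact hl2.le.trans (min_le_right _ _)
    _ = _ := by
      rw [mul_add, ENNReal.mul_div_cancel hc0 ENNReal.ofReal_ne_top]

end Distance
end BoundaryVariance

namespace BoundaryVariance

/-! ### Comparing measures locally, up to factors tending to 1. -/

section LocalComparison

/-- A measure which is locally almost dominated by another one is dominated by it. -/
lemma measure_le_of_locally_le {X : Type*} [TopologicalSpace X] [SecondCountableTopology X]
    [MeasurableSpace X] [OpensMeasurableSpace X] {μ ν : Measure X} {S : Set X} (m : ℕ)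
    (h : ∀ c : ℝ, 1 < c → ∀ x ∈ S, ∃ U ∈ 𝓝 x, ∀ A ⊆ U ∩ S, MeasurableSet A →
      μ A ≤ ENNReal.ofReal c ^ m * ν A) {A : Set X} (hA : A ⊆ S) (hAm : MeasurableSet A) :
    μ A ≤ ν A := by
  have key : ∀ c : ℝ, 1 < c → μ A ≤ ENNReal.ofReal c ^ m * ν A := by
    intro c hc
    choose! U hU hUA using h c hc
    -- Countably many of the neighbourhoods cover `S`; making them disjoint turns the local bounds
    -- into a bound for `A` with the same constant.
    obtain ⟨t, htS, htc, ht⟩ := TopologicalSpace.countable_cover_nhdsWithin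
      (f := fun x => interior (U x)) (s := S)
      fun x hx => mem_nhdsWithin_of_mem_nhds (interior_mem_nhds.2 (hU x hx))
    rcases t.eq_empty_or_nonempty with rfl | hne
    · have : A = ∅ := subset_empty_iff.1 (hA.trans (by simpa using ht))
      simp [this]
    obtain ⟨g, rfl⟩ := htc.exists_eq_range hne
    set V : ℕ → Set X := fun k => interior (U (g k))
    have hVm : ∀ k, MeasurableSet (disjointed V k) :=
      MeasurableSet.disjointed fun k => isOpen_interior.measurableSet
    have hAV : A = ⋃ k, A ∩ disjointed V k := by
      rw [← inter_iUnion, iUnion_disjointed]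
      refine (inter_eq_left.2 (hA.trans (ht.trans ?_))).symm
      simp only [mem_range, iUnion_exists, iUnion_iUnion_eq', V]
      exact subset_rfl
    have hdisj : Pairwise (Function.onFun Disjoint fun k => A ∩ disjointed V k) :=
      fun i j hij => ((disjoint_disjointed V) hij).mono inter_subset_right inter_subset_right
    rw [hAV, measure_iUnion hdisj fun k => hAm.inter (hVm k),
      measure_iUnion hdisj fun k => hAm.inter (hVm k), ← ENNReal.tsum_mul_left]
    refine ENNReal.tsum_le_tsum fun k => hUA (g k) (htS (mem_range_self k)) _ ?_
      (hAm.inter (hVm k))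
    exact fun y hy => ⟨interior_subset (disjointed_subset V k hy.2), hA hy.1⟩
  -- The exponent `m` does not depend on `c`, so the constant disappears as `c` decreases to 1.
  have hlim : Filter.Tendsto (fun c : ℝ => ENNReal.ofReal c ^ m * ν A) (𝓝[>] 1)
      (𝓝 (1 * ν A)) := by
    refine ENNReal.Tendsto.mul_const ?_ (Or.inl one_ne_zero)
    have h1 : Filter.Tendsto (fun c : ℝ => ENNReal.ofReal c ^ m) (𝓝 1)
        (𝓝 (ENNReal.ofReal 1 ^ m)) :=
      (((ENNReal.continuous_pow m).comp ENNReal.continuous_ofReal).tendsto 1)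
    simp only [ENNReal.ofReal_one, one_pow] at h1
    exact h1.mono_left nhdsWithin_le_nhds
  rw [one_mul] at hlim
  exact ge_of_tendsto hlim (by filter_upwards [self_mem_nhdsWithin] with c hc using key c hc)

/-- The factor normalising the Hausdorff measure depends on `k` alone, so it is the same on both
sides of the usual Lipschitz bound. -/
lemma euclideanHausdorffMeasure_image_le {X Y : Type*} [EMetricSpace X] [EMetricSpace Y]
    [MeasurableSpace X] [BorelSpace X] [MeasurableSpace Y] [BorelSpace Y] {K : ℝ≥0} {f : X → Y}
    {s : Set X} (hf : LipschitzOnWith K f s) (k : ℕ) :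
    (μHE[k] : Measure Y) (f '' s) ≤ (K : ℝ≥0∞) ^ k * (μHE[k] : Measure X) s := by
  have h := hf.hausdorffMeasure_image_le (d := k) (Nat.cast_nonneg k)
  rw [ENNReal.rpow_natCast] at h
  rw [Measure.euclideanHausdorffMeasure_def, Measure.euclideanHausdorffMeasure_def,
    Measure.smul_apply, Measure.smul_apply, ENNReal.smul_def, ENNReal.smul_def, smul_eq_mul,
    smul_eq_mul, mul_left_comm]
  gcongr

end LocalComparison

/-! ### Hausdorff measure as density times Lebesgue measure in a chart. -/

section ChartMeasure

variable {d : ℕ} [NeZero d] {M : Type*} [EMetricSpace M]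
  [ChartedSpace (EuclideanHalfSpace d) M] [IsManifold (𝓡∂ d) ∞ M]
  [RiemannianBundle (fun x : M ↦ TangentSpace (𝓡∂ d) x)]

variable {k : ℕ} (ι : EuclideanSpace ℝ (Fin k) →ₗᵢ[ℝ] EuclideanSpace ℝ (Fin d)) (x₀ : M)

/-- The factor by which the coordinate frame at `p` scales `k`-dimensional volume. -/
noncomputable def frameDensity (p : M) : ℝ :=
  ((frameMap d x₀ p).toLinearMap ∘ₗ ι.toLinearMap).normDet

open Classical in
/-- The inverse of the chart at `x₀` on a linear subspace, with a junk value off the chart. -/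
noncomputable def chartParam (z : EuclideanSpace ℝ (Fin k)) : M :=
  if ι z ∈ (extChartAt (𝓡∂ d) x₀).target then (extChartAt (𝓡∂ d) x₀).symm (ι z) else x₀

open Classical in
/-- The volume density in the chart at `x₀`, extended by zero. -/
noncomputable def chartDensity (z : EuclideanSpace ℝ (Fin k)) : ℝ :=
  if ι z ∈ (extChartAt (𝓡∂ d) x₀).target then
    frameDensity ι x₀ ((extChartAt (𝓡∂ d) x₀).symm (ι z)) else 0

lemma frameDensity_nonneg (p : M) : 0 ≤ frameDensity ι x₀ p := LinearMap.normDet_nonneg _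

/-- Passing to the Gram determinant makes the density a square root of a polynomial in the metric
coefficients, from which its continuity follows. -/
lemma frameDensity_sq (p : M) : frameDensity ι x₀ p ^ 2 =
    (Matrix.of fun i j => inner ℝ (frameMap d x₀ p (ι (EuclideanSpace.single i 1)))
      (frameMap d x₀ p (ι (EuclideanSpace.single j 1)))).det := by
  have h := LinearMap.normDet_sq_eq_det_gram ((frameMap d x₀ p).toLinearMap ∘ₗ ι.toLinearMap)
    (EuclideanSpace.basisFun (Fin k) ℝ)
  simp only [RCLike.ofReal_real_eq_id, id_eq] at h
  rw [frameDensity, h]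
  congr 1
  ext i j
  simp [Matrix.gram]

variable {x₀}

lemma frameDensity_pos {p : M} (hp : p ∈ (extChartAt (𝓡∂ d) x₀).source) :
    0 < frameDensity ι x₀ p := by
  refine (frameDensity_nonneg ι x₀ p).lt_of_ne' fun h => ?_
  refine LinearMap.normDet_eq_zero_iff_ker_ne_bot.1 h (LinearMap.ker_eq_bot.2 fun v w hvw => ?_)
  have h1 := congrArg (coordMap d x₀ p) hvw
  simp only [LinearMap.comp_apply, ContinuousLinearMap.coe_coe, LinearIsometry.coe_toLinearMap]
    at h1
  rw [coordMap_frameMap hp, coordMap_frameMap hp] at h1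
  exact ι.injective h1

section Cont

variable [IsContMDiffRiemannianBundle (𝓡∂ d) 1 (EuclideanSpace ℝ (Fin d))
  (fun x : M ↦ TangentSpace (𝓡∂ d) x)]

lemma continuousOn_frameDensity :
    ContinuousOn (frameDensity ι x₀) (extChartAt (𝓡∂ d) x₀).source := by
  have h : ∀ p : M, frameDensity ι x₀ p = Real.sqrt (Matrix.of fun i j =>
      inner ℝ (frameMap d x₀ p (ι (EuclideanSpace.single i 1)))
      (frameMap d x₀ p (ι (EuclideanSpace.single j 1)))).det := fun p => by
    rw [← frameDensity_sq, Real.sqrt_sq (frameDensity_nonneg ι x₀ p)]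
  rw [continuousOn_iff_continuous_domRestrict]
  have h2 : Continuous fun p : (extChartAt (𝓡∂ d) x₀).source => (Matrix.of fun i j =>
      inner ℝ (frameMap d x₀ (p : M) (ι (EuclideanSpace.single i 1)))
      (frameMap d x₀ (p : M) (ι (EuclideanSpace.single j 1)))) := by
    refine continuous_pi fun i => continuous_pi fun j => ?_
    simp only [Matrix.of_apply, inner_frameMap]
    refine continuous_finsetSum _ fun a _ => continuous_finsetSum _ fun b _ => ?_
    exact continuous_const.mul
      (contMDiffOn_metricMatrix x₀ a b).continuousOn.domRestrict
  exact (Real.continuous_sqrt.comp h2.matrix_det).congr fun p => (h p).symm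

omit [RiemannianBundle (fun x : M ↦ TangentSpace (𝓡∂ d) x)]
  [IsContMDiffRiemannianBundle (𝓡∂ d) 1 (EuclideanSpace ℝ (Fin d))
    (fun x : M ↦ TangentSpace (𝓡∂ d) x)] [IsManifold (𝓡∂ d) ∞ M] in
lemma measurableSet_extChartAt_target (x₀ : M) :
    MeasurableSet (extChartAt (𝓡∂ d) x₀).target := by
  rw [extChartAt_target]
  exact ((chartAt (EuclideanHalfSpace d) x₀).open_target.preimage
    (𝓡∂ d).continuous_symm).measurableSet.inter (𝓡∂ d).isClosed_range.measurableSet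

omit [RiemannianBundle (fun x : M ↦ TangentSpace (𝓡∂ d) x)]
  [IsContMDiffRiemannianBundle (𝓡∂ d) 1 (EuclideanSpace ℝ (Fin d))
    (fun x : M ↦ TangentSpace (𝓡∂ d) x)] [IsManifold (𝓡∂ d) ∞ M] in
lemma measurable_chartParam [MeasurableSpace M] [BorelSpace M] :
    Measurable (chartParam ι x₀) := by
  classical
  refine ContinuousOn.measurable_piecewise
    (s := ι ⁻¹' (extChartAt (𝓡∂ d) x₀).target)
    (f := fun z => (extChartAt (𝓡∂ d) x₀).symm (ι z)) (g := fun _ => x₀)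
    ?_ continuousOn_const (ι.continuous.measurable (measurableSet_extChartAt_target x₀))
  exact (continuousOn_extChartAt_symm x₀).comp ι.continuous.continuousOn fun z hz => hz

lemma measurable_chartDensity : Measurable (chartDensity ι x₀) := by
  classical
  refine ContinuousOn.measurable_piecewise
    (s := ι ⁻¹' (extChartAt (𝓡∂ d) x₀).target)
    (f := fun z => frameDensity ι x₀ ((extChartAt (𝓡∂ d) x₀).symm (ι z))) (g := fun _ => 0)
    ?_ continuousOn_const (ι.continuous.measurable (measurableSet_extChartAt_target x₀))
  exact (continuousOn_frameDensity ι).comp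
    ((continuousOn_extChartAt_symm x₀).comp ι.continuous.continuousOn fun z hz => hz)
    fun z hz => (extChartAt (𝓡∂ d) x₀).map_target hz

end Cont

variable (x₀) in
/-- The Riemannian volume of a coordinate subspace in the chart at `x₀`. -/
noncomputable def chartMeasure [MeasurableSpace M] : Measure M :=
  (volume.withDensity fun z => ENNReal.ofReal (chartDensity ι x₀ z)).map (chartParam ι x₀)

variable [IsContMDiffRiemannianBundle (𝓡∂ d) 1 (EuclideanSpace ℝ (Fin d))
  (fun x : M ↦ TangentSpace (𝓡∂ d) x)] [MeasurableSpace M] [BorelSpace M]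

lemma chartMeasure_apply {A : Set M} (hA : MeasurableSet A) : chartMeasure ι x₀ A =
    ∫⁻ z in chartParam ι x₀ ⁻¹' A, ENNReal.ofReal (chartDensity ι x₀ z) := by
  rw [chartMeasure, Measure.map_apply (measurable_chartParam ι) hA,
    withDensity_apply _ (measurable_chartParam ι hA)]

lemma lintegral_chartMeasure {f : M → ℝ≥0∞} (hf : Measurable f) :
    ∫⁻ p, f p ∂chartMeasure ι x₀ =
      ∫⁻ z, ENNReal.ofReal (chartDensity ι x₀ z) * f (chartParam ι x₀ z) := by
  rw [chartMeasure, lintegral_map hf (measurable_chartParam ι)]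
  exact lintegral_withDensity_eq_lintegral_mul _ (measurable_chartDensity ι).ennreal_ofReal
      (hf.comp (measurable_chartParam ι))

lemma integral_chartMeasure {f : M → ℝ} (hf : AEStronglyMeasurable f (chartMeasure ι x₀)) :
    ∫ p, f p ∂chartMeasure ι x₀ =
      ∫ z, chartDensity ι x₀ z * f (chartParam ι x₀ z) := by
  have h0 : ∀ z, 0 ≤ chartDensity ι x₀ z := fun z => by
    rw [chartDensity]; split_ifs; exacts [frameDensity_nonneg _ _ _, le_rfl]
  rw [chartMeasure, integral_map (measurable_chartParam ι).aemeasurable hf,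
    integral_withDensity_eq_integral_toReal_smul (measurable_chartDensity ι).ennreal_ofReal
      (.of_forall fun _ => ENNReal.ofReal_lt_top)]
  simp only [ENNReal.toReal_ofReal (h0 _), smul_eq_mul]

variable [IsRiemannianManifold (𝓡∂ d) M] [SecondCountableTopology M]

lemma eventually_frameDensity_le {p : M} (hp : p ∈ (extChartAt (𝓡∂ d) x₀).source) {c : ℝ}
    (hc : 1 < c) : ∀ᶠ q in 𝓝 p, frameDensity ι x₀ q ≤ c * frameDensity ι x₀ p ∧
      frameDensity ι x₀ p ≤ c * frameDensity ι x₀ q := by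
  have h := (continuousOn_frameDensity ι).continuousAt (extChartAt_source_mem_nhds' hp)
  have hpos := frameDensity_pos ι hp
  have h1 := h.eventually_le_const (v := frameDensity ι x₀ p)
    (u := c * frameDensity ι x₀ p) (by nlinarith)
  have h2 := (h.const_mul c).eventually_const_le (v := c * frameDensity ι x₀ p)
    (u := frameDensity ι x₀ p) (by nlinarith)
  filter_upwards [h1, h2] with q h1 h2 using ⟨h1, h2⟩

/-- The Hausdorff measure is at most the Riemannian volume on coordinate subspaces. -/
lemma euclideanHausdorffMeasure_le_chartMeasure {S A : Set M}
    (hS : S ⊆ (extChartAt (𝓡∂ d) x₀).source) (hSι : ∀ q ∈ S, ∃ z, ι z = extChartAt (𝓡∂ d) x₀ q)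
    (hA : A ⊆ S) (hAm : MeasurableSet A) :
    (μHE[k] : Measure M) A ≤ chartMeasure ι x₀ A := by
  -- `k` factors of `c` come from the scaling of `k`-dimensional measure, and one from the
  -- oscillation of the density.
  refine measure_le_of_locally_le (k + 1) (fun c hc p hp => ?_) hA hAm
  obtain ⟨U, hU, -, hUe⟩ := exists_edist_le (hS hp) hc
  refine ⟨U ∩ {q | frameDensity ι x₀ p ≤ c * frameDensity ι x₀ q}, Filter.inter_mem hU
    ((eventually_frameDensity_le ι (hS hp) hc).mono fun q h => h.2), fun B hB hBm => ?_⟩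
  set φ := extChartAt (𝓡∂ d) x₀
  set s : Set (EuclideanSpace ℝ (Fin k)) := chartParam ι x₀ ⁻¹' B ∩ ι ⁻¹' φ.target
  have hsm : MeasurableSet s := (measurable_chartParam ι hBm).inter
    (ι.continuous.measurable (measurableSet_extChartAt_target x₀))
  have hparam : ∀ z ∈ s, chartParam ι x₀ z = φ.symm (ι z) := fun z hz => if_pos hz.2
  set T : EuclideanSpace ℝ (Fin k) →ₗ[ℝ] TangentSpace (𝓡∂ d) p :=
    (frameMap d x₀ p).toLinearMap ∘ₗ ι.toLinearMap
  -- Read from the tangent space at `p` with its own inner product, the inverse chart is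
  -- `c`-Lipschitz on the relevant set, while the linear map `T` scales volume exactly by the
  -- density at `p`.
  set F : TangentSpace (𝓡∂ d) p → M := fun v => φ.symm (coordMap d x₀ p v)
  have hFT : ∀ z, F (T z) = φ.symm (ι z) := fun z => by
    simp [F, T, coordMap_frameMap (hS hp)]
  have hBs : B ⊆ F '' (T '' s) := by
    intro q hq
    obtain ⟨z, hz⟩ := hSι q (hB hq).2
    have hzt : ι z ∈ φ.target := hz ▸ φ.map_source (hS (hB hq).2)
    have hzq : φ.symm (ι z) = q := by rw [hz, φ.left_inv (hS (hB hq).2)]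
    refine ⟨T z, ⟨z, ⟨?_, hzt⟩, rfl⟩, by rw [hFT, hzq]⟩
    change chartParam ι x₀ z ∈ B
    rw [chartParam, if_pos hzt, hzq]
    exact hq
  have hlip : LipschitzOnWith c.toNNReal F (T '' s) := by
    rintro _ ⟨z, hz, rfl⟩ _ ⟨z', hz', rfl⟩
    rw [hFT, hFT]
    have hz1 : φ.symm (ι z) ∈ U := by rw [← hparam z hz]; exact (hB hz.1).1.1
    have hz2 : φ.symm (ι z') ∈ U := by rw [← hparam z' hz']; exact (hB hz'.1).1.1
    refine (hUe _ hz1 _ hz2).trans (le_of_eq ?_)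
    rw [φ.right_inv hz.2, φ.right_inv hz'.2, edist_comm, edist_eq_enorm_sub, map_sub]
    rfl
  let _ : MeasurableSpace (TangentSpace (𝓡∂ d) p) := borel _
  have : BorelSpace (TangentSpace (𝓡∂ d) p) := ⟨rfl⟩
  have hvol : (μHE[k] : Measure (TangentSpace (𝓡∂ d) p)) (T '' s) =
      ENNReal.ofReal (frameDensity ι x₀ p) * volume s := by
    have h := LinearMap.euclideanHausdorffMeasure_image T s
    rw [finrank_euclideanSpace_fin, EuclideanSpace.euclideanHausdorffMeasure_eq_volume] at h
    exact h
  calc (μHE[k] : Measure M) B ≤ (μHE[k] : Measure M) (F '' (T '' s)) := measure_mono hBs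
    _ ≤ ENNReal.ofReal c ^ k * (ENNReal.ofReal (frameDensity ι x₀ p) * volume s) := by
      rw [← hvol]
      exact euclideanHausdorffMeasure_image_le hlip k
    _ = ENNReal.ofReal c ^ k * ∫⁻ z in s, ENNReal.ofReal (frameDensity ι x₀ p) := by
      rw [setLIntegral_const]
    _ ≤ ENNReal.ofReal c ^ k *
        ∫⁻ z in s, ENNReal.ofReal c * ENNReal.ofReal (chartDensity ι x₀ z) := by
      refine mul_le_mul' le_rfl (setLIntegral_mono' hsm fun z hz => ?_)
      have hz2 : ι z ∈ (extChartAt (𝓡∂ d) x₀).target := hz.2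
      rw [← ENNReal.ofReal_mul (by linarith), chartDensity, if_pos hz2]
      refine ENNReal.ofReal_le_ofReal ?_
      rw [← hparam z hz]
      exact (hB hz.1).1.2
    _ = ENNReal.ofReal c ^ (k + 1) * ∫⁻ z in s, ENNReal.ofReal (chartDensity ι x₀ z) := by
      rw [lintegral_const_mul' _ _ ENNReal.ofReal_ne_top, pow_succ, mul_assoc]
    _ ≤ ENNReal.ofReal c ^ (k + 1) * chartMeasure ι x₀ B := by
      rw [chartMeasure_apply ι hBm]
      gcongr
      exact inter_subset_left

/-- The Riemannian volume in a chart is at most the Hausdorff measure. -/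
lemma chartMeasure_le_euclideanHausdorffMeasure {A : Set M}
    (hA : A ⊆ (extChartAt (𝓡∂ d) x₀).source) (hAm : MeasurableSet A) :
    chartMeasure (LinearIsometry.id : EuclideanSpace ℝ (Fin d) →ₗᵢ[ℝ] _) x₀ A ≤ (μHE[d] : Measure M) A := by
  refine measure_le_of_locally_le (d + 1) (fun c hc p hp => ?_) hA hAm
  obtain ⟨U, hU, -, hUe⟩ := exists_le_edist hp hc
  set ι : EuclideanSpace ℝ (Fin d) →ₗᵢ[ℝ] EuclideanSpace ℝ (Fin d) := LinearIsometry.id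
  refine ⟨U ∩ {q | frameDensity ι x₀ q ≤ c * frameDensity ι x₀ p}, Filter.inter_mem hU
    ((eventually_frameDensity_le ι hp hc).mono fun q h => h.1), fun B hB hBm => ?_⟩
  set φ := extChartAt (𝓡∂ d) x₀
  set s : Set (EuclideanSpace ℝ (Fin d)) := chartParam ι x₀ ⁻¹' B ∩ φ.target
  have hsm : MeasurableSet s := (measurable_chartParam ι hBm).inter
    (measurableSet_extChartAt_target x₀)
  have hparam : ∀ z ∈ s, chartParam ι x₀ z = φ.symm z := fun z hz => if_pos hz.2
  set T : EuclideanSpace ℝ (Fin d) →ₗ[ℝ] TangentSpace (𝓡∂ d) p :=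
    (frameMap d x₀ p).toLinearMap ∘ₗ ι.toLinearMap
  have hTs : T '' s ⊆ (fun q => frameMap d x₀ p (φ q)) '' B := by
    rintro _ ⟨z, hz, rfl⟩
    refine ⟨φ.symm z, ?_, ?_⟩
    · rw [← hparam z hz]; exact hz.1
    · change frameMap d x₀ p (φ (φ.symm z)) = frameMap d x₀ p z
      rw [φ.right_inv hz.2]
  have hlip : LipschitzOnWith c.toNNReal (fun q => frameMap d x₀ p (φ q)) B := by
    intro q hq q' hq'
    refine le_of_eq_of_le ?_ (hUe q (hB hq).1.1 q' (hB hq').1.1)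
    rw [edist_comm, edist_eq_enorm_sub, map_sub]
  let _ : MeasurableSpace (TangentSpace (𝓡∂ d) p) := borel _
  have : BorelSpace (TangentSpace (𝓡∂ d) p) := ⟨rfl⟩
  have hvol : (μHE[d] : Measure (TangentSpace (𝓡∂ d) p)) (T '' s) =
      ENNReal.ofReal (frameDensity ι x₀ p) * volume s := by
    have h := LinearMap.euclideanHausdorffMeasure_image T s
    rw [finrank_euclideanSpace_fin, EuclideanSpace.euclideanHausdorffMeasure_eq_volume] at h
    exact h
  calc chartMeasure ι x₀ B = ∫⁻ z in s, ENNReal.ofReal (chartDensity ι x₀ z) := by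
        rw [chartMeasure_apply ι hBm]
        rw [← lintegral_indicator hsm, ← lintegral_indicator (measurable_chartParam ι hBm)]
        refine lintegral_congr fun z => ?_
        by_cases hz : z ∈ s
        · rw [indicator_of_mem hz, indicator_of_mem (show z ∈ chartParam ι x₀ ⁻¹' B from hz.1)]
        · rw [indicator_of_notMem hz, indicator_apply_eq_zero]
          intro hzB
          rw [chartDensity, if_neg (show ι z ∉ (extChartAt (𝓡∂ d) x₀).target from fun h => hz ⟨hzB, h⟩),
            ENNReal.ofReal_zero]
    _ ≤ ∫⁻ z in s, ENNReal.ofReal c * ENNReal.ofReal (frameDensity ι x₀ p) := by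
      refine setLIntegral_mono' hsm fun z hz => ?_
      have hz2 : ι z ∈ (extChartAt (𝓡∂ d) x₀).target := hz.2
      rw [← ENNReal.ofReal_mul (by linarith), chartDensity, if_pos hz2]
      refine ENNReal.ofReal_le_ofReal ?_
      have := (hB hz.1).1.2
      rw [hparam z hz] at this
      exact this
    _ = ENNReal.ofReal c * (μHE[d] : Measure (TangentSpace (𝓡∂ d) p)) (T '' s) := by
      rw [setLIntegral_const, hvol, mul_assoc]
    _ ≤ ENNReal.ofReal c * (ENNReal.ofReal c ^ d * (μHE[d] : Measure M) B) := by
      gcongr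
      exact (measure_mono hTs).trans (euclideanHausdorffMeasure_image_le hlip d)
    _ = _ := by rw [pow_succ]; ring

/-- The Hausdorff measure in a chart is the Riemannian volume. -/
theorem euclideanHausdorffMeasure_restrict_source (x₀ : M) :
    (μHE[d] : Measure M).restrict (extChartAt (𝓡∂ d) x₀).source =
      chartMeasure (LinearIsometry.id : EuclideanSpace ℝ (Fin d) →ₗᵢ[ℝ] _) x₀ := by
  set ι : EuclideanSpace ℝ (Fin d) →ₗᵢ[ℝ] EuclideanSpace ℝ (Fin d) := LinearIsometry.id
  have hsm : MeasurableSet (extChartAt (𝓡∂ d) x₀).source :=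
    (isOpen_extChartAt_source x₀).measurableSet
  -- The density vanishes off the chart target, so the junk value of `chartParam` carries no mass.
  have hz : chartMeasure ι x₀ (extChartAt (𝓡∂ d) x₀).sourceᶜ = 0 := by
    rw [chartMeasure_apply ι hsm.compl]
    refine (setLIntegral_congr_fun (g := fun _ => 0) (measurable_chartParam ι hsm.compl)
      fun z hz => ?_).trans (by simp)
    simp only
    rw [chartDensity]
    split_ifs with h
    · refine absurd ((extChartAt (𝓡∂ d) x₀).map_target h) ?_
      have h2 : chartParam ι x₀ z ∉ (extChartAt (𝓡∂ d) x₀).source := hz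
      rwa [chartParam, if_pos h] at h2
    · simp
  ext A hA
  rw [Measure.restrict_apply hA]
  have h1 : chartMeasure ι x₀ A = chartMeasure ι x₀ (A ∩ (extChartAt (𝓡∂ d) x₀).source) :=
    (measure_inter_conull hz).symm
  rw [h1]
  exact le_antisymm (euclideanHausdorffMeasure_le_chartMeasure ι subset_rfl
      (fun q _ => ⟨_, rfl⟩) inter_subset_right (hA.inter hsm))
    (chartMeasure_le_euclideanHausdorffMeasure inter_subset_right (hA.inter hsm))

end ChartMeasure
end BoundaryVariance

namespace BoundaryVariance

/-! ### Gradients in coordinates. -/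

section Gradient

variable {d : ℕ} [NeZero d] {M : Type*} [EMetricSpace M]
  [ChartedSpace (EuclideanHalfSpace d) M] [IsManifold (𝓡∂ d) ∞ M]

variable {x₀ p : M} {f h : M → ℝ}

/-- The partial derivatives of a function in the chart at `x₀`. -/
noncomputable def coordDeriv (x₀ : M) (f : M → ℝ) (p : M) (i : Fin d) : ℝ :=
  mfderiv (𝓡∂ d) 𝓘(ℝ, ℝ) f p (frameMap d x₀ p (EuclideanSpace.single i 1))

lemma mfderiv_frameMap_eq_fderivWithin (hp : p ∈ (extChartAt (𝓡∂ d) x₀).source)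
    (hf : MDifferentiableAt (𝓡∂ d) 𝓘(ℝ, ℝ) f p) (v : EuclideanSpace ℝ (Fin d)) :
    mfderiv (𝓡∂ d) 𝓘(ℝ, ℝ) f p (frameMap d x₀ p v) =
      fderivWithin ℝ (f ∘ (extChartAt (𝓡∂ d) x₀).symm) (range (𝓡∂ d))
        (extChartAt (𝓡∂ d) x₀ p) v := by
  set φ := extChartAt (𝓡∂ d) x₀
  have hleft : φ.symm (φ p) = p := φ.left_inv hp
  have h1 : mfderivWithin 𝓘(ℝ, EuclideanSpace ℝ (Fin d)) 𝓘(ℝ, ℝ) (f ∘ φ.symm) (range (𝓡∂ d))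
      (φ p) = (mfderiv (𝓡∂ d) 𝓘(ℝ, ℝ) f (φ.symm (φ p))) ∘L
        (mfderivWithin 𝓘(ℝ, EuclideanSpace ℝ (Fin d)) (𝓡∂ d) φ.symm (range (𝓡∂ d)) (φ p)) := by
    apply mfderiv_comp_mfderivWithin
    · rwa [hleft]
    · exact mdifferentiableWithinAt_extChartAt_symm (φ.map_source hp)
    · rw [uniqueMDiffWithinAt_iff_uniqueDiffWithinAt]
      exact (𝓡∂ d).uniqueDiffOn _ (extChartAt_target_subset_range x₀ (φ.map_source hp))
  rw [mfderivWithin_eq_fderivWithin] at h1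
  have h2 := congr($h1 v)
  refine Eq.trans ?_ h2.symm
  change _ = mfderiv (𝓡∂ d) 𝓘(ℝ, ℝ) f (φ.symm (φ p))
    (mfderivWithin 𝓘(ℝ, EuclideanSpace ℝ (Fin d)) (𝓡∂ d) φ.symm (range (𝓡∂ d)) (φ p) v)
  rw [mfderivWithin_symm_apply (φ.map_source hp), hleft]

lemma coordDeriv_eq (hp : p ∈ (extChartAt (𝓡∂ d) x₀).source)
    (hf : MDifferentiableAt (𝓡∂ d) 𝓘(ℝ, ℝ) f p) (i : Fin d) :
    coordDeriv x₀ f p i = fderivWithin ℝ (f ∘ (extChartAt (𝓡∂ d) x₀).symm)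
      (extChartAt (𝓡∂ d) x₀).target (extChartAt (𝓡∂ d) x₀ p) (EuclideanSpace.single i 1) := by
  rw [coordDeriv, mfderiv_frameMap_eq_fderivWithin hp hf,
    -- The chart target and the half-space have the same germ at this point, so the two
    -- within-derivatives agree.
    fderivWithin_congr_set' (extChartAt (𝓡∂ d) x₀ p)]
  have h1 := nhdsWithin_extChartAt_target_eq' (I := 𝓡∂ d) hp
  refine Filter.EventuallyEq.filter_mono ?_ inf_le_left
  exact (nhdsWithin_eq_iff_eventuallyEq.1 h1).symm

lemma contDiffOn_comp_extChartAt_symm (hf : ContMDiff (𝓡∂ d) 𝓘(ℝ, ℝ) 1 f) (x₀ : M) :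
    ContDiffOn ℝ 1 (f ∘ (extChartAt (𝓡∂ d) x₀).symm) (extChartAt (𝓡∂ d) x₀).target := by
  rw [← contMDiffOn_iff_contDiffOn]
  exact hf.comp_contMDiffOn (contMDiffOn_extChartAt_symm x₀)

lemma continuousOn_coordDeriv (hf : ContMDiff (𝓡∂ d) 𝓘(ℝ, ℝ) 1 f) (x₀ : M) (i : Fin d) :
    ContinuousOn (fun p => coordDeriv x₀ f p i) (extChartAt (𝓡∂ d) x₀).source := by
  have h1 := (contDiffOn_comp_extChartAt_symm hf x₀).continuousOn_fderivWithin
    (uniqueDiffOn_extChartAt_target x₀) le_rfl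
  have h2 : ContinuousOn (fun p => fderivWithin ℝ (f ∘ (extChartAt (𝓡∂ d) x₀).symm)
      (extChartAt (𝓡∂ d) x₀).target (extChartAt (𝓡∂ d) x₀ p) (EuclideanSpace.single i 1))
      (extChartAt (𝓡∂ d) x₀).source :=
    (h1.comp (continuousOn_extChartAt x₀) fun p hp => (extChartAt (𝓡∂ d) x₀).map_source hp).clm_apply
      continuousOn_const
  exact h2.congr fun p hp => coordDeriv_eq hp (hf.mdifferentiable one_ne_zero p) i

lemma mfderiv_frameMap_eq_sum (v : EuclideanSpace ℝ (Fin d)) :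
    (mfderiv (𝓡∂ d) 𝓘(ℝ, ℝ) f p (frameMap d x₀ p v) : ℝ) = ∑ i, v i * coordDeriv x₀ f p i := by
  have hv : frameMap d x₀ p v = ∑ i, v i • frameMap d x₀ p (EuclideanSpace.single i 1) := by
    conv_lhs => rw [← (EuclideanSpace.basisFun (Fin d) ℝ).sum_repr v]
    simp [map_sum]
  rw [hv]
  refine (map_sum (mfderiv (𝓡∂ d) 𝓘(ℝ, ℝ) f p) _ _).trans (Finset.sum_congr rfl fun i _ => ?_)
  exact map_smul (mfderiv (𝓡∂ d) 𝓘(ℝ, ℝ) f p) _ _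

variable [RiemannianBundle (fun x : M ↦ TangentSpace (𝓡∂ d) x)]

omit [IsManifold (𝓡∂ d) ∞ M] in
lemma inner_grad (f : M → ℝ) (p : M) (w : TangentSpace (𝓡∂ d) p) :
    inner ℝ (grad d f p) w = mfderiv (𝓡∂ d) 𝓘(ℝ, ℝ) f p w :=
  InnerProductSpace.toDual_symm_apply

lemma inner_grad_grad_eq_sum (hp : p ∈ (extChartAt (𝓡∂ d) x₀).source) :
    inner ℝ (grad d f p) (grad d h p) =
      ∑ i, coordMap d x₀ p (grad d f p) i * coordDeriv x₀ h p i := by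
  rw [real_inner_comm, inner_grad, ← mfderiv_frameMap_eq_sum, frameMap_coordMap hp]

lemma metricMatrix_mulVec_coordMap_grad (hp : p ∈ (extChartAt (𝓡∂ d) x₀).source) :
    Matrix.mulVec (metricMatrix d x₀ p) (coordMap d x₀ p (grad d f p)).ofLp =
      coordDeriv x₀ f p := by
  funext i
  have h1 := inner_grad f p (frameMap d x₀ p (EuclideanSpace.single i 1))
  nth_rewrite 1 [← frameMap_coordMap hp (grad d f p)] at h1
  rw [real_inner_comm, inner_frameMap] at h1
  rw [coordDeriv, ← h1, Finset.sum_eq_single i (fun b _ hb => by simp [hb]) (by simp)]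
  simp [Matrix.mulVec, dotProduct, mul_comm]

lemma det_metricMatrix (p : M) : (metricMatrix d x₀ p).det =
    frameDensity (LinearIsometry.id : EuclideanSpace ℝ (Fin d) →ₗᵢ[ℝ] _) x₀ p ^ 2 := by
  rw [frameDensity_sq]
  rfl

/-- Cramer's rule for the linear system that the Gram matrix imposes on the gradient components. The
adjugate gives continuity of these components, and its corner entry gives the boundary density. -/
lemma det_smul_coordMap_grad (hp : p ∈ (extChartAt (𝓡∂ d) x₀).source) (i : Fin d) :
    (metricMatrix d x₀ p).det * coordMap d x₀ p (grad d f p) i =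
      ∑ j, (metricMatrix d x₀ p).adjugate i j * coordDeriv x₀ f p j := by
  have h1 := congrArg (Matrix.mulVec (metricMatrix d x₀ p).adjugate)
    (metricMatrix_mulVec_coordMap_grad (f := f) hp)
  rw [Matrix.mulVec_mulVec, Matrix.adjugate_mul, Matrix.smul_mulVec, Matrix.one_mulVec] at h1
  exact congrFun h1 i

variable [IsContMDiffRiemannianBundle (𝓡∂ d) 1 (EuclideanSpace ℝ (Fin d))
    (fun x : M ↦ TangentSpace (𝓡∂ d) x)]

lemma continuousOn_metricMatrix (x₀ : M) :
    ContinuousOn (metricMatrix d x₀) (extChartAt (𝓡∂ d) x₀).source :=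
  continuousOn_pi.2 fun i => continuousOn_pi.2 fun j =>
    (contMDiffOn_metricMatrix x₀ i j).continuousOn

lemma continuousOn_coordMap_grad (hf : ContMDiff (𝓡∂ d) 𝓘(ℝ, ℝ) 1 f) (x₀ : M) (i : Fin d) :
    ContinuousOn (fun p => coordMap d x₀ p (grad d f p) i) (extChartAt (𝓡∂ d) x₀).source := by
  have hdet : ∀ p ∈ (extChartAt (𝓡∂ d) x₀).source, (metricMatrix d x₀ p).det ≠ 0 := fun p hp => by
    rw [det_metricMatrix]
    exact (pow_pos (frameDensity_pos _ hp) 2).ne'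
  have h1 : ContinuousOn (fun p => (metricMatrix d x₀ p).det⁻¹ *
      ∑ j, (metricMatrix d x₀ p).adjugate i j * coordDeriv x₀ f p j)
      (extChartAt (𝓡∂ d) x₀).source := by
    have hG := continuousOn_metricMatrix (d := d) x₀
    refine ContinuousOn.mul (ContinuousOn.inv₀ ?_ hdet) (continuousOn_finsetSum _ fun j _ =>
      ContinuousOn.mul ?_ (continuousOn_coordDeriv hf x₀ j))
    · exact (continuous_id.matrix_det).comp_continuousOn hG
    · exact (continuous_id.matrix_adjugate.matrix_elem i j).comp_continuousOn hG
  refine h1.congr fun p hp => ?_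
  simp only
  rw [← det_smul_coordMap_grad hp, inv_mul_cancel_left₀ (hdet p hp)]

lemma continuous_inner_grad_grad (hf : ContMDiff (𝓡∂ d) 𝓘(ℝ, ℝ) 1 f)
    (hh : ContMDiff (𝓡∂ d) 𝓘(ℝ, ℝ) 1 h) :
    Continuous fun p => inner ℝ (grad d f p) (grad d h p) := by
  refine continuous_iff_continuousAt.2 fun x₀ => ?_
  refine ContinuousOn.continuousAt ?_ (extChartAt_source_mem_nhds (I := 𝓡∂ d) x₀)
  exact (continuousOn_finsetSum _ fun i _ => (continuousOn_coordMap_grad hf x₀ i).mul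
    (continuousOn_coordDeriv hh x₀ i)).congr fun p hp => inner_grad_grad_eq_sum hp

lemma continuous_norm_grad (hf : ContMDiff (𝓡∂ d) 𝓘(ℝ, ℝ) 1 f) :
    Continuous fun p => ‖grad d f p‖ := by
  have h := (continuous_inner_grad_grad hf hf).sqrt
  refine h.congr fun p => ?_
  rw [real_inner_self_eq_norm_sq, Real.sqrt_sq (norm_nonneg _)]

end Gradient

/-! ### Boundary points and the normal component of a gradient. -/

section Boundary

variable {d : ℕ} [NeZero d] {M : Type*} [EMetricSpace M]
  [ChartedSpace (EuclideanHalfSpace d) M] [IsManifold (𝓡∂ d) ∞ M]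

variable {x₀ p : M}

omit [IsManifold (𝓡∂ d) ∞ M] in
lemma extChartAt_zero_nonneg (hp : p ∈ (extChartAt (𝓡∂ d) x₀).source) :
    0 ≤ extChartAt (𝓡∂ d) x₀ p 0 := by
  have h := extChartAt_target_subset_range x₀ ((extChartAt (𝓡∂ d) x₀).map_source hp)
  rwa [range_modelWithCornersEuclideanHalfSpace] at h

lemma mem_interior_iff (hp : p ∈ (extChartAt (𝓡∂ d) x₀).source) :
    p ∈ (𝓡∂ d).interior M ↔ 0 < extChartAt (𝓡∂ d) x₀ p 0 := by
  have h1 : p ∈ (𝓡∂ d).interior M ↔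
      extChartAt (𝓡∂ d) x₀ p ∈ interior (extChartAt (𝓡∂ d) x₀).target :=
    (𝓡∂ d).isInteriorPoint_iff_of_mem_atlas (n := ∞) (by simp)
      (chart_mem_atlas (EuclideanHalfSpace d) x₀) (by rwa [extChartAt_source] at hp)
  have h2 : ∀ y : EuclideanSpace ℝ (Fin d), 0 < y 0 ↔ y ∈ interior (range (𝓡∂ d)) := fun y => by
    rw [interior_range_modelWithCornersEuclideanHalfSpace, mem_ofPred_eq]
  rw [h1, h2]
  refine ⟨fun h => interior_mono (extChartAt_target_subset_range x₀) h, fun h => ?_⟩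
  rw [mem_interior_iff_mem_nhds] at h ⊢
  have h3 := extChartAt_target_mem_nhdsWithin' (I := 𝓡∂ d) hp
  rwa [nhdsWithin_eq_nhds.2 h] at h3

lemma mem_boundary_iff (hp : p ∈ (extChartAt (𝓡∂ d) x₀).source) :
    p ∈ (𝓡∂ d).boundary M ↔ extChartAt (𝓡∂ d) x₀ p 0 = 0 := by
  rw [← (𝓡∂ d).compl_interior, mem_compl_iff, mem_interior_iff hp, not_lt]
  exact ⟨fun h => le_antisymm h (extChartAt_zero_nonneg hp), fun h => h.le⟩

lemma mfderiv_extChartAt_zero (hp : p ∈ (extChartAt (𝓡∂ d) x₀).source)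
    (w : TangentSpace (𝓡∂ d) p) :
    (mfderiv (𝓡∂ d) 𝓘(ℝ, ℝ) (fun q => extChartAt (𝓡∂ d) x₀ q 0) p w : ℝ) =
      coordMap d x₀ p w 0 := by
  have h1 : MDifferentiableAt (𝓡∂ d) 𝓘(ℝ, EuclideanSpace ℝ (Fin d)) (extChartAt (𝓡∂ d) x₀) p :=
    mdifferentiableAt_extChartAt (by rwa [extChartAt_source] at hp)
  have h2 := mfderiv_comp p
    ((EuclideanSpace.proj (0 : Fin d) : EuclideanSpace ℝ (Fin d) →L[ℝ] ℝ).mdifferentiableAt) h1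
  rw [coordMap_eq_mfderiv hp]
  refine congr($h2 w).trans ?_
  rw [ContinuousLinearMap.mfderiv_eq]
  rfl

lemma mdifferentiableAt_extChartAt_zero (hp : p ∈ (extChartAt (𝓡∂ d) x₀).source) :
    MDifferentiableAt (𝓡∂ d) 𝓘(ℝ, ℝ) (fun q => extChartAt (𝓡∂ d) x₀ q 0) p :=
  ((EuclideanSpace.proj (0 : Fin d) : EuclideanSpace ℝ (Fin d) →L[ℝ] ℝ).mdifferentiableAt).comp p
    (mdifferentiableAt_extChartAt (by rwa [extChartAt_source] at hp))

/-- At a boundary point the differentials of the boundary coordinates of two charts are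
nonnegative multiples of each other. -/
lemma exists_coordMap_zero_eq_mul (hp : p ∈ (extChartAt (𝓡∂ d) x₀).source)
    (hpb : p ∈ (𝓡∂ d).boundary M) :
    ∃ a : ℝ, 0 ≤ a ∧ ∀ w : TangentSpace (𝓡∂ d) p, coordMap d x₀ p w 0 = a * coordMap d p p w 0 := by
  set ψ := extChartAt (𝓡∂ d) p
  have hpp : p ∈ ψ.source := mem_extChartAt_source p
  set τ : M → ℝ := fun q => extChartAt (𝓡∂ d) x₀ q 0
  have hψ0 : ψ p 0 = 0 := (mem_boundary_iff hpp).1 hpb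
  -- The boundary coordinate `τ` of the other chart is nonnegative and vanishes at `p`. Its
  -- differential is therefore nonnegative on inward vectors, and zero on tangential ones, since
  -- these are inward together with their negatives.
  have hmin : IsLocalMinOn (τ ∘ ψ.symm) (range (𝓡∂ d)) (ψ p) := by
    have h1 : (τ ∘ ψ.symm) (ψ p) = 0 := by
      rw [Function.comp_apply, ψ.left_inv hpp]
      exact (mem_boundary_iff hp).1 hpb
    have h2 : ∀ᶠ y in 𝓝 (ψ p), ψ.symm y ∈ (extChartAt (𝓡∂ d) x₀).source :=
      (continuousAt_extChartAt_symm' hpp).eventually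
        (extChartAt_source_mem_nhds' (by rwa [ψ.left_inv hpp]))
    refine Filter.Eventually.filter_mono nhdsWithin_le_nhds ?_
    filter_upwards [h2] with y hy
    rw [h1]
    exact extChartAt_zero_nonneg hy
  have hcone : ∀ v : EuclideanSpace ℝ (Fin d), 0 ≤ v 0 →
      v ∈ posTangentConeAt (range (𝓡∂ d)) (ψ p) := by
    intro v hv
    refine mem_posTangentConeAt_of_segment_subset ?_
    refine (𝓡∂ d).convex_range.segment_subset ?_ ?_ <;>
    rw [range_modelWithCornersEuclideanHalfSpace, mem_ofPred_eq]
    · exact hψ0.ge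
    · simpa [hψ0] using hv
  have hdiff := mdifferentiableAt_extChartAt_zero hp
  have hD : ∀ v, coordMap d x₀ p (frameMap d p p v) 0 =
      fderivWithin ℝ (τ ∘ ψ.symm) (range (𝓡∂ d)) (ψ p) v := fun v => by
    rw [← mfderiv_extChartAt_zero hp, mfderiv_frameMap_eq_fderivWithin hpp hdiff]
  set D := fderivWithin ℝ (τ ∘ ψ.symm) (range (𝓡∂ d)) (ψ p)
  have hnn : ∀ v : EuclideanSpace ℝ (Fin d), 0 ≤ v 0 → 0 ≤ D v := fun v hv =>
    hmin.fderivWithin_nonneg (hcone v hv)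
  refine ⟨D (EuclideanSpace.single 0 1), hnn _ (by simp), fun w => ?_⟩
  rw [← frameMap_coordMap hpp w, hD, coordMap_frameMap hpp]
  set v := coordMap d p p w
  have h3 : D (v - v 0 • EuclideanSpace.single 0 1) = 0 := by
    refine le_antisymm ?_ (hnn _ (by simp))
    have := hnn (-(v - v 0 • EuclideanSpace.single 0 1)) (by simp)
    rw [map_neg] at this
    linarith
  rw [map_sub, map_smul, smul_eq_mul] at h3
  linarith

variable [RiemannianBundle (fun x : M ↦ TangentSpace (𝓡∂ d) x)]

lemma coordMap_zero_eq_inner (hp : p ∈ (extChartAt (𝓡∂ d) x₀).source)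
    (w : TangentSpace (𝓡∂ d) p) :
    coordMap d x₀ p w 0 = inner ℝ (grad d (fun q => extChartAt (𝓡∂ d) x₀ q 0) p) w := by
  rw [inner_grad, mfderiv_extChartAt_zero hp]

/-- The boundary component of a gradient with normal derivative `-1`. -/
lemma coordMap_grad_zero_eq_norm {ρ : M → ℝ} (hp : p ∈ (extChartAt (𝓡∂ d) x₀).source)
    (hpb : p ∈ (𝓡∂ d).boundary M) (hN : normalDeriv d ρ p = -1) :
    coordMap d x₀ p (grad d ρ p) 0 = ‖grad d (fun q => extChartAt (𝓡∂ d) x₀ q 0) p‖ := by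
  obtain ⟨a, ha, haw⟩ := exists_coordMap_zero_eq_mul hp hpb
  have hpp : p ∈ (extChartAt (𝓡∂ d) p).source := mem_extChartAt_source p
  set T := grad d (fun q => extChartAt (𝓡∂ d) p q 0) p
  have h1 : grad d (fun q => extChartAt (𝓡∂ d) x₀ q 0) p = a • T := by
    refine ext_inner_right ℝ fun w => ?_
    rw [← coordMap_zero_eq_inner hp, haw, real_inner_smul_left, ← coordMap_zero_eq_inner hpp]
  -- The outward normal is defined through the chart centred at `p`. The hypothesis also forces `T ≠
  -- 0`: with the convention `0⁻¹ = 0` the normal derivative would otherwise be 0.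
  have hT : inner ℝ (grad d ρ p) T = ‖T‖ := by
    have h2 : inner ℝ (grad d ρ p) (-(‖T‖⁻¹ • T)) = -1 := hN
    rw [inner_neg_right, real_inner_smul_right, neg_inj] at h2
    have h3 : ‖T‖ ≠ 0 := fun h0 => by simp [h0] at h2
    field_simp at h2
    exact h2
  rw [haw, coordMap_zero_eq_inner hpp, h1, norm_smul, Real.norm_of_nonneg ha, real_inner_comm, hT]

end Boundary

/-! ### Boundary area density and volume density. -/

section Density

variable {n : ℕ} {M : Type*} [EMetricSpace M]
  [ChartedSpace (EuclideanHalfSpace (n + 1)) M] [IsManifold (𝓡∂ (n + 1)) ∞ M]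
  [RiemannianBundle (fun x : M ↦ TangentSpace (𝓡∂ (n + 1)) x)] {x₀ p : M}

/-- The boundary volume density is the volume density times the length of the gradient of the
boundary coordinate. -/
lemma frameDensity_mul_norm_grad (hp : p ∈ (extChartAt (𝓡∂ (n + 1)) x₀).source) :
    frameDensity (LinearIsometry.id : EuclideanSpace ℝ (Fin (n + 1)) →ₗᵢ[ℝ] _) x₀ p *
      ‖grad (n + 1) (fun q => extChartAt (𝓡∂ (n + 1)) x₀ q 0) p‖ =
    frameDensity (bdInclₗ n) x₀ p := by
  set T := grad (n + 1) (fun q => extChartAt (𝓡∂ (n + 1)) x₀ q 0) p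
  refine (sq_eq_sq₀ (mul_nonneg (frameDensity_nonneg _ _ _) (norm_nonneg _))
    (frameDensity_nonneg _ _ _)).1 ?_
  rw [mul_pow, ← det_metricMatrix, ← real_inner_self_eq_norm_sq, ← coordMap_zero_eq_inner hp,
    det_smul_coordMap_grad hp, frameDensity_sq]
  have hcd : ∀ j, coordDeriv x₀ (fun q => extChartAt (𝓡∂ (n + 1)) x₀ q 0) p j =
      if j = 0 then 1 else 0 := fun j => by
    refine (mfderiv_extChartAt_zero hp _).trans ?_
    rw [coordMap_frameMap hp, PiLp.single_apply]
    split_ifs with h1 h2 h2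
    · rfl
    · exact absurd h1.symm h2
    · exact absurd h2.symm h1
    · rfl
  simp only [hcd, mul_ite, mul_one, mul_zero, Finset.sum_ite_eq', Finset.mem_univ, if_true]
  -- The squared length of the gradient of `x⁰` is its own zeroth component; times the Gram
  -- determinant it is the `(0, 0)` entry of the adjugate, that is, the Gram determinant of the
  -- tangential frame.
  rw [Matrix.adjugate_fin_succ_eq_det_submatrix]
  simp only [Fin.val_zero, add_zero, pow_zero, one_mul]
  congr 1
  ext i j
  simp [metricMatrix, bdIncl_single]

end Density
end BoundaryVariance

namespace BoundaryVariance

/-! ### Chart half balls: Lipschitz data and integrals in coordinates. -/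

lemma LipschitzOnWith.exists_mul {E : Type*} [PseudoMetricSpace E] {f g : E → ℝ} {s : Set E}
    {K K' : ℝ≥0} {A B : ℝ} (hf : LipschitzOnWith K f s) (hg : LipschitzOnWith K' g s)
    (hA : ∀ x ∈ s, |f x| ≤ A) (hB : ∀ x ∈ s, |g x| ≤ B) :
    ∃ C, LipschitzOnWith C (fun x => f x * g x) s := by
  refine ⟨Real.toNNReal (A * K' + B * K), LipschitzOnWith.of_dist_le_mul fun x hx y hy => ?_⟩
  have h1 := hf.dist_le_mul x hx y hy
  have h2 := hg.dist_le_mul x hx y hy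
  have hA0 := (abs_nonneg _).trans (hA x hx)
  have hB0 := (abs_nonneg _).trans (hB x hx)
  rw [Real.coe_toNNReal _ (by positivity)]
  rw [Real.dist_eq] at *
  calc |f x * g x - f y * g y| = |f x * (g x - g y) + (f x - f y) * g y| := by ring_nf
    _ ≤ |f x| * |g x - g y| + |f x - f y| * |g y| := by
      rw [← abs_mul, ← abs_mul]; exact abs_add_le _ _
    _ ≤ A * (K' * dist x y) + (K * dist x y) * B := by
      gcongr
      exacts [hA x hx, hB y hy]
    _ = _ := by ring

lemma LipschitzOnWith.exists_abs_le {E : Type*} [PseudoMetricSpace E] {f : E → ℝ} {c : E} {r : ℝ}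
    {s : Set E} {K : ℝ≥0} (hf : LipschitzOnWith K f (Metric.ball c r ∩ s)) :
    ∃ A, ∀ x ∈ Metric.ball c r ∩ s, |f x| ≤ A := by
  rcases (Metric.ball c r ∩ s).eq_empty_or_nonempty with h | ⟨y, hy⟩
  · exact ⟨0, by simp [h]⟩
  refine ⟨K * (r + r) + |f y|, fun x hx => ?_⟩
  have h1 := hf.dist_le_mul x hx y hy
  rw [Real.dist_eq] at h1
  have h2 : |f x| ≤ |f x - f y| + |f y| := by simpa using abs_add_le (f x - f y) (f y)
  have h3 : dist x y ≤ r + r := (dist_triangle_right x y c).trans (add_le_add hx.1.le hy.1.le)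
  have h4 : K * dist x y ≤ K * (r + r) := by gcongr
  linarith

section ChartBall

variable {n : ℕ} {M : Type*} [EMetricSpace M]
  [ChartedSpace (EuclideanHalfSpace (n + 1)) M] [IsManifold (𝓡∂ (n + 1)) ∞ M]
  [RiemannianBundle (fun x : M ↦ TangentSpace (𝓡∂ (n + 1)) x)]
  {x₀ : M} {c : EuclideanSpace ℝ (Fin (n + 1))} {r : ℝ}

omit [IsManifold (𝓡∂ (n + 1)) ∞ M] [RiemannianBundle (fun x : M ↦ TangentSpace (𝓡∂ (n + 1)) x)] in
lemma exists_closedBall_subset_target (x₀ : M) : ∃ R > 0,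
    Metric.closedBall (extChartAt (𝓡∂ (n + 1)) x₀ x₀) R ∩ {y | 0 ≤ y 0} ⊆
      (extChartAt (𝓡∂ (n + 1)) x₀).target := by
  obtain ⟨ε, hε, h⟩ := Metric.mem_nhdsWithin_iff.1
    (extChartAt_target_mem_nhdsWithin (I := 𝓡∂ (n + 1)) x₀)
  rw [range_modelWithCornersEuclideanHalfSpace] at h
  exact ⟨ε / 2, half_pos hε, (inter_subset_inter_left _
    (Metric.closedBall_subset_ball (half_lt_self hε))).trans h⟩

omit [IsManifold (𝓡∂ (n + 1)) ∞ M] [RiemannianBundle (fun x : M ↦ TangentSpace (𝓡∂ (n + 1)) x)] in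
-- A `C¹` function on a convex set is locally Lipschitz, and the closed half ball is convex and
-- compact.
lemma exists_lipschitzOnWith_of_contDiffOn_target {g : EuclideanSpace ℝ (Fin (n + 1)) → ℝ}
    (hg : ContDiffOn ℝ 1 g (extChartAt (𝓡∂ (n + 1)) x₀).target)
    (hr : Metric.closedBall c r ∩ {y | 0 ≤ y 0} ⊆ (extChartAt (𝓡∂ (n + 1)) x₀).target) :
    ∃ K, LipschitzOnWith K g (Metric.ball c r ∩ {y | 0 ≤ y 0}) := by
  have hcl : IsClosed {y : EuclideanSpace ℝ (Fin (n + 1)) | 0 ≤ y 0} :=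
    isClosed_le continuous_const (by fun_prop)
  have hconv : Convex ℝ (Metric.closedBall c r ∩ {y : EuclideanSpace ℝ (Fin (n + 1)) | 0 ≤ y 0}) :=
    (convex_closedBall _ _).inter EuclideanHalfSpace.convex
  obtain ⟨K, hK⟩ := ((hg.mono hr).locallyLipschitzOn hconv).exists_lipschitzOnWith_of_compact
    ((isCompact_closedBall c r).inter_right hcl)
  exact ⟨K, hK.mono (inter_subset_inter_left _ Metric.ball_subset_closedBall)⟩

variable (n x₀) in
/-- The Riemannian volume density in the chart at `x₀`. -/
noncomputable def volDensity (p : M) : ℝ :=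
  frameDensity (LinearIsometry.id : EuclideanSpace ℝ (Fin (n + 1)) →ₗᵢ[ℝ] _) x₀ p

lemma chartDensity_id {y : EuclideanSpace ℝ (Fin (n + 1))}
    (hy : y ∈ (extChartAt (𝓡∂ (n + 1)) x₀).target) :
    chartDensity (LinearIsometry.id : EuclideanSpace ℝ (Fin (n + 1)) →ₗᵢ[ℝ] _) x₀ y =
      volDensity n x₀ ((extChartAt (𝓡∂ (n + 1)) x₀).symm y) := if_pos hy

omit [IsManifold (𝓡∂ (n + 1)) ∞ M] [RiemannianBundle (fun x : M ↦ TangentSpace (𝓡∂ (n + 1)) x)] in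
lemma chartParam_id {y : EuclideanSpace ℝ (Fin (n + 1))}
    (hy : y ∈ (extChartAt (𝓡∂ (n + 1)) x₀).target) :
    chartParam (LinearIsometry.id : EuclideanSpace ℝ (Fin (n + 1)) →ₗᵢ[ℝ] _) x₀ y =
      (extChartAt (𝓡∂ (n + 1)) x₀).symm y := if_pos hy

variable [IsContMDiffRiemannianBundle (𝓡∂ (n + 1)) 1 (EuclideanSpace ℝ (Fin (n + 1)))
    (fun x : M ↦ TangentSpace (𝓡∂ (n + 1)) x)]

lemma contDiffOn_volDensity (x₀ : M) :
    ContDiffOn ℝ 1 (fun y => volDensity n x₀ ((extChartAt (𝓡∂ (n + 1)) x₀).symm y))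
      (extChartAt (𝓡∂ (n + 1)) x₀).target := by
  have h1 : ∀ i j, ContDiffOn ℝ 1
      (fun y => metricMatrix (n + 1) x₀ ((extChartAt (𝓡∂ (n + 1)) x₀).symm y) i j)
      (extChartAt (𝓡∂ (n + 1)) x₀).target := fun i j => by
    rw [← contMDiffOn_iff_contDiffOn]
    exact (contMDiffOn_metricMatrix x₀ i j).comp (contMDiffOn_extChartAt_symm x₀)
      fun y hy => (extChartAt (𝓡∂ (n + 1)) x₀).map_target hy
  have h2 : ContDiffOn ℝ 1
      (fun y => (metricMatrix (n + 1) x₀ ((extChartAt (𝓡∂ (n + 1)) x₀).symm y)).det)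
      (extChartAt (𝓡∂ (n + 1)) x₀).target := by
    simp only [Matrix.det_apply']
    exact ContDiffOn.sum fun σ _ => contDiffOn_const.mul (contDiffOn_prod fun i _ => h1 _ _)
  refine (h2.sqrt fun y hy => ?_).congr fun y hy => ?_
  · rw [det_metricMatrix]
    exact (pow_pos (frameDensity_pos _ ((extChartAt (𝓡∂ (n + 1)) x₀).map_target hy)) 2).ne'
  · rw [det_metricMatrix, Real.sqrt_sq (frameDensity_nonneg _ _ _), volDensity]

variable [IsRiemannianManifold (𝓡∂ (n + 1)) M]

/-- The hypothesis measures the components against the distance of `M`; the inverse chart is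
Lipschitz near the centre, so they are Lipschitz in the coordinates too. -/
lemma exists_lipschitzOnWith_coordMap {V : ∀ x : M, TangentSpace (𝓡∂ (n + 1)) x}
    (hV : IsLipschitzField (n + 1) V) (x₀ : M) :
    ∃ r > 0, ∀ i, ∃ K, LipschitzOnWith K
      (fun y => coordMap (n + 1) x₀ ((extChartAt (𝓡∂ (n + 1)) x₀).symm y)
        (V ((extChartAt (𝓡∂ (n + 1)) x₀).symm y)) i)
      (Metric.ball (extChartAt (𝓡∂ (n + 1)) x₀ x₀) r ∩ {y | 0 ≤ y 0}) := by
  set φ := extChartAt (𝓡∂ (n + 1)) x₀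
  obtain ⟨K, U, hU, hK⟩ := hV x₀
  obtain ⟨W, hW, hWs, hWe⟩ := exists_edist_le (mem_extChartAt_source (I := 𝓡∂ (n + 1)) x₀)
    (one_lt_two : (1 : ℝ) < 2)
  have h1 : φ.symm ⁻¹' (U ∩ W) ∩ φ.target ∈ 𝓝[range (𝓡∂ (n + 1))] (φ x₀) := by
    refine Filter.inter_mem (nhdsWithin_le_nhds ?_) (extChartAt_target_mem_nhdsWithin x₀)
    exact (continuousAt_extChartAt_symm x₀).preimage_mem_nhds
      (by rw [extChartAt_to_inv]; exact Filter.inter_mem hU hW)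
  obtain ⟨r, hr, hrs⟩ := Metric.mem_nhdsWithin_iff.1 h1
  rw [range_modelWithCornersEuclideanHalfSpace] at hrs
  refine ⟨r, hr, fun i => ⟨K * (2 * ‖frameMap (n + 1) x₀ x₀‖₊), fun y hy y' hy' => ?_⟩⟩
  obtain ⟨⟨hyU, hyW⟩, hyt⟩ := hrs hy
  obtain ⟨⟨hyU', hyW'⟩, hyt'⟩ := hrs hy'
  have h2 := hK hyU hyU'
  simp only at h2
  rw [trivializationAt_snd_eq_coordMap (hWs hyW), trivializationAt_snd_eq_coordMap (hWs hyW')] at h2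
  have h3 := hWe _ hyW _ hyW'
  rw [φ.right_inv hyt, φ.right_inv hyt'] at h3
  have h4 : edist (φ.symm y) (φ.symm y') ≤ (2 * ‖frameMap (n + 1) x₀ x₀‖₊ : ℝ≥0) * edist y y' := by
    refine h3.trans ?_
    rw [edist_comm y y', edist_eq_enorm_sub, ENNReal.coe_mul, mul_assoc]
    refine mul_le_mul' (by simp) (ContinuousLinearMap.le_opENorm _ _)
  refine le_trans ?_ (h2.trans ?_)
  · have := (PiLp.lipschitzWith_ofLp 2 (fun _ : Fin (n + 1) => ℝ)
      (coordMap (n + 1) x₀ (φ.symm y) (V (φ.symm y)))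
      (coordMap (n + 1) x₀ (φ.symm y') (V (φ.symm y'))))
    rw [ENNReal.coe_one, one_mul] at this
    exact (edist_le_pi_edist _ _ i).trans this
  · rw [ENNReal.coe_mul, mul_assoc]
    gcongr

variable [SecondCountableTopology M] [MeasurableSpace M] [BorelSpace M]

/-- Integrals of functions supported in a chart ball, in coordinates. -/
lemma integral_eq_setIntegral_halfBall {g : M → ℝ}
    (hg : AEStronglyMeasurable g (μHE[n + 1] : Measure M))
    (hr : Metric.ball c r ∩ {y | 0 ≤ y 0} ⊆ (extChartAt (𝓡∂ (n + 1)) x₀).target)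
    (h0 : ∀ p, (p ∈ (extChartAt (𝓡∂ (n + 1)) x₀).source →
      extChartAt (𝓡∂ (n + 1)) x₀ p ∉ Metric.ball c r) → g p = 0) :
    ∫ p, g p ∂(μHE[n + 1] : Measure M) = ∫ y in Metric.ball c r ∩ {y | 0 < y 0},
      volDensity n x₀ ((extChartAt (𝓡∂ (n + 1)) x₀).symm y) *
        g ((extChartAt (𝓡∂ (n + 1)) x₀).symm y) := by
  set φ := extChartAt (𝓡∂ (n + 1)) x₀
  set ι : EuclideanSpace ℝ (Fin (n + 1)) →ₗᵢ[ℝ] EuclideanSpace ℝ (Fin (n + 1)) :=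
    LinearIsometry.id
  have h1 : ∫ p in φ.source, g p ∂(μHE[n + 1] : Measure M) = ∫ p, g p ∂(μHE[n + 1] : Measure M) :=
    setIntegral_eq_integral_of_forall_compl_eq_zero fun p hp => h0 p fun h => absurd h hp
  have hcl : MeasurableSet {y : EuclideanSpace ℝ (Fin (n + 1)) | 0 ≤ y 0} :=
    (isClosed_le continuous_const (by fun_prop)).measurableSet
  have hsupp : ∀ z ∉ Metric.ball c r ∩ {y : EuclideanSpace ℝ (Fin (n + 1)) | 0 ≤ y 0},
      chartDensity ι x₀ z * g (chartParam ι x₀ z) = 0 := by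
    intro z hz
    by_cases hzt : z ∈ φ.target
    · have hzr : z ∈ range (𝓡∂ (n + 1)) := extChartAt_target_subset_range x₀ hzt
      rw [range_modelWithCornersEuclideanHalfSpace] at hzr
      rw [chartParam_id hzt, h0, mul_zero]
      intro _ hb
      rw [φ.right_inv hzt] at hb
      exact hz ⟨hb, hzr⟩
    · rw [chartDensity, if_neg (show ι z ∉ (extChartAt (𝓡∂ (n + 1)) x₀).target from hzt), zero_mul]
  -- The coordinate hyperplane is Lebesgue null, so the open half ball, where ordinary derivatives
  -- exist, may replace the relatively closed one.
  have hae : (Metric.ball c r ∩ {y : EuclideanSpace ℝ (Fin (n + 1)) | 0 ≤ y 0} : Set _) =ᵐ[volume]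
      (Metric.ball c r ∩ {y : EuclideanSpace ℝ (Fin (n + 1)) | 0 < y 0} : Set _) := by
    have h2 : ∀ᵐ y : EuclideanSpace ℝ (Fin (n + 1)), y 0 ≠ 0 := by
      rw [ae_iff]; simpa using volume_hyperplane_eq_zero
    filter_upwards [h2] with y hy
    refine propext (and_congr_right fun _ => ?_)
    exact ⟨fun h => lt_of_le_of_ne (show 0 ≤ y 0 from h) hy.symm,
      fun h => (show 0 < y 0 from h).le⟩
  rw [← h1, euclideanHausdorffMeasure_restrict_source, integral_chartMeasure ι (by
      rw [← euclideanHausdorffMeasure_restrict_source]; exact hg.restrict),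
    ← setIntegral_eq_integral_of_forall_compl_eq_zero hsupp, setIntegral_congr_set hae]
  refine setIntegral_congr_fun (Metric.isOpen_ball.inter isOpen_openHalfSpace).measurableSet
    fun y hy => ?_
  have hyt : y ∈ φ.target := hr ⟨hy.1, (show 0 < y 0 from hy.2).le⟩
  rw [chartDensity_id hyt, chartParam_id hyt]

/-- Boundary integrals of functions supported in a chart ball are dominated by integrals in
coordinates. -/
lemma lintegral_boundary_le {g : M → ℝ≥0∞} (hg : Measurable g)
    (hr : Metric.ball c r ∩ {y | 0 ≤ y 0} ⊆ (extChartAt (𝓡∂ (n + 1)) x₀).target)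
    (h0 : ∀ p, (p ∈ (extChartAt (𝓡∂ (n + 1)) x₀).source →
      extChartAt (𝓡∂ (n + 1)) x₀ p ∉ Metric.ball c r) → g p = 0) :
    ∫⁻ p in (𝓡∂ (n + 1)).boundary M, g p ∂(μHE[n] : Measure M) ≤
      ∫⁻ z in bdIncl n ⁻¹' Metric.ball c r, ENNReal.ofReal (frameDensity (bdInclₗ n) x₀
        ((extChartAt (𝓡∂ (n + 1)) x₀).symm (bdIncl n z))) *
          g ((extChartAt (𝓡∂ (n + 1)) x₀).symm (bdIncl n z)) := by
  set φ := extChartAt (𝓡∂ (n + 1)) x₀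
  have hsrc : MeasurableSet φ.source := (isOpen_extChartAt_source x₀).measurableSet
  have hbd : MeasurableSet ((𝓡∂ (n + 1)).boundary M) :=
    ((𝓡∂ (n + 1)).isClosed_boundary (n := ∞) (by simp)).measurableSet
  have hmeas : (μHE[n] : Measure M).restrict ((𝓡∂ (n + 1)).boundary M ∩ φ.source) ≤
      chartMeasure (bdInclₗ n) x₀ := by
    refine Measure.le_iff.2 fun A hA => ?_
    rw [Measure.restrict_apply hA]
    refine (euclideanHausdorffMeasure_le_chartMeasure (bdInclₗ n)
      (S := (𝓡∂ (n + 1)).boundary M ∩ φ.source) (x₀ := x₀) inter_subset_right ?_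
      inter_subset_right (hA.inter (hbd.inter hsrc))).trans (measure_mono inter_subset_left)
    rintro q ⟨hqb, hqs⟩
    refine ⟨WithLp.toLp 2 fun i => φ q i.succ, ?_⟩
    ext i
    refine Fin.cases ?_ (fun j => ?_) i
    · exact ((mem_boundary_iff hqs).1 hqb).symm
    · rfl
  calc ∫⁻ p in (𝓡∂ (n + 1)).boundary M, g p ∂(μHE[n] : Measure M)
      = ∫⁻ p in (𝓡∂ (n + 1)).boundary M ∩ φ.source, g p ∂(μHE[n] : Measure M) := by
        rw [inter_comm, ← Measure.restrict_restrict hsrc]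
        refine (setLIntegral_eq_of_support_subset fun p hp => ?_).symm
        by_contra hps
        exact hp (h0 p fun h => absurd h hps)
    _ ≤ ∫⁻ p, g p ∂chartMeasure (bdInclₗ n) x₀ := lintegral_mono' hmeas le_rfl
    _ = ∫⁻ z, ENNReal.ofReal (chartDensity (bdInclₗ n) x₀ z) *
          g (chartParam (bdInclₗ n) x₀ z) := lintegral_chartMeasure _ hg
    _ = ∫⁻ z in bdIncl n ⁻¹' Metric.ball c r, ENNReal.ofReal (chartDensity (bdInclₗ n) x₀ z) *
          g (chartParam (bdInclₗ n) x₀ z) := by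
        refine (setLIntegral_eq_of_support_subset fun z hz => ?_).symm
        by_contra hzb
        refine hz ?_
        simp only
        by_cases hzt : bdInclₗ n z ∈ φ.target
        · rw [chartParam, if_pos hzt, h0, mul_zero]
          intro _ hb
          rw [φ.right_inv hzt] at hb
          exact hzb hb
        · rw [chartDensity, if_neg hzt, ENNReal.ofReal_zero, zero_mul]
    _ = _ := by
        refine setLIntegral_congr_fun (Metric.isOpen_ball.preimage
          isometry_bdIncl.continuous).measurableSet fun z hz => ?_
        have hzt : bdInclₗ n z ∈ φ.target := hr ⟨hz, (le_refl (0 : ℝ))⟩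
        rw [chartDensity, if_pos hzt, chartParam, if_pos hzt]
        rfl

end ChartBall
end BoundaryVariance

namespace BoundaryVariance

/-! ### Green's formula near a point. -/

section LocalGreen

variable {n : ℕ} {M : Type*} [EMetricSpace M]
  [ChartedSpace (EuclideanHalfSpace (n + 1)) M] [IsManifold (𝓡∂ (n + 1)) ∞ M]
  [RiemannianBundle (fun x : M ↦ TangentSpace (𝓡∂ (n + 1)) x)]
  [IsContMDiffRiemannianBundle (𝓡∂ (n + 1)) 1 (EuclideanSpace ℝ (Fin (n + 1)))
    (fun x : M ↦ TangentSpace (𝓡∂ (n + 1)) x)]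
  [IsRiemannianManifold (𝓡∂ (n + 1)) M]
  [SecondCountableTopology M] [MeasurableSpace M] [BorelSpace M]

/-- A bounded function in a chart ball, divided by the volume density, is integrable. -/
lemma exists_integrable_div_volDensity (x₀ : M) {c : EuclideanSpace ℝ (Fin (n + 1))} {r A : ℝ}
    {D : EuclideanSpace ℝ (Fin (n + 1)) → ℝ} (hD : Measurable D) (hA : ∀ y, |D y| ≤ A)
    (hDr : ∀ y ∉ Metric.ball c r, D y = 0) :
    ∃ L : M → ℝ, Integrable L (μHE[n + 1] : Measure M) ∧
      (∀ p ∉ (extChartAt (𝓡∂ (n + 1)) x₀).source, L p = 0) ∧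
      ∀ p ∈ (extChartAt (𝓡∂ (n + 1)) x₀).source,
        L p = (volDensity n x₀ p)⁻¹ * D (extChartAt (𝓡∂ (n + 1)) x₀ p) := by
  classical
  set φ := extChartAt (𝓡∂ (n + 1)) x₀
  have hsrc : MeasurableSet φ.source := (isOpen_extChartAt_source x₀).measurableSet
  have h1 : Measurable (φ.source.piecewise φ fun _ => 0) :=
    ContinuousOn.measurable_piecewise (continuousOn_extChartAt x₀) continuousOn_const hsrc
  have h2 : Measurable (φ.source.piecewise (fun p => (volDensity n x₀ p)⁻¹) fun _ => 0) :=
    ContinuousOn.measurable_piecewise ((continuousOn_frameDensity _).inv₀ fun p hp =>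
      (frameDensity_pos _ hp).ne') continuousOn_const hsrc
  -- Extending the chart and the inverse density by zero keeps `L` measurable on all of `M`. In
  -- coordinates the density cancels, leaving the bounded `D`.
  set L : M → ℝ := fun p => φ.source.piecewise (fun p => (volDensity n x₀ p)⁻¹) (fun _ => 0) p *
    D (φ.source.piecewise φ (fun _ => 0) p)
  have hLm : Measurable L := h2.mul (hD.comp h1)
  have hL0 : ∀ p ∉ φ.source, L p = 0 := fun p hp => by simp [L, hp]
  have hL1 : ∀ p ∈ φ.source, L p = (volDensity n x₀ p)⁻¹ * D (φ p) := fun p hp => by simp [L, hp]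
  refine ⟨L, ⟨hLm.aestronglyMeasurable, ?_⟩, hL0, hL1⟩
  rw [hasFiniteIntegral_iff_enorm]
  set ι : EuclideanSpace ℝ (Fin (n + 1)) →ₗᵢ[ℝ] EuclideanSpace ℝ (Fin (n + 1)) :=
    LinearIsometry.id
  calc ∫⁻ p, ‖L p‖ₑ ∂(μHE[n + 1] : Measure M)
      = ∫⁻ p in φ.source, ‖L p‖ₑ ∂(μHE[n + 1] : Measure M) := by
        refine (setLIntegral_eq_of_support_subset fun p hp => ?_).symm
        by_contra h
        exact hp (by simp [hL0 p h])
    _ = ∫⁻ z, ENNReal.ofReal (chartDensity ι x₀ z) * ‖L (chartParam ι x₀ z)‖ₑ := by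
        rw [euclideanHausdorffMeasure_restrict_source, lintegral_chartMeasure _ hLm.enorm]
    _ ≤ ∫⁻ z, (Metric.ball c r).indicator (fun _ => ENNReal.ofReal A) z := by
        refine lintegral_mono fun z => ?_
        by_cases hz : z ∈ φ.target
        · have hsz := φ.map_target hz
          have hpos : 0 < volDensity n x₀ (φ.symm z) := frameDensity_pos _ hsz
          rw [chartDensity_id hz, chartParam_id hz, hL1 _ hsz, φ.right_inv hz,
            ← ofReal_norm, ← ENNReal.ofReal_mul hpos.le, norm_mul, norm_inv,
            Real.norm_of_nonneg hpos.le, mul_inv_cancel_left₀ hpos.ne']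
          by_cases hzr : z ∈ Metric.ball c r
          · rw [indicator_of_mem hzr]
            exact ENNReal.ofReal_le_ofReal (hA z)
          · simp [hDr z hzr]
        · rw [chartDensity, if_neg (show ι z ∉ (extChartAt (𝓡∂ (n + 1)) x₀).target from hz)]
          simp
    _ < (⊤ : ℝ≥0∞) := by
        rw [lintegral_indicator measurableSet_ball, setLIntegral_const]
        exact ENNReal.mul_lt_top ENNReal.ofReal_lt_top measure_ball_lt_top

/-- Green's formula for `χ ∇ρ` with `χ` supported near a given point. -/
theorem exists_local_green {ρ : M → ℝ} (hρ : ContMDiff (𝓡∂ (n + 1)) 𝓘(ℝ, ℝ) 1 ρ)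
    (hN : ∀ x ∈ (𝓡∂ (n + 1)).boundary M, normalDeriv (n + 1) ρ x = -1)
    (hLip : IsLipschitzField (n + 1) (grad (n + 1) ρ)) (x₀ : M) :
    ∃ N ∈ 𝓝 x₀, ∀ χ : M → ℝ, ContMDiff (𝓡∂ (n + 1)) 𝓘(ℝ, ℝ) 1 χ → tsupport χ ⊆ N →
      (∀ p, 0 ≤ χ p) → ∃ L : M → ℝ, Integrable L (μHE[n + 1] : Measure M) ∧
      ∀ u : M → ℝ, ContMDiff (𝓡∂ (n + 1)) 𝓘(ℝ, ℝ) 1 u →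
        ((∀ p ∈ (𝓡∂ (n + 1)).boundary M, u p = 0) →
          ∫ p, (L p * u p + χ p * inner ℝ (grad (n + 1) ρ p) (grad (n + 1) u p))
            ∂(μHE[n + 1] : Measure M) = 0) ∧
        ((∀ p, 0 ≤ u p) → ∫ p, (L p * u p + χ p * inner ℝ (grad (n + 1) ρ p)
            (grad (n + 1) u p)) ∂(μHE[n + 1] : Measure M) ≤ 0 ∧
          ∫⁻ p in (𝓡∂ (n + 1)).boundary M, ENNReal.ofReal (χ p * u p) ∂(μHE[n] : Measure M) ≤
          ENNReal.ofReal (-∫ p, (L p * u p + χ p * inner ℝ (grad (n + 1) ρ p)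
            (grad (n + 1) u p)) ∂(μHE[n + 1] : Measure M))) := by
  set φ := extChartAt (𝓡∂ (n + 1)) x₀
  set c := φ x₀
  obtain ⟨R, hR, hRt⟩ := exists_closedBall_subset_target (n := n) x₀
  obtain ⟨r', hr', hV⟩ := exists_lipschitzOnWith_coordMap hLip x₀
  set r := min R r'
  have hr : 0 < r := lt_min hR hr'
  have hrt : Metric.closedBall c r ∩ {y | 0 ≤ y 0} ⊆ φ.target :=
    (inter_subset_inter_left _ (Metric.closedBall_subset_closedBall (min_le_left _ _))).trans hRt
  have hbt : Metric.ball c r ∩ {y | 0 ≤ y 0} ⊆ φ.target :=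
    (inter_subset_inter_left _ Metric.ball_subset_closedBall).trans hrt
  -- Half the radius: the field then vanishes off the concentric half-radius ball, as Green's
  -- formula on the half ball requires.
  refine ⟨φ.source ∩ φ ⁻¹' Metric.ball c (r / 2), Filter.inter_mem
    (extChartAt_source_mem_nhds x₀) ((continuousAt_extChartAt x₀).preimage_mem_nhds
      (Metric.ball_mem_nhds _ (half_pos hr))), fun χ hχ hχN hχ0 => ?_⟩
  have hχz : ∀ p, (p ∈ φ.source → φ p ∉ Metric.ball c (r / 2)) → χ p = 0 := by
    intro p hp
    by_contra h
    obtain ⟨h1, h2⟩ := hχN (subset_tsupport _ h)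
    exact hp h1 h2
  have hball : Metric.ball c (r / 2) ⊆ Metric.ball c r :=
    Metric.ball_subset_ball (half_le_self hr.le)
  -- Components of `χ √g ∇ρ`: the Euclidean divergence of this field is `√g` times the Riemannian
  -- divergence of `χ ∇ρ`.
  set X : Fin (n + 1) → EuclideanSpace ℝ (Fin (n + 1)) → ℝ := fun i y =>
    χ (φ.symm y) * volDensity n x₀ (φ.symm y) *
      coordMap (n + 1) x₀ (φ.symm y) (grad (n + 1) ρ (φ.symm y)) i
  have hX : ∀ i, ∃ K, LipschitzOnWith K (X i) (Metric.ball c r ∩ {y | 0 ≤ y 0}) := by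
    intro i
    obtain ⟨K1, hK1⟩ := exists_lipschitzOnWith_of_contDiffOn_target
      (contDiffOn_comp_extChartAt_symm hχ x₀) hrt
    obtain ⟨K2, hK2⟩ := exists_lipschitzOnWith_of_contDiffOn_target (contDiffOn_volDensity x₀) hrt
    obtain ⟨K3, hK3⟩ := hV i
    replace hK3 := hK3.mono (inter_subset_inter_left _
      (Metric.ball_subset_ball (min_le_right R r')))
    obtain ⟨A1, hA1⟩ := LipschitzOnWith.exists_abs_le hK1
    obtain ⟨A2, hA2⟩ := LipschitzOnWith.exists_abs_le hK2
    obtain ⟨A3, hA3⟩ := LipschitzOnWith.exists_abs_le hK3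
    obtain ⟨K4, hK4⟩ := LipschitzOnWith.exists_mul hK1 hK2 hA1 hA2
    obtain ⟨A4, hA4⟩ := LipschitzOnWith.exists_abs_le hK4
    exact LipschitzOnWith.exists_mul hK4 hK3 hA4 hA3
  have hX0 : ∀ i, ∀ y ∈ Metric.ball c r ∩ {y | 0 ≤ y 0}, y ∉ Metric.ball c (r / 2) →
      X i y = 0 := by
    intro i y hy hyr
    have : χ (φ.symm y) = 0 := hχz _ fun _ => by rwa [φ.right_inv (hbt hy)]
    simp [X, this]
  obtain ⟨D, hDm, ⟨A, hDA⟩, hDr, hD⟩ := exists_divergence_halfBall hr hX hX0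
  obtain ⟨L, hL, hL0, hL1⟩ := exists_integrable_div_volDensity x₀ hDm hDA hDr
  refine ⟨L, hL, fun u hu => ?_⟩
  set h : EuclideanSpace ℝ (Fin (n + 1)) → ℝ := u ∘ φ.symm
  have hhc : ContDiffOn ℝ 1 h φ.target := contDiffOn_comp_extChartAt_symm hu x₀
  have hhL : ∃ K, LipschitzOnWith K h (Metric.ball c r ∩ {y | 0 ≤ y 0}) :=
    exists_lipschitzOnWith_of_contDiffOn_target hhc hrt
  have hopen : IsOpen (Metric.ball c r ∩ {y : EuclideanSpace ℝ (Fin (n + 1)) | 0 < y 0}) :=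
    Metric.isOpen_ball.inter isOpen_openHalfSpace
  have hsub : Metric.ball c r ∩ {y : EuclideanSpace ℝ (Fin (n + 1)) | 0 < y 0} ⊆
      Metric.ball c r ∩ {y | 0 ≤ y 0} := fun y hy => ⟨hy.1, (show 0 < y 0 from hy.2).le⟩
  have hnhds : ∀ y ∈ Metric.ball c r ∩ {y | 0 < y 0}, φ.target ∈ 𝓝 y := fun y hy =>
    Filter.mem_of_superset (hopen.mem_nhds hy) (hsub.trans hbt)
  have hhd : ∀ y ∈ Metric.ball c r ∩ {y | 0 < y 0}, DifferentiableAt ℝ h y := fun y hy =>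
    ((hhc.differentiableOn one_ne_zero) y (hbt (hsub hy))).differentiableAt (hnhds y hy)
  have hgreen := hD h hhL hhd
  have hint : ∫ p, (L p * u p + χ p * inner ℝ (grad (n + 1) ρ p) (grad (n + 1) u p))
      ∂(μHE[n + 1] : Measure M) = -∫ z in bdIncl n ⁻¹' Metric.ball c r,
        X 0 (bdIncl n z) * h (bdIncl n z) := by
    have hgm : AEStronglyMeasurable (fun p => L p * u p + χ p *
        inner ℝ (grad (n + 1) ρ p) (grad (n + 1) u p)) (μHE[n + 1] : Measure M) :=
      (hL.aestronglyMeasurable.mul hu.continuous.aestronglyMeasurable).add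
        (hχ.continuous.mul (continuous_inner_grad_grad hρ hu)).aestronglyMeasurable
    rw [← hgreen, integral_eq_setIntegral_halfBall (c := c) (r := r) (x₀ := x₀) hgm hbt]
    · refine setIntegral_congr_fun hopen.measurableSet fun y hy => ?_
      have hyt := hbt (hsub hy)
      have hsz := φ.map_target hyt
      have hpos : 0 < volDensity n x₀ (φ.symm y) := frameDensity_pos _ hsz
      have hder : ∀ i, coordDeriv x₀ u (φ.symm y) i =
          fderiv ℝ h y (EuclideanSpace.single i 1) := fun i => by
        rw [coordDeriv_eq hsz (hu.mdifferentiable one_ne_zero _), φ.right_inv hyt,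
          fderivWithin_of_mem_nhds (hnhds y hy)]
      rw [hL1 _ hsz, φ.right_inv hyt, inner_grad_grad_eq_sum hsz, mul_add, mul_assoc,
        mul_inv_cancel_left₀ hpos.ne', Finset.mul_sum, Finset.mul_sum]
      congr 1
      refine Finset.sum_congr rfl fun i _ => ?_
      rw [hder]
      simp only [X]
      ring
    · intro p hp
      have h1 : L p = 0 := by
        by_cases hps : p ∈ φ.source
        · rw [hL1 p hps, hDr _ (hp hps), mul_zero]
        · exact hL0 p hps
      have h2 : χ p = 0 := hχz p fun hps hb => hp hps (hball hb)
      rw [h1, h2, zero_mul, zero_mul, add_zero]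
  have hbsub : ∀ z ∈ bdIncl n ⁻¹' Metric.ball c r,
      bdIncl n z ∈ Metric.ball c r ∩ {y | 0 ≤ y 0} := fun z hz => ⟨hz, le_refl (0 : ℝ)⟩
  have hbbd : ∀ z ∈ bdIncl n ⁻¹' Metric.ball c r,
      φ.symm (bdIncl n z) ∈ (𝓡∂ (n + 1)).boundary M := fun z hz => by
    have hzt := hbt (hbsub z hz)
    rw [mem_boundary_iff (φ.map_target hzt), φ.right_inv hzt]
    rfl
  have hbm : MeasurableSet (bdIncl n ⁻¹' Metric.ball c r) :=
    (Metric.isOpen_ball.preimage isometry_bdIncl.continuous).measurableSet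
  rw [hint]
  refine ⟨fun hu0 => ?_, fun hu0 => ?_⟩
  · rw [neg_eq_zero]
    refine setIntegral_eq_zero_of_forall_eq_zero fun z hz => ?_
    simp only [h, Function.comp_apply]
    rw [hu0 _ (hbbd z hz), mul_zero]
  -- The normal derivative condition enters here: the component of `∇ρ` along `x⁰` is `|∇x⁰|`, which
  -- turns the volume density into the area density.
  · have hX1 : ∀ z ∈ bdIncl n ⁻¹' Metric.ball c r, X 0 (bdIncl n z) =
        χ (φ.symm (bdIncl n z)) * frameDensity (bdInclₗ n) x₀ (φ.symm (bdIncl n z)) := by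
      intro z hz
      have hsz := φ.map_target (hbt (hbsub z hz))
      simp only [X]
      rw [coordMap_grad_zero_eq_norm hsz (hbbd z hz) (hN _ (hbbd z hz)), mul_assoc, volDensity,
        frameDensity_mul_norm_grad hsz]
    have hbint : IntegrableOn (fun z => X 0 (bdIncl n z) * h (bdIncl n z))
        (bdIncl n ⁻¹' Metric.ball c r) := by
      obtain ⟨K1, hK1⟩ := hX 0
      obtain ⟨K2, hK2⟩ := hhL
      obtain ⟨A1, hA1⟩ := LipschitzOnWith.exists_abs_le hK1
      obtain ⟨A2, hA2⟩ := LipschitzOnWith.exists_abs_le hK2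
      have hfin : volume (bdIncl n ⁻¹' Metric.ball c r) ≠ (⊤ : ℝ≥0∞) := by
        refine (Bornology.IsBounded.measure_lt_top ?_).ne
        rw [Metric.isBounded_iff]
        refine ⟨r + r, fun z hz w hw => ?_⟩
        rw [← isometry_bdIncl.dist_eq]
        exact (dist_triangle_right _ _ c).trans
          (add_le_add (le_of_lt hz) (le_of_lt hw))
      have hcont : ContinuousOn (fun z => X 0 (bdIncl n z) * h (bdIncl n z))
          (bdIncl n ⁻¹' Metric.ball c r) :=
        ContinuousOn.comp (hK1.continuousOn.mul hK2.continuousOn)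
          isometry_bdIncl.continuous.continuousOn hbsub
      refine ⟨hcont.aestronglyMeasurable hbm, ?_⟩
      refine HasFiniteIntegral.restrict_of_bounded (C := A1 * A2) hfin.lt_top ?_
      refine (ae_restrict_iff' hbm).2 (.of_forall fun z hz => ?_)
      rw [norm_mul]
      have h1 := hA1 _ (hbsub z hz)
      have h2 := hA2 _ (hbsub z hz)
      exact mul_le_mul h1 h2 (norm_nonneg _) ((abs_nonneg _).trans h1)
    have hnn : 0 ≤ᵐ[volume.restrict (bdIncl n ⁻¹' Metric.ball c r)]
        fun z => X 0 (bdIncl n z) * h (bdIncl n z) := by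
      refine (ae_restrict_iff' hbm).2 (.of_forall fun z hz => ?_)
      change 0 ≤ X 0 (bdIncl n z) * h (bdIncl n z)
      rw [hX1 z hz]
      exact mul_nonneg (mul_nonneg (hχ0 _) (frameDensity_nonneg _ _ _)) (hu0 _)
    refine ⟨neg_nonpos.2 (integral_nonneg_of_ae hnn), ?_⟩
    rw [neg_neg, ofReal_integral_eq_lintegral_ofReal hbint hnn]
    have hm : Measurable fun p => ENNReal.ofReal (χ p * u p) :=
      (hχ.continuous.mul hu.continuous).measurable.ennreal_ofReal
    refine (lintegral_boundary_le (x₀ := x₀) (c := c) (r := r) hm hbt fun p hp => ?_).trans ?_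
    · rw [hχz p fun hps hb => hp hps (hball hb), zero_mul, ENNReal.ofReal_zero]
    · refine setLIntegral_mono' hbm fun z hz => ?_
      rw [← ENNReal.ofReal_mul (frameDensity_nonneg _ _ _), hX1 z hz]
      refine ENNReal.ofReal_le_ofReal (le_of_eq ?_)
      simp only [h, Function.comp_apply]
      ring

end LocalGreen
end BoundaryVariance

namespace BoundaryVariance

/-! ### Finiteness and positivity of the Riemannian volume. -/

section Volume

variable {n : ℕ} {M : Type*} [EMetricSpace M]
  [ChartedSpace (EuclideanHalfSpace (n + 1)) M] [IsManifold (𝓡∂ (n + 1)) ∞ M]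
  [RiemannianBundle (fun x : M ↦ TangentSpace (𝓡∂ (n + 1)) x)]
  [IsContMDiffRiemannianBundle (𝓡∂ (n + 1)) 1 (EuclideanSpace ℝ (Fin (n + 1)))
    (fun x : M ↦ TangentSpace (𝓡∂ (n + 1)) x)]
  [IsRiemannianManifold (𝓡∂ (n + 1)) M] [MeasurableSpace M] [BorelSpace M]

/-- The Riemannian volume is finite near every point. -/
lemma exists_mem_nhds_measure_lt_top (x₀ : M) :
    ∃ W ∈ 𝓝 x₀, (μHE[n + 1] : Measure M) W < (⊤ : ℝ≥0∞) := by
  set φ := extChartAt (𝓡∂ (n + 1)) x₀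
  obtain ⟨W, hW, hWs, hWe⟩ := exists_edist_le (mem_extChartAt_source (I := 𝓡∂ (n + 1)) x₀)
    (one_lt_two : (1 : ℝ) < 2)
  set W' := W ∩ φ ⁻¹' Metric.ball (φ x₀) 1
  refine ⟨W', Filter.inter_mem hW ((continuousAt_extChartAt x₀).preimage_mem_nhds
    (Metric.ball_mem_nhds _ one_pos)), ?_⟩
  have hlip : LipschitzOnWith (2 * ‖frameMap (n + 1) x₀ x₀‖₊) φ.symm (φ '' W') := by
    rintro _ ⟨q, hq, rfl⟩ _ ⟨q', hq', rfl⟩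
    rw [φ.left_inv (hWs hq.1), φ.left_inv (hWs hq'.1)]
    refine (hWe _ hq.1 _ hq'.1).trans ?_
    rw [edist_comm (φ q), edist_eq_enorm_sub, ENNReal.coe_mul, mul_assoc]
    exact mul_le_mul' (by simp) (ContinuousLinearMap.le_opENorm _ _)
  have hsub : W' ⊆ φ.symm '' (φ '' W') := fun q hq => ⟨φ q, ⟨q, hq, rfl⟩, φ.left_inv (hWs hq.1)⟩
  refine (measure_mono hsub).trans_lt ((euclideanHausdorffMeasure_image_le hlip _).trans_lt ?_)
  rw [EuclideanSpace.euclideanHausdorffMeasure_eq_volume]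
  refine ENNReal.mul_lt_top (ENNReal.pow_lt_top ENNReal.coe_lt_top) ?_
  refine (measure_mono ?_).trans_lt (measure_ball_lt_top (x := φ x₀) (r := 1))
  rintro _ ⟨q, hq, rfl⟩
  exact hq.2

lemma isFiniteMeasure_euclideanHausdorffMeasure [CompactSpace M] :
    IsFiniteMeasure (μHE[n + 1] : Measure M) := by
  have : IsLocallyFiniteMeasure (μHE[n + 1] : Measure M) :=
    ⟨fun x => exists_mem_nhds_measure_lt_top x⟩
  exact ⟨isCompact_univ.measure_lt_top⟩

/-- The Riemannian volume charges nonempty open sets. -/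
lemma isOpenPosMeasure_euclideanHausdorffMeasure :
    (μHE[n + 1] : Measure M).IsOpenPosMeasure := by
  refine ⟨fun U hU ⟨x₀, hx₀⟩ h0 => ?_⟩
  set φ := extChartAt (𝓡∂ (n + 1)) x₀
  have hx : x₀ ∈ φ.source := mem_extChartAt_source x₀
  obtain ⟨W, hW, hWs, hWe⟩ := exists_le_edist hx (one_lt_two : (1 : ℝ) < 2)
  obtain ⟨C, hC, hCv⟩ := exists_norm_le_frameMap hx
  have hlip : LipschitzOnWith (C.toNNReal * 2) φ (U ∩ W) := by
    intro q hq q' hq'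
    have h1 := hWe q hq.2 q' hq'.2
    have h2 : ‖φ q' - φ q‖ₑ ≤ C.toNNReal * ‖frameMap (n + 1) x₀ x₀ (φ q' - φ q)‖ₑ := by
      rw [← ofReal_norm, ← ofReal_norm, ← ENNReal.ofReal, ← ENNReal.ofReal_mul hC.le]
      exact ENNReal.ofReal_le_ofReal (hCv _)
    rw [edist_comm, edist_eq_enorm_sub, ENNReal.coe_mul, mul_assoc]
    refine h2.trans ?_
    gcongr
    exact h1.trans (le_of_eq (by simp))
  -- The chart is Lipschitz near `x₀`, so it maps a null set to a null set; yet the image contains a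
  -- nonempty open half ball.
  have hzero : volume (φ '' (U ∩ W)) = 0 := by
    rw [← EuclideanSpace.euclideanHausdorffMeasure_eq_volume, ← nonpos_iff_eq_zero]
    refine (euclideanHausdorffMeasure_image_le hlip _).trans ?_
    rw [measure_mono_null inter_subset_left h0, mul_zero]
  have hmem : φ '' (U ∩ W) ∈ 𝓝[range (𝓡∂ (n + 1))] (φ x₀) :=
    by
    rw [← map_extChartAt_nhds x₀]
    exact Filter.image_mem_map (Filter.inter_mem (hU.mem_nhds hx₀) hW)
  obtain ⟨ε, hε, hεs⟩ := Metric.mem_nhdsWithin_iff.1 hmem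
  rw [range_modelWithCornersEuclideanHalfSpace] at hεs
  have hopen : IsOpen (Metric.ball (φ x₀) ε ∩ {y : EuclideanSpace ℝ (Fin (n + 1)) | 0 < y 0}) :=
    Metric.isOpen_ball.inter isOpen_openHalfSpace
  have hne : (Metric.ball (φ x₀) ε ∩
      {y : EuclideanSpace ℝ (Fin (n + 1)) | 0 < y 0}).Nonempty := by
    -- Moving inward reaches the open half-space even when `x₀` is a boundary point.
    refine ⟨φ x₀ + (ε / 2) • EuclideanSpace.single 0 1, ?_, ?_⟩
    · rw [Metric.mem_ball, dist_self_add_left, norm_smul, Real.norm_of_nonneg (by positivity)]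
      simp [hε]
    · have := extChartAt_zero_nonneg hx
      simp only [mem_ofPred_eq, PiLp.add_apply, PiLp.smul_apply, PiLp.single_apply,
        if_true, smul_eq_mul, mul_one]
      change 0 < φ x₀ 0 + ε / 2
      have h2 : 0 ≤ φ x₀ 0 := this
      linarith
  refine (hopen.measure_pos volume hne).ne' (measure_mono_null ?_ hzero)
  exact fun y hy => hεs ⟨hy.1, (show 0 < y 0 from hy.2).le⟩

end Volume

/-! ### Global Green's formula and the weak Laplacian. -/

section GlobalGreen

variable {n : ℕ} {M : Type*} [EMetricSpace M] [CompactSpace M]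
  [ChartedSpace (EuclideanHalfSpace (n + 1)) M] [IsManifold (𝓡∂ (n + 1)) ∞ M]
  [RiemannianBundle (fun x : M ↦ TangentSpace (𝓡∂ (n + 1)) x)]
  [IsContMDiffRiemannianBundle (𝓡∂ (n + 1)) 1 (EuclideanSpace ℝ (Fin (n + 1)))
    (fun x : M ↦ TangentSpace (𝓡∂ (n + 1)) x)]
  [IsRiemannianManifold (𝓡∂ (n + 1)) M] [MeasurableSpace M] [BorelSpace M]

lemma _root_.Continuous.integrable_of_compactSpace {X : Type*} [TopologicalSpace X]
    [CompactSpace X] [MeasurableSpace X] [BorelSpace X] [SecondCountableTopology X]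
    {μ : Measure X} [IsFiniteMeasure μ] {f : X → ℝ} (hf : Continuous f) : Integrable f μ := by
  obtain ⟨C, hC⟩ := isCompact_univ.exists_bound_of_continuousOn hf.continuousOn
  exact .of_bound hf.aestronglyMeasurable C (.of_forall fun x => hC x trivial)

lemma integrable_mul_of_continuous {X : Type*} [TopologicalSpace X]
    [CompactSpace X] [MeasurableSpace X] [BorelSpace X] [SecondCountableTopology X]
    {μ : Measure X} {L f : X → ℝ} (hL : Integrable L μ) (hf : Continuous f) :
    Integrable (fun x => L x * f x) μ := by
  obtain ⟨C, hC⟩ := isCompact_univ.exists_bound_of_continuousOn hf.continuousOn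
  exact hL.mul_bdd (c := C) hf.aestronglyMeasurable (.of_forall fun x => hC x trivial)

/-- Green's formula: the boundary measure is the boundary part of the divergence of `∇ρ`. -/
theorem exists_green {ρ : M → ℝ} (hρ : ContMDiff (𝓡∂ (n + 1)) 𝓘(ℝ, ℝ) 1 ρ)
    (hN : ∀ x ∈ (𝓡∂ (n + 1)).boundary M, normalDeriv (n + 1) ρ x = -1)
    (hLip : IsLipschitzField (n + 1) (grad (n + 1) ρ)) :
    ∃ L : M → ℝ, Integrable L (μHE[n + 1] : Measure M) ∧
      ∀ u : M → ℝ, ContMDiff (𝓡∂ (n + 1)) 𝓘(ℝ, ℝ) 1 u →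
        ((∀ p ∈ (𝓡∂ (n + 1)).boundary M, u p = 0) →
          ∫ p, (L p * u p + inner ℝ (grad (n + 1) ρ p) (grad (n + 1) u p))
            ∂(μHE[n + 1] : Measure M) = 0) ∧
        ((∀ p, 0 ≤ u p) →
          ∫⁻ p in (𝓡∂ (n + 1)).boundary M, ENNReal.ofReal (u p) ∂(μHE[n] : Measure M) ≤
          ENNReal.ofReal (-∫ p, (L p * u p + inner ℝ (grad (n + 1) ρ p)
            (grad (n + 1) u p)) ∂(μHE[n + 1] : Measure M))) := by
  have := isFiniteMeasure_euclideanHausdorffMeasure (n := n) (M := M)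
  choose N hNx hNG using exists_local_green hρ hN hLip
  obtain ⟨t, ht⟩ := CompactSpace.elim_nhds_subcover (fun x => interior (N x))
    fun x => interior_mem_nhds.2 (hNx x)
  obtain ⟨χ, hχ⟩ := SmoothPartitionOfUnity.exists_isSubordinate (𝓡∂ (n + 1)) isClosed_univ
    (fun i : t => interior (N i)) (fun i => isOpen_interior) (by
      rw [← top_eq_univ, ← ht]
      exact iUnion₂_subset fun x hx => subset_iUnion (fun i : t => interior (N i)) ⟨x, hx⟩)
  have hχs : ∀ i, ContMDiff (𝓡∂ (n + 1)) 𝓘(ℝ, ℝ) 1 (χ i) := fun i =>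
    (χ i).contMDiff.of_le (by exact_mod_cast le_top)
  have hχ1 : ∀ p, ∑ i, χ i p = 1 := fun p => by
    rw [← finsum_eq_sum_of_fintype]
    exact χ.sum_eq_one (mem_univ p)
  choose L hL hLG using fun i : t => hNG i (χ i) (hχs i) ((hχ i).trans interior_subset)
    (χ.nonneg i)
  -- The `L i` are the divergences of `χ i ∇ρ`, so their sum plays the role of the divergence of
  -- `∇ρ`; no derivative of the cutoffs survives because they add up to 1.
  refine ⟨fun p => ∑ i, L i p, integrable_finsetSum _ fun i _ => hL i, fun u hu => ?_⟩
  have hint : ∀ i, Integrable (fun p => L i p * u p + χ i p *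
      inner ℝ (grad (n + 1) ρ p) (grad (n + 1) u p)) (μHE[n + 1] : Measure M) := fun i =>
    (integrable_mul_of_continuous (hL i) hu.continuous).add
      ((hχs i).continuous.mul (continuous_inner_grad_grad hρ hu)).integrable_of_compactSpace
  have hsum : ∫ p, ((∑ i, L i p) * u p + inner ℝ (grad (n + 1) ρ p) (grad (n + 1) u p))
      ∂(μHE[n + 1] : Measure M) = ∑ i, ∫ p, (L i p * u p + χ i p *
      inner ℝ (grad (n + 1) ρ p) (grad (n + 1) u p)) ∂(μHE[n + 1] : Measure M) := by
    rw [← integral_finsetSum _ fun i _ => hint i]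
    refine integral_congr_ae (.of_forall fun p => ?_)
    simp only
    rw [Finset.sum_add_distrib, ← Finset.sum_mul, ← Finset.sum_mul, hχ1, one_mul]
  rw [hsum]
  refine ⟨fun hu0 => Finset.sum_eq_zero fun i _ => (hLG i u hu).1 hu0, fun hu0 => ?_⟩
  rw [← Finset.sum_neg_distrib, ENNReal.ofReal_sum_of_nonneg fun i _ =>
    neg_nonneg.2 ((hLG i u hu).2 hu0).1]
  calc ∫⁻ p in (𝓡∂ (n + 1)).boundary M, ENNReal.ofReal (u p) ∂(μHE[n] : Measure M)
      = ∫⁻ p in (𝓡∂ (n + 1)).boundary M, ∑ i, ENNReal.ofReal (χ i p * u p)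
          ∂(μHE[n] : Measure M) := by
        refine lintegral_congr fun p => ?_
        rw [← ENNReal.ofReal_sum_of_nonneg fun i _ => mul_nonneg (χ.nonneg i p) (hu0 p),
          ← Finset.sum_mul, hχ1, one_mul]
    _ = ∑ i, ∫⁻ p in (𝓡∂ (n + 1)).boundary M, ENNReal.ofReal (χ i p * u p)
          ∂(μHE[n] : Measure M) :=
        lintegral_finsetSum _ fun i _ =>
          ((hχs i).continuous.mul hu.continuous).measurable.ennreal_ofReal
    _ ≤ _ := Finset.sum_le_sum fun i _ => ((hLG i u hu).2 hu0).2

/-- If the boundary has finite area, Green's formula holds with the weak Laplacian. -/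
theorem lintegral_boundary_le_laplacian {ρ : M → ℝ} (hρ : ContMDiff (𝓡∂ (n + 1)) 𝓘(ℝ, ℝ) 1 ρ)
    (hN : ∀ x ∈ (𝓡∂ (n + 1)).boundary M, normalDeriv (n + 1) ρ x = -1)
    (hLip : IsLipschitzField (n + 1) (grad (n + 1) ρ))
    (hfin : (μHE[n] : Measure M) ((𝓡∂ (n + 1)).boundary M) ≠ (⊤ : ℝ≥0∞)) :
    Integrable (laplacian (n + 1) ρ) (μHE[n + 1] : Measure M) ∧
      ∀ u : M → ℝ, ContMDiff (𝓡∂ (n + 1)) 𝓘(ℝ, ℝ) 1 u → (∀ p, 0 ≤ u p) →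
        ∫⁻ p in (𝓡∂ (n + 1)).boundary M, ENNReal.ofReal (u p) ∂(μHE[n] : Measure M) ≤
          ENNReal.ofReal (-∫ p, (laplacian (n + 1) ρ p * u p + inner ℝ (grad (n + 1) ρ p)
            (grad (n + 1) u p)) ∂(μHE[n + 1] : Measure M)) := by
  have := isFiniteMeasure_euclideanHausdorffMeasure (n := n) (M := M)
  obtain ⟨L, hL, hG⟩ := exists_green hρ hN hLip
  have hw : IsWeakLaplacian (n + 1) ρ L := by
    refine ⟨hL, fun u hu hus => ?_⟩
    have h1 := (hG u hu).1 fun p hp => by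
      by_contra h
      have h2 := hus (subset_tsupport _ h)
      rw [← (𝓡∂ (n + 1)).compl_interior] at hp
      exact hp h2
    rw [integral_add (integrable_mul_of_continuous hL hu.continuous)
      (continuous_inner_grad_grad hρ hu).integrable_of_compactSpace] at h1
    linarith
  have hex : ∃ L : M → ℝ, IsWeakLaplacian (n + 1) ρ L := ⟨L, hw⟩
  have hw' : IsWeakLaplacian (n + 1) ρ (laplacian (n + 1) ρ) := by
    rw [laplacian, dif_pos hex]
    exact hex.choose_spec
  -- `laplacian` is an arbitrary choice among weak Laplacians; the fundamental lemma of the calculus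
  -- of variations shows that any two agree almost everywhere in the interior.
  have hint : ∀ᵐ p ∂(μHE[n + 1] : Measure M), p ∈ (𝓡∂ (n + 1)).interior M →
      laplacian (n + 1) ρ p - L p = 0 := by
    refine IsOpen.ae_eq_zero_of_integral_contMDiff_smul_eq_zero (𝓡∂ (n + 1))
      ((𝓡∂ (n + 1)).isOpen_interior (n := ∞) (by simp))
      ((hw'.1.sub hL).locallyIntegrable.locallyIntegrableOn _) fun g hg _ hgs => ?_
    have hg1 : ContMDiff (𝓡∂ (n + 1)) 𝓘(ℝ, ℝ) 1 g := hg.of_le (by exact_mod_cast le_top)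
    have h1 := (hw'.2 g hg1 hgs).trans (hw.2 g hg1 hgs).symm
    rw [← sub_eq_zero, ← integral_sub (integrable_mul_of_continuous hw'.1 hg.continuous)
      (integrable_mul_of_continuous hL hg.continuous)] at h1
    rw [← h1]
    refine integral_congr_ae (.of_forall fun p => ?_)
    simp only [smul_eq_mul]
    ring
  -- A set of finite `n`-dimensional measure is null in dimension `n + 1`. This is where finiteness
  -- of the boundary area is used.
  have hbd : (μHE[n + 1] : Measure M) ((𝓡∂ (n + 1)).boundary M) = 0 :=
    (Measure.euclideanHausdorffMeasure_zero_or_top (Nat.lt_succ_self n) _).resolve_right hfin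
  have hae : ∀ᵐ p ∂(μHE[n + 1] : Measure M), laplacian (n + 1) ρ p = L p := by
    have h2 : ∀ᵐ p ∂(μHE[n + 1] : Measure M), p ∉ (𝓡∂ (n + 1)).boundary M :=
      measure_eq_zero_iff_ae_notMem.1 hbd
    filter_upwards [hint, h2] with p hp hpb
    rw [← (𝓡∂ (n + 1)).compl_interior, mem_compl_iff, not_not] at hpb
    exact sub_eq_zero.1 (hp hpb)
  refine ⟨hw'.1, fun u hu hu0 => ((hG u hu).2 hu0).trans (le_of_eq ?_)⟩
  congr 2
  refine integral_congr_ae ?_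
  filter_upwards [hae] with p hp
  rw [hp]

end GlobalGreen
end BoundaryVariance

namespace BoundaryVariance

/-! ### Functions with vanishing gradient, and the gradient of a square. -/

section Constancy

variable {d : ℕ} [NeZero d] {M : Type*} [EMetricSpace M]
  [ChartedSpace (EuclideanHalfSpace d) M] [IsManifold (𝓡∂ d) ∞ M]
  [RiemannianBundle (fun x : M ↦ TangentSpace (𝓡∂ d) x)] {f : M → ℝ}

/-- A function with vanishing gradient on a connected manifold is constant. -/
lemma eq_of_grad_eq_zero [PreconnectedSpace M] (hf : ContMDiff (𝓡∂ d) 𝓘(ℝ, ℝ) 1 f)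
    (h0 : ∀ p, grad d f p = 0) (p q : M) : f p = f q := by
  refine IsLocallyConstant.apply_eq_of_preconnectedSpace
    ((IsLocallyConstant.iff_eventually_eq f).2 fun x₀ => ?_) p q
  set φ := extChartAt (𝓡∂ d) x₀
  obtain ⟨ε, hε, hεs⟩ := Metric.mem_nhdsWithin_iff.1
    (extChartAt_target_mem_nhdsWithin (I := 𝓡∂ d) x₀)
  set S := Metric.ball (φ x₀) ε ∩ range (𝓡∂ d)
  -- On a convex half ball a zero within-derivative forces constancy by the mean value inequality,
  -- at boundary points as well.
  have hconv : Convex ℝ S := (convex_ball _ _).inter (𝓡∂ d).convex_range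
  have hdiff : ∀ y ∈ S, HasFDerivWithinAt (f ∘ φ.symm) (0 : EuclideanSpace ℝ (Fin d) →L[ℝ] ℝ)
      S y := by
    intro y hy
    have hyt : y ∈ φ.target := hεs hy
    have hsz := φ.map_target hyt
    have h1 : DifferentiableWithinAt ℝ (f ∘ φ.symm) (range (𝓡∂ d)) y := by
      have h2 := (contDiffOn_comp_extChartAt_symm hf x₀).differentiableOn one_ne_zero y hyt
      refine h2.mono_of_mem_nhdsWithin ?_
      have h3 := extChartAt_target_mem_nhdsWithin' (I := 𝓡∂ d) hsz
      rwa [φ.right_inv hyt] at h3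
    have h2 : fderivWithin ℝ (f ∘ φ.symm) (range (𝓡∂ d)) y = 0 := by
      ext v
      have h3 := mfderiv_frameMap_eq_fderivWithin hsz (hf.mdifferentiable one_ne_zero _) v
      rw [φ.right_inv hyt] at h3
      rw [zero_apply]
      refine h3.symm.trans ((inner_grad f _ _).symm.trans ?_)
      rw [h0, inner_zero_left]
    rw [← h2]
    exact h1.hasFDerivWithinAt.mono inter_subset_right
  have hx₀ : φ x₀ ∈ S := ⟨Metric.mem_ball_self hε, mem_range_self _⟩
  have hconst : ∀ y ∈ S, (f ∘ φ.symm) y = (f ∘ φ.symm) (φ x₀) := fun y hy => by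
    have h1 := hconv.norm_image_sub_le_of_norm_hasFDerivWithin_le (C := 0) hdiff
      (fun y _ => by simp) hx₀ hy
    rw [zero_mul, norm_le_zero_iff, sub_eq_zero] at h1
    exact h1
  filter_upwards [extChartAt_source_mem_nhds (I := 𝓡∂ d) x₀,
    (continuousAt_extChartAt (I := 𝓡∂ d) x₀).preimage_mem_nhds (Metric.ball_mem_nhds _ hε)] with q hq hqb
  have h1 := hconst (φ q) ⟨hqb, mem_range_self _⟩
  rwa [Function.comp_apply, Function.comp_apply, φ.left_inv hq,
    φ.left_inv (mem_extChartAt_source x₀)] at h1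

omit [IsManifold (𝓡∂ d) ∞ M] in
lemma inner_grad_sub_sq (ρ : M → ℝ) {p : M} (hf : MDifferentiableAt (𝓡∂ d) 𝓘(ℝ, ℝ) f p) (a : ℝ) :
    inner ℝ (grad d ρ p) (grad d (fun q => (f q - a) ^ 2) p) =
      2 * (f p - a) * inner ℝ (grad d ρ p) (grad d f p) := by
  rw [real_inner_comm, inner_grad, real_inner_comm (grad d f p), inner_grad]
  have h1 : HasFDerivAt (fun t : ℝ => (t - a) ^ 2)
      ((2 * (f p - a)) • ContinuousLinearMap.id ℝ ℝ) (f p) := by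
    have h2 := ((hasDerivAt_id (f p)).sub_const a).pow 2
    refine h2.hasFDerivAt.congr_fderiv ?_
    ext
    simp
  have h3 := (h1.hasMFDerivAt.comp p hf.hasMFDerivAt).mfderiv
  exact congr($h3 (grad d ρ p))

end Constancy

/-! ### Variance, Poincaré inequality and the final estimate. -/

section Variance

variable {X : Type*} [MeasurableSpace X] {μ : Measure X} [IsProbabilityMeasure μ] {f : X → ℝ}

/-- Used twice: on the boundary, to bound the variance for an arbitrary centre `a`, and on Ω, with
equality when `a` is the mean. -/
lemma integral_sub_sq (h1 : Integrable f μ) (h2 : Integrable (fun x => f x ^ 2) μ) (a : ℝ) :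
    ∫ x, (f x - a) ^ 2 ∂μ = var μ f + (∫ x, f x ∂μ - a) ^ 2 := by
  have h3 : ∀ x, (f x - a) ^ 2 = f x ^ 2 - 2 * a * f x + a ^ 2 := fun x => by ring
  have h4 : Integrable (fun x => f x ^ 2 - 2 * a * f x) μ := h2.sub (h1.const_mul _)
  simp_rw [h3]
  rw [integral_add h4 (integrable_const _),
    integral_sub h2 (h1.const_mul _), integral_const_mul, integral_const, var]
  simp only [probReal_univ, smul_eq_mul]
  ring

end Variance

section Poincare

variable {d : ℕ} [NeZero d] {M : Type*} [EMetricSpace M] [ChartedSpace (EuclideanHalfSpace d) M]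
  [RiemannianBundle (fun x : M ↦ TangentSpace (𝓡∂ d) x)] [MeasurableSpace M]

/-- The Poincaré inequality. -/
lemma ofReal_var_le_poincareConst_mul {μ : Measure M} {f : M → ℝ}
    (hf : ContMDiff (𝓡∂ d) 𝓘(ℝ, ℝ) 1 f) (h0 : energy d μ f ≠ 0)
    (htop : energy d μ f ≠ (⊤ : ℝ≥0∞)) :
    ENNReal.ofReal (var μ f) ≤ poincareConst d μ * energy d μ f := by
  -- Dividing by the energy exhibits the quotient as a lower bound of the admissible constants, so
  -- no minimiser has to be produced; the infimum may be infinite.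
  rw [← ENNReal.div_le_iff h0 htop]
  exact le_sInf fun C hC => ENNReal.div_le_of_le_mul (hC f hf)

end Poincare

section Main

variable {n : ℕ} {M : Type*} [EMetricSpace M] [CompactSpace M] [ConnectedSpace M]
  [ChartedSpace (EuclideanHalfSpace (n + 1)) M] [IsManifold (𝓡∂ (n + 1)) ∞ M]
  [RiemannianBundle (fun x : M ↦ TangentSpace (𝓡∂ (n + 1)) x)]
  [IsContMDiffRiemannianBundle (𝓡∂ (n + 1)) 1 (EuclideanSpace ℝ (Fin (n + 1)))
    (fun x : M ↦ TangentSpace (𝓡∂ (n + 1)) x)]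
  [IsRiemannianManifold (𝓡∂ (n + 1)) M] [MeasurableSpace M] [BorelSpace M]

lemma ofReal_integral_le_lintegral {X : Type*} [MeasurableSpace X] {μ : Measure X} {F : X → ℝ}
    (hF : Integrable F μ) : ENNReal.ofReal (∫ x, F x ∂μ) ≤ ∫⁻ x, ENNReal.ofReal (F x) ∂μ := by
  calc ENNReal.ofReal (∫ x, F x ∂μ) ≤ ENNReal.ofReal (∫ x, max (F x) 0 ∂μ) :=
        ENNReal.ofReal_le_ofReal (integral_mono hF hF.pos_part fun x => le_max_left _ _)
    _ = ∫⁻ x, ENNReal.ofReal (max (F x) 0) ∂μ :=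
        ofReal_integral_eq_lintegral_ofReal hF.pos_part (.of_forall fun x => le_max_right _ _)
    _ = _ := by simp [ENNReal.ofReal_max]

lemma measure_univ_ne_zero : (μHE[n + 1] : Measure M) univ ≠ 0 := by
  have := isOpenPosMeasure_euclideanHausdorffMeasure (n := n) (M := M)
  exact isOpen_univ.measure_ne_zero _ univ_nonempty

lemma volΩ_eq : volΩ (n + 1) M =
    ((μHE[n + 1] : Measure M) univ)⁻¹ • (μHE[n + 1] : Measure M) := by
  rw [volΩ, normalizedHausdorff, Measure.restrict_univ]

lemma isProbabilityMeasure_volΩ : IsProbabilityMeasure (volΩ (n + 1) M) := by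
  have := isFiniteMeasure_euclideanHausdorffMeasure (n := n) (M := M)
  refine ⟨?_⟩
  rw [volΩ_eq, Measure.smul_apply, smul_eq_mul]
  exact ENNReal.inv_mul_cancel measure_univ_ne_zero (measure_ne_top _ _)

lemma lintegral_volume (h : M → ℝ≥0∞) : ∫⁻ p, h p ∂(μHE[n + 1] : Measure M) =
    (μHE[n + 1] : Measure M) univ * ∫⁻ p, h p ∂volΩ (n + 1) M := by
  have := isFiniteMeasure_euclideanHausdorffMeasure (n := n) (M := M)
  rw [volΩ_eq, lintegral_smul_measure, smul_eq_mul, ← mul_assoc,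
    ENNReal.mul_inv_cancel measure_univ_ne_zero (measure_ne_top _ _), one_mul]

lemma energy_ne_top {f : M → ℝ} (hf : ContMDiff (𝓡∂ (n + 1)) 𝓘(ℝ, ℝ) 1 f) :
    energy (n + 1) (volΩ (n + 1) M) f ≠ (⊤ : ℝ≥0∞) := by
  have := isProbabilityMeasure_volΩ (n := n) (M := M)
  have h1 := ((continuous_norm_grad hf).pow 2).integrable_of_compactSpace (μ := volΩ (n + 1) M)
  have h2 := h1.2
  rw [hasFiniteIntegral_iff_enorm] at h2
  refine (lt_of_eq_of_lt (lintegral_congr fun p => ?_) h2).ne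
  simp

/-- The gradient norm is continuous and vanishes almost everywhere, and the volume charges every
nonempty open set. -/
lemma grad_eq_zero_of_energy_eq_zero {f : M → ℝ} (hf : ContMDiff (𝓡∂ (n + 1)) 𝓘(ℝ, ℝ) 1 f)
    (h0 : energy (n + 1) (volΩ (n + 1) M) f = 0) (p : M) : grad (n + 1) f p = 0 := by
  have := isOpenPosMeasure_euclideanHausdorffMeasure (n := n) (M := M)
  have hc := continuous_norm_grad hf
  have h1 : ∫⁻ p, ‖grad (n + 1) f p‖ₑ ^ 2 ∂(μHE[n + 1] : Measure M) = 0 := by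
    rw [lintegral_volume]
    exact mul_eq_zero_of_right _ h0
  have h2 : (fun p => ‖grad (n + 1) f p‖) =ᵐ[(μHE[n + 1] : Measure M)] fun _ => 0 := by
    have hm : Measurable fun p => ‖grad (n + 1) f p‖ₑ ^ 2 := by
      have := (hc.measurable.enorm).pow_const 2
      simpa using this
    filter_upwards [(lintegral_eq_zero_iff hm).1 h1] with p hp
    simpa using hp
  have h3 := (Continuous.ae_eq_iff_eq _ hc continuous_const).1 h2
  exact norm_eq_zero.1 (congrFun h3 p)

/-- The variance bound on a boundary of positive finite area. -/
theorem lintegral_boundary_sub_sq_le {ρ : M → ℝ} (hρ : ContMDiff (𝓡∂ (n + 1)) 𝓘(ℝ, ℝ) 1 ρ)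
    (hN : ∀ x ∈ (𝓡∂ (n + 1)).boundary M, normalDeriv (n + 1) ρ x = -1)
    (hLip : IsLipschitzField (n + 1) (grad (n + 1) ρ))
    (hfin : (μHE[n] : Measure M) ((𝓡∂ (n + 1)).boundary M) ≠ (⊤ : ℝ≥0∞))
    {f : M → ℝ} (hf : ContMDiff (𝓡∂ (n + 1)) 𝓘(ℝ, ℝ) 1 f) (a : ℝ) :
    ∫⁻ p in (𝓡∂ (n + 1)).boundary M, ENNReal.ofReal ((f p - a) ^ 2) ∂(μHE[n] : Measure M) ≤
      (μHE[n + 1] : Measure M) univ *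
        (2 * eLpNorm (fun x ↦ ‖grad (n + 1) ρ x‖) (⊤ : ℝ≥0∞) (volΩ (n + 1) M) *
          ((∫⁻ p, ENNReal.ofReal ((f p - a) ^ 2) ∂volΩ (n + 1) M) ^ (1 / 2 : ℝ) *
            energy (n + 1) (volΩ (n + 1) M) f ^ (1 / 2 : ℝ)) +
        eLpNorm (fun x ↦ max (-laplacian (n + 1) ρ x) 0) (⊤ : ℝ≥0∞) (volΩ (n + 1) M) *
          ∫⁻ p, ENNReal.ofReal ((f p - a) ^ 2) ∂volΩ (n + 1) M) := by
  have := isFiniteMeasure_euclideanHausdorffMeasure (n := n) (M := M)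
  set L := laplacian (n + 1) ρ
  set u : M → ℝ := fun p => (f p - a) ^ 2
  set B := eLpNorm (fun x ↦ ‖grad (n + 1) ρ x‖) (⊤ : ℝ≥0∞) (volΩ (n + 1) M)
  set A := eLpNorm (fun x ↦ max (-L x) 0) (⊤ : ℝ≥0∞) (volΩ (n + 1) M)
  have hu : ContMDiff (𝓡∂ (n + 1)) 𝓘(ℝ, ℝ) 1 u := (hf.sub contMDiff_const).pow 2
  obtain ⟨hL, hG⟩ := lintegral_boundary_le_laplacian hρ hN hLip hfin
  have hint : Integrable (fun p => L p * u p + inner ℝ (grad (n + 1) ρ p) (grad (n + 1) u p))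
      (μHE[n + 1] : Measure M) := (integrable_mul_of_continuous hL hu.continuous).add
    (continuous_inner_grad_grad hρ hu).integrable_of_compactSpace
  refine (hG u hu fun p => sq_nonneg _).trans ?_
  rw [← integral_neg]
  refine (ofReal_integral_le_lintegral hint.neg).trans ?_
  rw [lintegral_volume]
  refine mul_le_mul' le_rfl ?_
  have hB : ∀ᵐ p ∂volΩ (n + 1) M, ‖grad (n + 1) ρ p‖ₑ ≤ B := by
    have h1 := ae_le_eLpNormEssSup (μ := volΩ (n + 1) M) (f := fun x ↦ ‖grad (n + 1) ρ x‖)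
    filter_upwards [h1] with p hp
    rw [enorm_norm] at hp
    simpa [B, eLpNorm_exponent_top] using hp
  have hA : ∀ᵐ p ∂volΩ (n + 1) M, ENNReal.ofReal (-L p) ≤ A := by
    have h1 := ae_le_eLpNormEssSup (μ := volΩ (n + 1) M) (f := fun x ↦ max (-L x) 0)
    filter_upwards [h1] with p hp
    rw [← ofReal_norm, Real.norm_of_nonneg (le_max_right _ _)] at hp
    refine (ENNReal.ofReal_le_ofReal (le_max_left _ _)).trans (hp.trans (le_of_eq ?_))
    rw [← eLpNorm_exponent_top]
  have hgm : Measurable fun p => ‖f p - a‖ₑ :=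
    (hf.continuous.sub continuous_const).measurable.enorm
  have hdm : Measurable fun p => ‖grad (n + 1) f p‖ₑ := by
    simpa using (continuous_norm_grad hf).measurable.enorm
  have hgd : Measurable fun p => ‖f p - a‖ₑ * ‖grad (n + 1) f p‖ₑ := hgm.mul hdm
  have hum : Measurable fun p => ENNReal.ofReal (u p) := hu.continuous.measurable.ennreal_ofReal
  calc ∫⁻ p, ENNReal.ofReal (-(L p * u p + inner ℝ (grad (n + 1) ρ p) (grad (n + 1) u p)))
        ∂volΩ (n + 1) M
      ≤ ∫⁻ p, (2 * B * (‖f p - a‖ₑ * ‖grad (n + 1) f p‖ₑ) + A * ENNReal.ofReal (u p))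
        ∂volΩ (n + 1) M := by
        refine lintegral_mono_ae ?_
        filter_upwards [hA, hB] with p hpA hpB
        rw [inner_grad_sub_sq ρ (hf.mdifferentiable one_ne_zero p) a]
        have h1 : -(L p * u p + 2 * (f p - a) * inner ℝ (grad (n + 1) ρ p) (grad (n + 1) f p)) ≤
            2 * ‖grad (n + 1) ρ p‖ * (‖f p - a‖ * ‖grad (n + 1) f p‖) + -L p * u p := by
          have h2 := abs_real_inner_le_norm (grad (n + 1) ρ p) (grad (n + 1) f p)
          have h3 : |(f p - a) * inner ℝ (grad (n + 1) ρ p) (grad (n + 1) f p)| ≤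
              ‖f p - a‖ * (‖grad (n + 1) ρ p‖ * ‖grad (n + 1) f p‖) := by
            rw [abs_mul, Real.norm_eq_abs]
            gcongr
          have h4 := neg_abs_le ((f p - a) * inner ℝ (grad (n + 1) ρ p) (grad (n + 1) f p))
          nlinarith
        refine (ENNReal.ofReal_le_ofReal h1).trans (ENNReal.ofReal_add_le.trans ?_)
        refine add_le_add ?_ ?_
        · rw [ENNReal.ofReal_mul (by positivity), ENNReal.ofReal_mul (by positivity),
            ENNReal.ofReal_mul (by positivity), ofReal_norm, ofReal_norm, ofReal_norm,
            ENNReal.ofReal_ofNat]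
          gcongr
        · rw [ENNReal.ofReal_mul' (sq_nonneg _)]
          gcongr
    _ = 2 * B * ∫⁻ p, ‖f p - a‖ₑ * ‖grad (n + 1) f p‖ₑ ∂volΩ (n + 1) M +
        A * ∫⁻ p, ENNReal.ofReal (u p) ∂volΩ (n + 1) M := by
        rw [lintegral_add_right _ (hum.const_mul A), lintegral_const_mul _ hgd,
          lintegral_const_mul _ hum]
    _ ≤ _ := by
        refine add_le_add (mul_le_mul' le_rfl ?_) le_rfl
        -- Cauchy-Schwarz for `|f - a|` and `|∇f|`.
        have h1 := ENNReal.lintegral_mul_le_Lp_mul_Lq (volΩ (n + 1) M)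
          Real.HolderConjugate.two_two hgm.aemeasurable hdm.aemeasurable
        refine h1.trans (le_of_eq ?_)
        simp only [ENNReal.rpow_two, energy]
        congr 2
        refine lintegral_congr fun p => ?_
        rw [← ofReal_norm, ← ENNReal.ofReal_pow (norm_nonneg _), Real.norm_eq_abs, sq_abs]

theorem ofReal_var_boundary_le {ρ : M → ℝ} (hρ : ContMDiff (𝓡∂ (n + 1)) 𝓘(ℝ, ℝ) 1 ρ)
    (hN : ∀ x ∈ (𝓡∂ (n + 1)).boundary M, normalDeriv (n + 1) ρ x = -1)
    (hLip : IsLipschitzField (n + 1) (grad (n + 1) ρ))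
    {f : M → ℝ} (hf : ContMDiff (𝓡∂ (n + 1)) 𝓘(ℝ, ℝ) 1 f) :
    ENNReal.ofReal (var (volBd (n + 1) M) f) ≤
      traceConst (n + 1) ρ * energy (n + 1) (volΩ (n + 1) M) f := by
  have := isProbabilityMeasure_volΩ (n := n) (M := M)
  set s := (μHE[n] : Measure M) ((𝓡∂ (n + 1)).boundary M)
  -- `n + 1 - 1` reduces to `n`, so the definitional unfolding suffices.
  have hvol : volBd (n + 1) M = s⁻¹ • (μHE[n] : Measure M).restrict ((𝓡∂ (n + 1)).boundary M) := rfl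
  -- In these degenerate cases the normalised boundary measure is the zero measure and the variance
  -- is 0, so positivity and finiteness of the area need not be proved.
  by_cases hs : s = 0 ∨ s = (⊤ : ℝ≥0∞)
  · have h0 : volBd (n + 1) M = 0 := by
      rw [hvol]
      rcases hs with hs | hs
      · rw [Measure.restrict_eq_zero.2 hs, smul_zero]
      · rw [hs, ENNReal.inv_top, zero_smul]
    simp [h0, var]
  obtain ⟨hs0, hsfin⟩ := not_or.1 hs
  have hprob : IsProbabilityMeasure (volBd (n + 1) M) := by
    refine ⟨?_⟩
    rw [hvol, Measure.smul_apply, Measure.restrict_apply_univ, smul_eq_mul]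
    exact ENNReal.inv_mul_cancel hs0 hsfin
  have hc : ∀ a, Continuous fun p => (f p - a) ^ 2 := fun a =>
    (hf.continuous.sub continuous_const).pow 2
  have hvar : ∀ a, ENNReal.ofReal (var (volBd (n + 1) M) f) ≤
      s⁻¹ * ∫⁻ p in (𝓡∂ (n + 1)).boundary M, ENNReal.ofReal ((f p - a) ^ 2)
        ∂(μHE[n] : Measure M) := by
    intro a
    have h1 := integral_sub_sq (μ := volBd (n + 1) M) hf.continuous.integrable_of_compactSpace
      (hf.continuous.pow 2).integrable_of_compactSpace a
    have h2 : var (volBd (n + 1) M) f ≤ ∫ p, (f p - a) ^ 2 ∂volBd (n + 1) M := by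
      rw [h1]
      exact le_add_of_nonneg_right (sq_nonneg _)
    refine (ENNReal.ofReal_le_ofReal h2).trans (le_of_eq ?_)
    rw [ofReal_integral_eq_lintegral_ofReal (hc a).integrable_of_compactSpace
      (.of_forall fun p => sq_nonneg _), hvol, lintegral_smul_measure, smul_eq_mul]
  -- With zero energy the division behind the Poincaré inequality is unavailable; connectedness
  -- makes `f` constant instead.
  by_cases hE0 : energy (n + 1) (volΩ (n + 1) M) f = 0
  · have hconst := eq_of_grad_eq_zero hf (grad_eq_zero_of_energy_eq_zero hf hE0)
    obtain ⟨p₀⟩ : Nonempty M := inferInstance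
    refine (hvar (f p₀)).trans ?_
    simp [hconst _ p₀]
  set E := energy (n + 1) (volΩ (n + 1) M) f
  set C := poincareConst (n + 1) (volΩ (n + 1) M)
  -- The centre is the mean over Ω rather than over the boundary, so that the Poincaré inequality
  -- applies to `(f - a)^2`.
  set a := ∫ p, f p ∂volΩ (n + 1) M
  have hv : ∫⁻ p, ENNReal.ofReal ((f p - a) ^ 2) ∂volΩ (n + 1) M ≤ C * E := by
    rw [← ofReal_integral_eq_lintegral_ofReal (hc a).integrable_of_compactSpace
      (.of_forall fun p => sq_nonneg _), integral_sub_sq hf.continuous.integrable_of_compactSpace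
      (hf.continuous.pow 2).integrable_of_compactSpace, sub_self, zero_pow two_ne_zero, add_zero]
    exact ofReal_var_le_poincareConst_mul hf hE0 (energy_ne_top hf)
  refine (hvar a).trans ?_
  refine (mul_le_mul' le_rfl (lintegral_boundary_sub_sq_le hρ hN hLip hsfin hf a)).trans ?_
  have hsq : (C * E) ^ (1 / 2 : ℝ) * E ^ (1 / 2 : ℝ) = C ^ (1 / 2 : ℝ) * E := by
    rw [ENNReal.mul_rpow_of_nonneg _ _ (by norm_num), mul_assoc,
      ← ENNReal.rpow_add_of_nonneg _ _ (by norm_num) (by norm_num)]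
    norm_num
  calc _ ≤ s⁻¹ * ((μHE[n + 1] : Measure M) univ *
        (2 * eLpNorm (fun x ↦ ‖grad (n + 1) ρ x‖) (⊤ : ℝ≥0∞) (volΩ (n + 1) M) *
          ((C * E) ^ (1 / 2 : ℝ) * E ^ (1 / 2 : ℝ)) +
        eLpNorm (fun x ↦ max (-laplacian (n + 1) ρ x) 0) (⊤ : ℝ≥0∞) (volΩ (n + 1) M) *
          (C * E))) := by gcongr
    _ = traceConst (n + 1) ρ * E := by
      rw [hsq]
      change _ = (μHE[n + 1] : Measure M) univ / s *
        (2 * eLpNorm (fun x ↦ ‖grad (n + 1) ρ x‖) (⊤ : ℝ≥0∞) (volΩ (n + 1) M) * C ^ (1 / 2 : ℝ) +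
          eLpNorm (fun x ↦ max (-laplacian (n + 1) ρ x) 0) (⊤ : ℝ≥0∞) (volΩ (n + 1) M) * C) * E
      rw [div_eq_mul_inv ((μHE[n + 1] : Measure M) univ) s]
      ring

end Main
end BoundaryVariance

theorem mainTheorem10 (d : ℕ) [NeZero d] (hd : 2 ≤ d)
    {M : Type*} [EMetricSpace M] [CompactSpace M] [ConnectedSpace M]
    [MeasurableSpace M] [BorelSpace M]
    [ChartedSpace (EuclideanHalfSpace d) M] [IsManifold (𝓡∂ d) ∞ M]
    [RiemannianBundle (fun x : M ↦ TangentSpace (𝓡∂ d) x)]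
    [IsContMDiffRiemannianBundle (𝓡∂ d) ∞ (EuclideanSpace ℝ (Fin d))
      (fun x : M ↦ TangentSpace (𝓡∂ d) x)]
    [IsRiemannianManifold (𝓡∂ d) M]
    (hbd : IsConnected ((𝓡∂ d).boundary M))
    (ρ : M → ℝ) (hρ : ContMDiff (𝓡∂ d) 𝓘(ℝ, ℝ) 1 ρ)
    (hN : ∀ x ∈ (𝓡∂ d).boundary M, BoundaryVariance.normalDeriv d ρ x = -1)
    (hLip : BoundaryVariance.IsLipschitzField d (BoundaryVariance.grad d ρ))
    (f : M → ℝ) (hf : ContMDiff (𝓡∂ d) 𝓘(ℝ, ℝ) 1 f) :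
    ENNReal.ofReal (BoundaryVariance.var (BoundaryVariance.volBd d M) f) ≤
      BoundaryVariance.traceConst d ρ *
        BoundaryVariance.energy d (BoundaryVariance.volΩ d M) f := by
  obtain ⟨n, rfl⟩ : ∃ n, d = n + 1 := ⟨d - 1, by omega⟩
  -- A `C¹` metric is enough: the volume density only has to be Lipschitz in charts.
  have : IsContMDiffRiemannianBundle (𝓡∂ (n + 1)) 1 (EuclideanSpace ℝ (Fin (n + 1)))
      (fun x : M ↦ TangentSpace (𝓡∂ (n + 1)) x) :=
    IsContMDiffRiemannianBundle.of_le (n := ∞) (by exact_mod_cast le_top)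
  exact BoundaryVariance.ofReal_var_boundary_le hρ hN hLip hf
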